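/- Fix a real number $\alpha\ge 1$. An instance of $k$-clustering consists of a set $X$ of $n\ge 2$ points, a metric $d$ on $X$ and a positive integer $k$. A solution is a family of (closed) balls centred at points of $X$ whose union contains $X$; its cost is the sum of the $\alpha$-th powers of the radii, and $\mathrm{opt}$ denotes the least cost of a solution with at most $k$ balls. Let $L = 1+\log_2\Delta$, where $\Delta$ is the aspect ratio of $X$, that is, the ratio of the maximum and the minimum distance between two distinct points of $X$. There are a randomized algorithm and a constant $C$, both depending only on $\alpha$, such that for all instances $(X,d,k)$ and all $\varepsilon>0$ the following holds on input $(n,k,\varepsilon,(d(x_i,x_j))_{i,j})$. The algorithm always halts within $$ n^{\,C\,\left(\frac{L\log_2 n}{\min\{\varepsilon,1\}}\right)^{\alpha} L} $$ steps, that is, for $\varepsilon \le 1$, in time $n^{O((L\log n/\varepsilon)^{\alpha}L)}$; and with probability at least $1-\frac1n$ it returns a solution with at most $(1+\varepsilon)k$ balls whose cost is at most $(1+\varepsilon)\,\mathrm{opt}$. Here an algorithm is a program in a first-order functional language with recursive procedures, whose data are lists and pairs of real numbers, with unit-cost exact operations on a randomized real RAM: $+,-,\times,/$, comparison, $x\mapsto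 x^{\alpha}$ for $x\ge0$, rational constants, pairing and projections, variable access, procedure calls, and independent samples from the uniform distribution on $[0,1]$. -/

import Mathlib

/-! ## The model of computation

A first-order functional language (pure LISP with recursive procedures) over S-expressions whose
atoms are real numbers, with a random source.  Every evaluated node of a program costs one step, and
every such node is one `O(1)`-time action of a randomized real RAM or pointer machine: reading a
variable, allocating a pair, following a pointer, one exact arithmetic operation, one `α`-th power,
one comparison with a branch, one uniform sample from `[0,1]`, one procedure call.  There is no
rounding, and the only constants are rational numbers. -/

/-- Data: real numbers, the empty list and pairs (pairs are pointers to their components). -/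
inductive Val where
  | num (x : ℝ)
  | nil
  | cons (a b : Val)

/-- The real number held by an atom (`0` for other data). -/
def Val.toReal : Val → ℝ
  | .num x => x
  | _ => 0

/-- First component of a pair (`nil` for other data). -/
def Val.fst : Val → Val
  | .cons a _ => a
  | _ => .nil

/-- Second component of a pair (`nil` for other data). -/
def Val.snd : Val → Val
  | .cons _ b => b
  | _ => .nil

/-- LISP lists. -/
def Val.ofList : List Val → Val
  | [] => .nil
  | a :: l => .cons a (Val.ofList l)

inductive UnOp where
  | fst | snd | pow

inductive BinOp where
  | cons | add | sub | mul | div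

/-- `pow` is the map `x ↦ x ^ α` on the nonnegative reals (`α` is the fixed exponent of the cost
function, not a part of the input). -/
noncomputable def UnOp.apply (α : ℝ) : UnOp → Val → Val
  | .fst, v => v.fst
  | .snd, v => v.snd
  | .pow, v => .num (max v.toReal 0 ^ α)

noncomputable def BinOp.apply : BinOp → Val → Val → Val
  | .cons, v, w => .cons v w
  | .add, v, w => .num (v.toReal + w.toReal)
  | .sub, v, w => .num (v.toReal - w.toReal)
  | .mul, v, w => .num (v.toReal * w.toReal)
  | .div, v, w => .num (v.toReal / w.toReal)

/-- Expressions.  Variables are de Bruijn indices. -/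
inductive Expr where
  | var (i : ℕ)
  | const (q : ℚ)
  | nil
  | un (o : UnOp) (a : Expr)
  | bin (o : BinOp) (a b : Expr)
  /-- a fresh uniform sample from `[0,1]` -/
  | rand
  /-- `letIn a b`: evaluate `a`, bind the result to variable `0`, evaluate `b` -/
  | letIn (a b : Expr)
  /-- `ifNil a b c`: if `a` evaluates to `nil` then `b` else `c` -/
  | ifNil (a b c : Expr)
  /-- `ifLe a b c d`: if `a ≤ b` (as real numbers) then `c` else `d` -/
  | ifLe (a b c d : Expr)
  /-- call procedure number `f` with argument `a` -/
  | call (f : ℕ) (a : Expr)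

/-- A program: finitely many one-argument (mutually recursive) procedures and a main expression.
In a procedure body, and in the main expression, variable `0` is the argument. -/
structure Program where
  procs : List Expr
  main : Expr

/-- The outcomes of the random source: a sequence of numbers from `[0,1]`. -/
abbrev Tape : Type := ℕ → unitInterval

/-- The samples are independent and uniformly distributed on `[0,1]`. -/
noncomputable def tapeMeasure : MeasureTheory.Measure Tape :=
  MeasureTheory.Measure.infinitePi fun _ : ℕ =>
    (MeasureTheory.volume : MeasureTheory.Measure unitInterval)

/-- `Eval α P ω env a p v p' t`: with procedures `P`, variables `env` and random source `ω`, of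
which the first `p` samples have been used, `a` evaluates to `v` in exactly `t` steps, after which
the first `p'` samples have been used. -/
inductive Eval (α : ℝ) (P : List Expr) (ω : Tape) :
    List Val → Expr → ℕ → Val → ℕ → ℕ → Prop
  | var {env i p v} : env[i]? = some v → Eval α P ω env (.var i) p v p 1
  | const {env q p} : Eval α P ω env (.const q) p (.num (q : ℝ)) p 1
  | nil {env p} : Eval α P ω env .nil p .nil p 1
  | un {env o a p v p₁ t₁} :
      Eval α P ω env a p v p₁ t₁ →
      Eval α P ω env (.un o a) p (o.apply α v) p₁ (t₁ + 1)
  | bin {env o a b p v p₁ t₁ w p₂ t₂} :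
      Eval α P ω env a p v p₁ t₁ → Eval α P ω env b p₁ w p₂ t₂ →
      Eval α P ω env (.bin o a b) p (o.apply v w) p₂ (t₁ + t₂ + 1)
  | rand {env p} : Eval α P ω env .rand p (.num (ω p : ℝ)) (p + 1) 1
  | letIn {env a b p v p₁ t₁ w p₂ t₂} :
      Eval α P ω env a p v p₁ t₁ → Eval α P ω (v :: env) b p₁ w p₂ t₂ →
      Eval α P ω env (.letIn a b) p w p₂ (t₁ + t₂ + 1)
  | ifNil_nil {env a b c p p₁ t₁ w p₂ t₂} :
      Eval α P ω env a p .nil p₁ t₁ → Eval α P ω env b p₁ w p₂ t₂ →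
      Eval α P ω env (.ifNil a b c) p w p₂ (t₁ + t₂ + 1)
  | ifNil_other {env a b c p v p₁ t₁ w p₂ t₂} :
      Eval α P ω env a p v p₁ t₁ → v ≠ .nil → Eval α P ω env c p₁ w p₂ t₂ →
      Eval α P ω env (.ifNil a b c) p w p₂ (t₁ + t₂ + 1)
  | ifLe_le {env a b c d p v p₁ t₁ w p₂ t₂ u p₃ t₃} :
      Eval α P ω env a p v p₁ t₁ → Eval α P ω env b p₁ w p₂ t₂ → v.toReal ≤ w.toReal →
      Eval α P ω env c p₂ u p₃ t₃ →
      Eval α P ω env (.ifLe a b c d) p u p₃ (t₁ + t₂ + t₃ + 1)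
  | ifLe_gt {env a b c d p v p₁ t₁ w p₂ t₂ u p₃ t₃} :
      Eval α P ω env a p v p₁ t₁ → Eval α P ω env b p₁ w p₂ t₂ → w.toReal < v.toReal →
      Eval α P ω env d p₂ u p₃ t₃ →
      Eval α P ω env (.ifLe a b c d) p u p₃ (t₁ + t₂ + t₃ + 1)
  | call {env f a p v p₁ t₁ body w p₂ t₂} :
      Eval α P ω env a p v p₁ t₁ → P[f]? = some body → Eval α P ω [v] body p₁ w p₂ t₂ →
      Eval α P ω env (.call f a) p w p₂ (t₁ + t₂ + 1)

/-- Evaluation is deterministic once the random source is fixed. -/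
theorem Eval.unique {α : ℝ} {P : List Expr} {ω : Tape} {env : List Val} {a : Expr} {p : ℕ}
    {v : Val} {p' t : ℕ} (h : Eval α P ω env a p v p' t) :
    ∀ {w : Val} {q s : ℕ}, Eval α P ω env a p w q s → v = w ∧ p' = q ∧ t = s := by
  induction h with
  | var h => intro w q s h'; cases h' with | var h'' => simp_all
  | const => intro w q s h'; cases h'; simp
  | nil => intro w q s h'; cases h'; simp
  | rand => intro w q s h'; cases h'; simp
  | un _ ih =>
    intro w q s h'
    cases h' with
    | un h1 => obtain ⟨rfl, rfl, rfl⟩ := ih h1; simp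
  | bin _ _ ih1 ih2 =>
    intro w q s h'
    cases h' with
    | bin h1 h2 =>
      obtain ⟨rfl, rfl, rfl⟩ := ih1 h1
      obtain ⟨rfl, rfl, rfl⟩ := ih2 h2
      simp
  | letIn _ _ ih1 ih2 =>
    intro w q s h'
    cases h' with
    | letIn h1 h2 =>
      obtain ⟨rfl, rfl, rfl⟩ := ih1 h1
      obtain ⟨rfl, rfl, rfl⟩ := ih2 h2
      simp
  | ifNil_nil _ _ ih1 ih2 =>
    intro w q s h'
    cases h' with
    | ifNil_nil h1 h2 =>
      obtain ⟨-, rfl, rfl⟩ := ih1 h1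
      obtain ⟨rfl, rfl, rfl⟩ := ih2 h2
      simp
    | ifNil_other h1 hn h2 => exact absurd (ih1 h1).1.symm hn
  | ifNil_other _ hn _ ih1 ih2 =>
    intro w q s h'
    cases h' with
    | ifNil_nil h1 h2 => exact absurd (ih1 h1).1 hn
    | ifNil_other h1 hn' h2 =>
      obtain ⟨rfl, rfl, rfl⟩ := ih1 h1
      obtain ⟨rfl, rfl, rfl⟩ := ih2 h2
      simp
  | ifLe_le _ _ hl _ ih1 ih2 ih3 =>
    intro w q s h'
    cases h' with
    | ifLe_le h1 h2 _ h3 =>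
      obtain ⟨rfl, rfl, rfl⟩ := ih1 h1
      obtain ⟨rfl, rfl, rfl⟩ := ih2 h2
      obtain ⟨rfl, rfl, rfl⟩ := ih3 h3
      simp
    | ifLe_gt h1 h2 hl' h3 =>
      obtain ⟨rfl, rfl, rfl⟩ := ih1 h1
      obtain ⟨rfl, rfl, rfl⟩ := ih2 h2
      exact absurd hl (not_le.mpr hl')
  | ifLe_gt _ _ hl _ ih1 ih2 ih3 =>
    intro w q s h'
    cases h' with
    | ifLe_le h1 h2 hl' h3 =>
      obtain ⟨rfl, rfl, rfl⟩ := ih1 h1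
      obtain ⟨rfl, rfl, rfl⟩ := ih2 h2
      exact absurd hl' (not_le.mpr hl)
    | ifLe_gt h1 h2 _ h3 =>
      obtain ⟨rfl, rfl, rfl⟩ := ih1 h1
      obtain ⟨rfl, rfl, rfl⟩ := ih2 h2
      obtain ⟨rfl, rfl, rfl⟩ := ih3 h3
      simp
  | call _ hb _ ih1 ih2 =>
    intro w q s h'
    cases h' with
    | call h1 hb' h2 =>
      obtain ⟨rfl, rfl, rfl⟩ := ih1 h1
      obtain rfl : _ = _ := Option.some.inj (hb.symm.trans hb')
      obtain ⟨rfl, rfl, rfl⟩ := ih2 h2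
      simp

/-- On input `input` and random source `ω`, the program `A` halts after exactly `t` steps and
returns `out`. -/
def Program.Runs (A : Program) (α : ℝ) (ω : Tape) (input out : Val) (t : ℕ) : Prop :=
  ∃ p, Eval α A.procs ω [input] A.main 0 out p t

/-! ## Clustering -/

/-- A ball, given by its centre and its radius. -/
structure Ball (X : Type*) where
  center : X
  radius : ℝ
  radius_nonneg : 0 ≤ radius

/-- The balls `{y | d(y, z) ≤ r}` of the family contain all points of `X`. -/
def Covers {X : Type*} [MetricSpace X] (B : List (Ball X)) : Prop :=
  ∀ x : X, ∃ b ∈ B, x ∈ Metric.closedBall b.center b.radius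

/-- The sum of the `α`-th powers of the radii. -/
noncomputable def cost {X : Type*} (α : ℝ) (B : List (Ball X)) : ℝ :=
  (B.map fun b => b.radius ^ α).sum

/-- The cost of an optimal `k`-clustering of `X`. -/
noncomputable def optCost (X : Type*) [MetricSpace X] (α : ℝ) (k : ℕ) : ℝ :=
  sInf {c | ∃ B : List (Ball X), B.length ≤ k ∧ Covers B ∧ cost α B = c}

/-- The ratio of the maximum and the minimum distance between distinct points. -/
noncomputable def aspectRatio (X : Type*) [MetricSpace X] : ℝ :=
  Metric.diam (Set.univ : Set X) / Set.infsep (Set.univ : Set X)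

/-- `L = 1 + log (aspect ratio)`. -/
noncomputable def logAspect (X : Type*) [MetricSpace X] : ℝ :=
  1 + Real.logb 2 (aspectRatio X)

/-- The input `(n, k, ε, D)`, with `D` the `n × n` distance matrix (a list of rows) of the points
of `X` in the order given by `e`. -/
noncomputable def encodeInstance {X : Type*} [MetricSpace X] {n : ℕ} (e : Fin n ≃ X)
    (k : ℕ) (ε : ℝ) : Val :=
  .cons (.num n) (.cons (.num k) (.cons (.num ε)
    (Val.ofList (List.ofFn fun i => Val.ofList (List.ofFn fun j => .num (dist (e i) (e j)))))))

/-- An output: a list of pairs (index of the centre, radius). -/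
noncomputable def encodeBalls {X : Type*} {n : ℕ} (e : Fin n ≃ X) (B : List (Ball X)) : Val :=
  Val.ofList (B.map fun b => .cons (.num ((e.symm b.center : ℕ) : ℝ)) (.num b.radius))

/-!
The algorithm is deterministic: the random choice of a partition in a hierarchical decomposition is
replaced by a search through a short list of partitions, so that the failure probability is `0`.

*Scales.*  A set of diameter at most `D` is solved by recursion on the scales `D, D / 2, …`, of
which there are at most `L`.  Fix the scale `D` and a small radius `r = D / κ`, where `κ` is of the
order of `L log n / ε`.  If a cover has more than `κ ^ α` balls of radius larger than `r`, a single
ball of radius `D` is at least as good.  Otherwise its large balls can be guessed (`guess`,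
`guess_le`): each of them, shrunk as far as possible without losing a point, is determined by its
centre and by a point on its boundary.  The remaining balls have radius at most `r`, and the
remaining points are split by a partition into parts of diameter at most `D / 2`
(`splitSolve_le`), where each small ball is paid for once per part that it meets.

*Partitions.*  Region growing (`carve`) finds a partition for which the balls of radius `r` meet on
average at most `1 + O(δ)` parts, with respect to given weights of the balls (`carve_cost`).
Repeating this with multiplicative updates of the weights gives a family of `O(n log n / δ)`
partitions such that every ball of radius `r` meets at most `1 + 5 δ` parts on average over the
family (`mwu_average`).  Hence for every choice of multipliers of the number and the cost of the
balls, some partition of the family increases the weighted sum by a factor of at most `1 + 5 δ`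
(`exists_partition`).  With `δ = min ε 1 / (20 m)` for `m` scales the total loss is a factor of
`1 + ε / 2` (`approx_solve`).  The multipliers are needed in the analysis only: the solver returns
a table with a cheapest candidate for each number of balls.  With the multipliers `1 / k` and
`1 / c`, for `c` slightly above the optimum, both the number and the cost turn out to be within a
factor of `1 + ε` (`exists_mem_table`).

*Running time.*  A call of the solver branches into polynomially many calls for each of the `κ ^ α`
guesses and into one call for each part of each partition of the family at each scale.  This gives
`n ^ O(κ ^ α L)` steps (`tSolve_lt`, `TimeParams.powBounded_time`).

*The program.*  `algorithm` implements this in the given language.  A weakest-precondition calculus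
(`wp`, `wp_sound`) reduces statements on evaluation to statements on the procedures that are
called. It counts only the steps spent in calls; each body has at most `300` nodes, which bounds
its own steps.
-/

namespace KClustering

/-! ### A weakest-precondition calculus for programs without random choices -/

/-- Procedure `f` of the program `P`, called with argument `v`, returns `w` within `T` steps and
uses no random samples. -/
def Halts (α : ℝ) (P : List Expr) (f : ℕ) (v w : Val) (T : ℕ) : Prop :=
  ∃ body, P[f]? = some body ∧ ∀ ω p, ∃ t ≤ T, Eval α P ω [v] body p w p t

/-- The number of nodes of an expression, an upper bound for the steps of one evaluation that are
not spent inside procedure calls. -/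
def size : Expr → ℕ
  | .var _ => 1
  | .const _ => 1
  | .nil => 1
  | .un _ a => size a + 1
  | .bin _ a b => size a + size b + 1
  | .rand => 1
  | .letIn a b => size a + size b + 1
  | .ifNil a b c => size a + size b + size c + 1
  | .ifLe a b c d => size a + size b + size c + size d + 1
  | .call _ a => size a + 1

/-- Case distinction on whether `v` is the empty list. -/
def caseNil (v : Val) (p q : Prop) : Prop := (v = .nil → p) ∧ (v ≠ .nil → q)

/-- Case distinction on the order of two numbers. -/
def caseLe (x y : ℝ) (p q : Prop) : Prop := (x ≤ y → p) ∧ (y < x → q)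

/-- Procedure `f` with argument `v` returns some `w` within some time `t` such that `Q w t`. -/
def calls (α : ℝ) (P : List Expr) (f : ℕ) (v : Val) (Q : Val → ℕ → Prop) : Prop :=
  ∃ w t, Halts α P f v w t ∧ Q w t

/-- `wp α P a env Q`: the evaluation of `a` in the environment `env` yields a value `v` and spends
at most `t` steps inside procedure calls, for some `v` and `t` with `Q v t`. -/
def wp (α : ℝ) (P : List Expr) : Expr → List Val → (Val → ℕ → Prop) → Prop
  | .var i, env, Q => ∃ v, env[i]? = some v ∧ Q v 0
  | .const q, _, Q => Q (.num (q : ℝ)) 0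
  | .nil, _, Q => Q .nil 0
  | .un o a, env, Q => wp α P a env fun v t => Q (o.apply α v) t
  | .bin o a b, env, Q => wp α P a env fun v t => wp α P b env fun w t' => Q (o.apply v w) (t + t')
  | .rand, _, _ => False
  | .letIn a b, env, Q => wp α P a env fun v t => wp α P b (v :: env) fun w t' => Q w (t + t')
  | .ifNil a b c, env, Q => wp α P a env fun v t =>
      caseNil v (wp α P b env fun w t' => Q w (t + t')) (wp α P c env fun w t' => Q w (t + t'))
  | .ifLe a b c d, env, Q => wp α P a env fun v t => wp α P b env fun w t' =>
      caseLe v.toReal w.toReal (wp α P c env fun u t'' => Q u (t + t' + t''))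
        (wp α P d env fun u t'' => Q u (t + t' + t''))
  | .call f a, env, Q => wp α P a env fun v t => calls α P f v fun w t' => Q w (t + t')

/-- The steps outside procedure calls number at most `size a`, since without loops every node of an
expression is evaluated at most once. -/
theorem wp_sound {α : ℝ} {P : List Expr} (a : Expr) : ∀ {env : List Val} {Q : Val → ℕ → Prop},
    wp α P a env Q →
      ∃ v t, Q v t ∧ ∀ ω p, ∃ s ≤ t + size a, Eval α P ω env a p v p s := by
  induction a with
  | var i =>
    rintro env Q ⟨v, hv, hQ⟩
    exact ⟨v, 0, hQ, fun ω p => ⟨1, by simp [size], .var hv⟩⟩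
  | const q => exact fun h => ⟨_, _, h, fun ω p => ⟨1, by simp [size], .const⟩⟩
  | nil => exact fun h => ⟨_, _, h, fun ω p => ⟨1, by simp [size], .nil⟩⟩
  | un o a iha =>
    intro env Q h
    obtain ⟨v, t, hQ, he⟩ := iha h
    refine ⟨_, t, hQ, fun ω p => ?_⟩
    obtain ⟨s, hs, he⟩ := he ω p
    exact ⟨s + 1, by simp only [size]; omega, .un he⟩
  | bin o a b iha ihb =>
    intro env Q h
    obtain ⟨v, t, h', he⟩ := iha h
    obtain ⟨w, t', hQ, he'⟩ := ihb h'
    refine ⟨_, _, hQ, fun ω p => ?_⟩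
    obtain ⟨s, hs, he⟩ := he ω p
    obtain ⟨s', hs', he'⟩ := he' ω p
    exact ⟨s + s' + 1, by simp only [size]; omega, .bin he he'⟩
  | rand => exact fun h => h.elim
  | letIn a b iha ihb =>
    intro env Q h
    obtain ⟨v, t, h', he⟩ := iha h
    obtain ⟨w, t', hQ, he'⟩ := ihb h'
    refine ⟨_, _, hQ, fun ω p => ?_⟩
    obtain ⟨s, hs, he⟩ := he ω p
    obtain ⟨s', hs', he'⟩ := he' ω p
    exact ⟨s + s' + 1, by simp only [size]; omega, .letIn he he'⟩
  | ifNil a b c iha ihb ihc =>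
    intro env Q h
    obtain ⟨v, t, h', he⟩ := iha h
    by_cases hv : v = .nil
    · obtain ⟨w, t', hQ, he'⟩ := ihb (h'.1 hv)
      refine ⟨_, _, hQ, fun ω p => ?_⟩
      obtain ⟨s, hs, he⟩ := he ω p
      obtain ⟨s', hs', he'⟩ := he' ω p
      exact ⟨s + s' + 1, by simp only [size]; omega, .ifNil_nil (hv ▸ he) he'⟩
    · obtain ⟨w, t', hQ, he'⟩ := ihc (h'.2 hv)
      refine ⟨_, _, hQ, fun ω p => ?_⟩
      obtain ⟨s, hs, he⟩ := he ω p
      obtain ⟨s', hs', he'⟩ := he' ω p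
      exact ⟨s + s' + 1, by simp only [size]; omega, .ifNil_other he hv he'⟩
  | ifLe a b c d iha ihb ihc ihd =>
    intro env Q h
    obtain ⟨v, t, h', he⟩ := iha h
    obtain ⟨w, t', h'', he'⟩ := ihb h'
    rcases le_or_gt v.toReal w.toReal with hl | hl
    · obtain ⟨u, t'', hQ, he''⟩ := ihc (h''.1 hl)
      refine ⟨_, _, hQ, fun ω p => ?_⟩
      obtain ⟨s, hs, he⟩ := he ω p
      obtain ⟨s', hs', he'⟩ := he' ω p
      obtain ⟨s'', hs'', he''⟩ := he'' ω p
      exact ⟨s + s' + s'' + 1, by simp only [size]; omega, .ifLe_le he he' hl he''⟩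
    · obtain ⟨u, t'', hQ, he''⟩ := ihd (h''.2 hl)
      refine ⟨_, _, hQ, fun ω p => ?_⟩
      obtain ⟨s, hs, he⟩ := he ω p
      obtain ⟨s', hs', he'⟩ := he' ω p
      obtain ⟨s'', hs'', he''⟩ := he'' ω p
      exact ⟨s + s' + s'' + 1, by simp only [size]; omega, .ifLe_gt he he' hl he''⟩
  | call f a iha =>
    intro env Q h
    obtain ⟨v, t, ⟨w, t', ⟨body, hb, hw⟩, hQ⟩, he⟩ := iha h
    refine ⟨w, _, hQ, fun ω p => ?_⟩
    obtain ⟨s, hs, he⟩ := he ω p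
    obtain ⟨s', hs', he'⟩ := hw ω p
    exact ⟨s + s' + 1, by simp only [size]; omega, .call he hb he'⟩

theorem Halts.of_wp {α : ℝ} {P : List Expr} {f : ℕ} {body : Expr} {v w : Val} {T : ℕ}
    (hf : P[f]? = some body) (hs : size body ≤ 300)
    (h : wp α P body [v] fun w' t => w' = w ∧ t + 300 ≤ T) : Halts α P f v w T := by
  obtain ⟨w', t, ⟨rfl, ht⟩, he⟩ := wp_sound body h
  refine ⟨body, hf, fun ω p => ?_⟩
  obtain ⟨s, hs, he⟩ := he ω p
  exact ⟨s, by omega, he⟩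

theorem calls.intro {α : ℝ} {P : List Expr} {f : ℕ} {v w : Val} {T : ℕ} {Q : Val → ℕ → Prop}
    (h : Halts α P f v w T) (hQ : Q w T) : calls α P f v Q := ⟨w, T, h, hQ⟩

theorem caseLe.intro {x y : ℝ} {p q : Prop} (h₁ : x ≤ y → p) (h₂ : y < x → q) :
    caseLe x y p q := ⟨h₁, h₂⟩

theorem caseNil.intro {v : Val} {p q : Prop} (h₁ : v = .nil → p) (h₂ : v ≠ .nil → q) :
    caseNil v p q := ⟨h₁, h₂⟩

theorem caseNil_nil (p q : Prop) : caseNil .nil p q ↔ p := by simp [caseNil]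

theorem caseNil_cons (a b : Val) (p q : Prop) : caseNil (.cons a b) p q ↔ q := by simp [caseNil]

theorem wp_var_zero (α : ℝ) (P : List Expr) (v : Val) (env : List Val) (Q : Val → ℕ → Prop) :
    wp α P (.var 0) (v :: env) Q ↔ Q v 0 := by simp [wp]

theorem wp_var_succ (α : ℝ) (P : List Expr) (i : ℕ) (v : Val) (env : List Val)
    (Q : Val → ℕ → Prop) : wp α P (.var (i + 1)) (v :: env) Q ↔ wp α P (.var i) env Q := by
  simp [wp]

theorem wp_const (α : ℝ) (P : List Expr) (q : ℚ) (env : List Val) (Q : Val → ℕ → Prop) :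
    wp α P (.const q) env Q ↔ Q (.num (q : ℝ)) 0 := Iff.rfl

theorem wp_nil (α : ℝ) (P : List Expr) (env : List Val) (Q : Val → ℕ → Prop) :
    wp α P .nil env Q ↔ Q .nil 0 := Iff.rfl

theorem wp_un (α : ℝ) (P : List Expr) (o : UnOp) (a : Expr) (env : List Val)
    (Q : Val → ℕ → Prop) :
    wp α P (.un o a) env Q ↔ wp α P a env fun v t => Q (o.apply α v) t := Iff.rfl

theorem wp_bin (α : ℝ) (P : List Expr) (o : BinOp) (a b : Expr) (env : List Val)
    (Q : Val → ℕ → Prop) :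
    wp α P (.bin o a b) env Q ↔
      wp α P a env fun v t => wp α P b env fun w t' => Q (o.apply v w) (t + t') := Iff.rfl

theorem wp_letIn (α : ℝ) (P : List Expr) (a b : Expr) (env : List Val) (Q : Val → ℕ → Prop) :
    wp α P (.letIn a b) env Q ↔
      wp α P a env fun v t => wp α P b (v :: env) fun w t' => Q w (t + t') := Iff.rfl

theorem wp_ifNil (α : ℝ) (P : List Expr) (a b c : Expr) (env : List Val) (Q : Val → ℕ → Prop) :
    wp α P (.ifNil a b c) env Q ↔ wp α P a env fun v t =>
      caseNil v (wp α P b env fun w t' => Q w (t + t'))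
        (wp α P c env fun w t' => Q w (t + t')) := Iff.rfl

theorem wp_ifLe (α : ℝ) (P : List Expr) (a b c d : Expr) (env : List Val)
    (Q : Val → ℕ → Prop) :
    wp α P (.ifLe a b c d) env Q ↔ wp α P a env fun v t => wp α P b env fun w t' =>
      caseLe v.toReal w.toReal (wp α P c env fun u t'' => Q u (t + t' + t''))
        (wp α P d env fun u t'' => Q u (t + t' + t'')) := Iff.rfl

theorem wp_call (α : ℝ) (P : List Expr) (f : ℕ) (a : Expr) (env : List Val)
    (Q : Val → ℕ → Prop) :
    wp α P (.call f a) env Q ↔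
      wp α P a env fun v t => calls α P f v fun w t' => Q w (t + t') := Iff.rfl

theorem Halts.mono {α : ℝ} {P : List Expr} {f : ℕ} {v w : Val} {T T' : ℕ}
    (h : Halts α P f v w T) (hT : T ≤ T') : Halts α P f v w T' := by
  obtain ⟨body, hf, he⟩ := h
  refine ⟨body, hf, fun ω p => ?_⟩
  obtain ⟨s, hs, he⟩ := he ω p
  exact ⟨s, hs.trans hT, he⟩

noncomputable section

/-! ### Partitions by region growing -/

variable {X : Type} [MetricSpace X]

/-- The points of `S` in the closed ball around `c` of radius `R`. -/
def near (c : X) (R : ℝ) (S : List X) : List X := S.filter fun x => dist c x ≤ R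

/-- The points of `S` outside the closed ball around `c` of radius `R`. -/
def far (c : X) (R : ℝ) (S : List X) : List X := S.filter fun x => ¬ dist c x ≤ R

theorem mem_near {c x : X} {R : ℝ} {S : List X} : x ∈ near c R S ↔ x ∈ S ∧ dist c x ≤ R := by
  simp [near]

theorem mem_far {c x : X} {R : ℝ} {S : List X} : x ∈ far c R S ↔ x ∈ S ∧ R < dist c x := by
  simp [far]

theorem length_near_le (c : X) (R : ℝ) (S : List X) : (near c R S).length ≤ S.length :=
  List.length_filter_le _ _

theorem length_far_le (c : X) (R : ℝ) (S : List X) : (far c R S).length ≤ S.length :=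
  List.length_filter_le _ _

theorem length_near_add_far (c : X) (R : ℝ) (S : List X) :
    (near c R S).length + (far c R S).length = S.length := by
  induction S with
  | nil => rfl
  | cons x S ih =>
    by_cases h : dist c x ≤ R
    · simp [near, far, h, not_lt.2 h] at ih ⊢; omega
    · simp [near, far, h, not_le.1 h] at ih ⊢; omega

theorem length_far_lt {c x : X} {R : ℝ} {S : List X} (hx : x ∈ S) (h : dist c x ≤ R) :
    (far c R S).length < S.length := by
  have h1 := length_near_add_far c R S
  have h2 : 0 < (near c R S).length := List.length_pos_of_mem (mem_near.2 ⟨hx, h⟩)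
  omega

theorem far_near_comm (c v : X) (r ρ : ℝ) (S : List X) :
    far v ρ (near c r S) = near c r (far v ρ S) := by
  simp only [far, near, List.filter_filter, Bool.and_comm]

/-- The weight of the points `c` of `pts` within distance `R` of `v` whose ball of radius `r` still
meets the remaining set `rem`. -/
def vol (pts : List X) (w : X → ℝ) (r : ℝ) (rem : List X) (v : X) (R : ℝ) : ℝ :=
  (pts.map fun c => if dist v c ≤ R ∧ near c r rem ≠ [] then w c else 0).sum

/-- Starting from `R`, increase the radius in steps of `s` until the volume `V` grows by a factor of
at most `1 + δ` in the next step, but at most `f` times. -/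
def grow (V : ℝ → ℝ) (s δ : ℝ) : ℕ → ℝ → ℝ
  | 0, R => R
  | f + 1, R => if V (R + s) ≤ (1 + δ) * V R then R else grow V s δ f (R + s)

/-- Removes balls from `rem`, with radii found by region growing, until nothing is left.  The result
lists the centres and radii of these balls.  It encodes the partition of the points in which a point
belongs to the first ball containing it. -/
def carve (pts : List X) (w : X → ℝ) (r δ base : ℝ) (T : ℕ) : ℕ → List X → List (X × ℝ)
  | 0, _ => []
  | _ + 1, [] => []
  | f + 1, v :: rem =>
    let ρ := grow (fun R => vol pts w r (v :: rem) v R + base) (2 * r) δ T 0 + r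
    (v, ρ) :: carve pts w r δ base T f (far v ρ (v :: rem))

/-- The number of parts of the partition `P` that `U` meets. -/
def meet : List X → List (X × ℝ) → ℕ
  | _, [] => 0
  | U, q :: P => (if near q.1 q.2 U = [] then 0 else 1) + meet (far q.1 q.2 U) P

/-- Every point of `S` belongs to some part of the partition `P`. -/
def Exhausts (P : List (X × ℝ)) (S : List X) : Prop := ∀ x ∈ S, ∃ q ∈ P, dist q.1 x ≤ q.2

theorem Exhausts.far {P : List (X × ℝ)} {S : List X} {q : X × ℝ} (h : Exhausts (q :: P) S) :
    Exhausts P (far q.1 q.2 S) := by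
  intro x hx
  rw [mem_far] at hx
  obtain ⟨q', hq', hd⟩ := h x hx.1
  rcases List.mem_cons.1 hq' with rfl | hq'
  · exact absurd hd (not_le.2 hx.2)
  · exact ⟨q', hq', hd⟩

theorem meet_le_length (U : List X) (P : List (X × ℝ)) : meet U P ≤ P.length := by
  induction P generalizing U with
  | nil => simp [meet]
  | cons q P ih =>
    have := ih (far q.1 q.2 U)
    simp only [meet, List.length_cons]
    split_ifs <;> omega

theorem one_le_meet {U : List X} {P : List (X × ℝ)} (hU : U ≠ []) (h : Exhausts P U) :
    1 ≤ meet U P := by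
  induction P generalizing U with
  | nil =>
    obtain ⟨x, hx⟩ := List.exists_mem_of_ne_nil U hU
    obtain ⟨q, hq, -⟩ := h x hx
    simp at hq
  | cons q P ih =>
    by_cases hn : near q.1 q.2 U = []
    · have hf : far q.1 q.2 U ≠ [] := by
        intro hf
        have := length_near_add_far q.1 q.2 U
        rw [hn, hf] at this
        exact hU (List.length_eq_zero_iff.1 (by simpa using this.symm))
      have := ih hf h.far
      simp only [meet]; omega
    · simp only [meet, if_neg hn]; omega

theorem exhausts_carve (pts : List X) (w : X → ℝ) (r δ base : ℝ) (T : ℕ) {f : ℕ} {rem : List X}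
    (hg : ∀ (V : ℝ → ℝ), 0 ≤ grow V (2 * r) δ T 0) (hr : 0 ≤ r)
    (hf : rem.length ≤ f) : Exhausts (carve pts w r δ base T f rem) rem := by
  induction f generalizing rem with
  | zero => obtain rfl := List.length_eq_zero_iff.1 (Nat.le_zero.1 hf); intro x hx; simp at hx
  | succ f ih =>
    cases rem with
    | nil => intro x hx; simp at hx
    | cons v rem =>
      intro x hx
      simp only [carve]
      set ρ := grow (fun R => vol pts w r (v :: rem) v R + base) (2 * r) δ T 0 + r with hρ
      have h0 : 0 ≤ ρ := add_nonneg (hg _) hr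
      by_cases hd : dist v x ≤ ρ
      · exact ⟨_, List.mem_cons_self, hd⟩
      · have hlt : (far v ρ (v :: rem)).length < (v :: rem).length :=
          length_far_lt List.mem_cons_self (by simpa using h0)
        obtain ⟨q, hq, hqx⟩ := ih (rem := far v ρ (v :: rem)) (by omega) x
          (mem_far.2 ⟨hx, not_le.1 hd⟩)
        exact ⟨q, List.mem_cons_of_mem _ hq, hqx⟩

theorem length_carve_le (pts : List X) (w : X → ℝ) (r δ base : ℝ) (T f : ℕ) (rem : List X) :
    (carve pts w r δ base T f rem).length ≤ f := by
  induction f generalizing rem with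
  | zero => simp [carve]
  | succ f ih =>
    cases rem with
    | nil => simp [carve]
    | cons v rem => simpa [carve] using ih _

theorem grow_mem_Icc (V : ℝ → ℝ) {s : ℝ} (hs : 0 ≤ s) (δ : ℝ) (f : ℕ) (R : ℝ) :
    R ≤ grow V s δ f R ∧ grow V s δ f R ≤ R + f * s := by
  induction f generalizing R with
  | zero => simp [grow]
  | succ f ih =>
    simp only [grow]
    split_ifs
    · exact ⟨le_rfl, le_add_of_nonneg_right (by positivity)⟩
    · have := ih (R + s)
      push_cast
      constructor <;> linarith [this.1, this.2]

theorem carve_radius_le (pts : List X) (w : X → ℝ) {r : ℝ} (hr : 0 ≤ r) (δ base : ℝ) (T : ℕ)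
    {f : ℕ} {rem : List X} {q : X × ℝ} (hq : q ∈ carve pts w r δ base T f rem) :
    q.2 ≤ (2 * T + 1) * r := by
  induction f generalizing rem with
  | zero => simp [carve] at hq
  | succ f ih =>
    cases rem with
    | nil => simp [carve] at hq
    | cons v rem =>
      simp only [carve, List.mem_cons] at hq
      rcases hq with rfl | hq
      · have := (grow_mem_Icc (fun R => vol pts w r (v :: rem) v R + base)
          (by positivity : 0 ≤ 2 * r) δ T 0).2
        dsimp only
        linarith
      · exact ih hq

/-- Growth by a factor of more than `1 + δ` cannot happen `f` times if the volume is bounded. -/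
theorem grow_spec {V : ℝ → ℝ} {s δ B : ℝ} (hδ : 0 ≤ δ) (hB : ∀ R, V R < B) (f : ℕ) (R : ℝ)
    (h : B ≤ V R * (1 + δ) ^ f) :
    V (grow V s δ f R + s) ≤ (1 + δ) * V (grow V s δ f R) := by
  induction f generalizing R with
  | zero => exact absurd h (not_le.2 (by simpa using hB R))
  | succ f ih =>
    simp only [grow]
    split_ifs with hc
    · exact hc
    · refine ih _ (h.trans ?_)
      rw [pow_succ]
      have : 0 ≤ (1 + δ) ^ f := by positivity
      nlinarith [mul_le_mul_of_nonneg_left (not_le.1 hc).le this]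

theorem sum_map_le {ι : Type*} {l : List ι} {f g : ι → ℝ} (h : ∀ i ∈ l, f i ≤ g i) :
    (l.map f).sum ≤ (l.map g).sum :=
  List.sum_le_sum h

theorem sum_map_add' {ι : Type*} (l : List ι) (f g : ι → ℝ) :
    (l.map fun i => f i + g i).sum = (l.map f).sum + (l.map g).sum :=
  List.sum_map_add

theorem sum_map_mul_left' {ι : Type*} (l : List ι) (a : ℝ) (f : ι → ℝ) :
    (l.map fun i => a * f i).sum = a * (l.map f).sum :=
  List.sum_map_mul_left l f a

theorem sum_map_nonneg {ι : Type*} {l : List ι} {f : ι → ℝ} (h : ∀ i ∈ l, 0 ≤ f i) :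
    0 ≤ (l.map f).sum := by
  refine List.sum_nonneg fun x hx => ?_
  obtain ⟨i, hi, rfl⟩ := List.mem_map.1 hx
  exact h i hi

/-- If every step of the region growing ends with slow growth, then the weighted number of parts
met by the balls of radius `r` exceeds the weight of these balls only slightly.  A ball around `c`
that meets the part just removed has its centre within the enlarged radius; the balls around the
centres within the smaller radius have no points left afterwards, so that the volumes to which the
cut balls are charged are disjoint. -/
theorem carve_cost {pts : List X} {w : X → ℝ} {r δ base : ℝ} {T : ℕ} (hw : ∀ c, 0 ≤ w c)
    (hδ : 0 ≤ δ) (hb : 0 ≤ base)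
    (hg : ∀ rem v, let V := fun R => vol pts w r rem v R + base
      V (grow V (2 * r) δ T 0 + 2 * r) ≤ (1 + δ) * V (grow V (2 * r) δ T 0))
    (f : ℕ) (rem : List X) :
    (pts.map fun c => w c * (meet (near c r rem) (carve pts w r δ base T f rem) : ℝ)).sum ≤
      (1 + δ) * (pts.map fun c => if near c r rem ≠ [] then w c else 0).sum + f * (δ * base) := by
  have hpos : ∀ rem : List X, 0 ≤ (pts.map fun c => if near c r rem ≠ [] then w c else 0).sum :=
    fun rem => sum_map_nonneg fun c _ => by split_ifs; exacts [hw c, le_rfl]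
  induction f generalizing rem with
  | zero =>
    have := hpos rem
    simp only [carve, meet, Nat.cast_zero, mul_zero, List.map_const', List.sum_replicate, smul_zero]
    positivity
  | succ f ih =>
    cases rem with
    | nil =>
      have := hpos []
      simp only [carve, meet, Nat.cast_zero, mul_zero, List.map_const', List.sum_replicate,
        smul_zero]
      positivity
    | cons v rem =>
      have hg' := hg (v :: rem) v
      simp only [carve]
      set R := grow (fun R => vol pts w r (v :: rem) v R + base) (2 * r) δ T 0 with hR
      have hIH := ih (far v (R + r) (v :: rem))
      set S := v :: rem
      have h1 : (pts.map fun c => w c * (meet (near c r S)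
            ((v, R + r) :: carve pts w r δ base T f (far v (R + r) S)) : ℝ)).sum ≤
          vol pts w r S v (R + 2 * r) + (pts.map fun c => w c * (meet (near c r (far v (R + r) S))
            (carve pts w r δ base T f (far v (R + r) S)) : ℝ)).sum := by
        rw [vol, ← sum_map_add']
        refine sum_map_le fun c _ => ?_
        simp only [meet, far_near_comm, Nat.cast_add, mul_add]
        gcongr
        by_cases hn : near v (R + r) (near c r S) = []
        · simp only [hn, if_true, Nat.cast_zero, mul_zero]
          split_ifs; exacts [hw c, le_rfl]
        · obtain ⟨x, hx⟩ := List.exists_mem_of_ne_nil _ hn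
          rw [mem_near, mem_near] at hx
          have hc : dist v c ≤ R + 2 * r := by
            have := dist_triangle_right v c x
            linarith [hx.1.2, hx.2]
          rw [if_neg hn, if_pos ⟨hc, List.ne_nil_of_mem (mem_near.2 hx.1)⟩]
          simp
      have h2 : (pts.map fun c => if near c r (far v (R + r) S) ≠ [] then w c else 0).sum +
          vol pts w r S v R ≤ (pts.map fun c => if near c r S ≠ [] then w c else 0).sum := by
        rw [vol, ← sum_map_add']
        refine sum_map_le fun c _ => ?_
        by_cases hn : near c r (far v (R + r) S) = []
        · simp only [hn, ne_eq, not_true_eq_false, if_false, zero_add]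
          by_cases hc : dist v c ≤ R ∧ near c r S ≠ []
          · rw [if_pos hc, if_pos hc.2]
          · rw [if_neg hc]; split_ifs; exacts [le_rfl, hw c]
        · obtain ⟨x, hx⟩ := List.exists_mem_of_ne_nil _ hn
          rw [mem_near, mem_far] at hx
          have h3 : near c r S ≠ [] := List.ne_nil_of_mem (mem_near.2 ⟨hx.1.1, hx.2⟩)
          have h4 : ¬ dist v c ≤ R := by
            intro h
            have := dist_triangle v c x
            linarith [hx.1.2, hx.2]
          simp [hn, h3, h4]
      dsimp only at hg'
      rw [← hR] at hg'
      push_cast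
      nlinarith [mul_le_mul_of_nonneg_left h2 (by positivity : 0 ≤ 1 + δ)]

/-! ### A family of partitions by multiplicative weights -/

/-- Multiplicative update: the weight of a point grows if its ball of radius `r` is cut by `P`. -/
def upd (pts : List X) (r : ℝ) (P : List (X × ℝ)) (w : X → ℝ) : X → ℝ := fun c =>
  w c * (1 + ((meet (near c r pts) P : ℝ) - 1) / pts.length)

/-- A family of `f` partitions, each of them obtained by region growing with respect to weights that
favour the points whose balls were cut by the preceding ones. -/
def mwu (pts : List X) (r δ : ℝ) (T : ℕ) : ℕ → (X → ℝ) → List (List (X × ℝ))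
  | 0, _ => []
  | f + 1, w =>
    let P := carve pts w r δ ((pts.map w).sum / pts.length) T pts.length pts
    P :: mwu pts r δ T f (upd pts r P w)

theorem length_mwu (pts : List X) (r δ : ℝ) (T f : ℕ) (w : X → ℝ) :
    (mwu pts r δ T f w).length = f := by
  induction f generalizing w with
  | zero => rfl
  | succ f ih => simp [mwu, ih]

theorem exists_carve_of_mem_mwu {pts : List X} {r δ : ℝ} {T f : ℕ} {w : X → ℝ}
    {P : List (X × ℝ)} (h : P ∈ mwu pts r δ T f w) :
    ∃ w' base, P = carve pts w' r δ base T pts.length pts := by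
  induction f generalizing w with
  | zero => simp [mwu] at h
  | succ f ih =>
    simp only [mwu, List.mem_cons] at h
    rcases h with rfl | h
    · exact ⟨_, _, rfl⟩
    · exact ih h

/-- One round of region growing cuts little with respect to the current weights.  The average weight
`W / n` is added to all volumes; thus they lie between `W / n` and `(n + 1) * (W / n)`, which bounds
the number of steps, and the `n` parts together are charged only `δ * W` for it. -/
theorem carve_cost_total {pts : List X} {w : X → ℝ} {r δ : ℝ} {T : ℕ} (hw : ∀ c, 0 < w c)
    (hδ : 0 ≤ δ) (hpts : pts ≠ [])
    (hT : (pts.length : ℝ) + 1 < (1 + δ) ^ T) :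
    (pts.map fun c => w c * (meet (near c r pts)
        (carve pts w r δ ((pts.map w).sum / pts.length) T pts.length pts) : ℝ)).sum ≤
      (1 + 2 * δ) * (pts.map w).sum := by
  set W := (pts.map w).sum with hW
  have hn : (0 : ℝ) < pts.length := by
    exact_mod_cast List.length_pos_iff.2 hpts
  have hW0 : 0 < W := by
    rw [hW]
    refine List.sum_pos _ (fun x hx => ?_) (by simpa using hpts)
    obtain ⟨c, -, rfl⟩ := List.mem_map.1 hx
    exact hw c
  have hb : 0 < W / pts.length := by positivity
  have hle : ∀ rem, (pts.map fun c => if near c r rem ≠ [] then w c else 0).sum ≤ W := fun rem =>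
    sum_map_le fun c _ => by split_ifs; exacts [le_rfl, (hw c).le]
  have hvol : ∀ rem v R, 0 ≤ vol pts w r rem v R ∧ vol pts w r rem v R ≤ W := fun rem v R =>
    ⟨sum_map_nonneg fun c _ => by split_ifs; exacts [(hw c).le, le_rfl],
      sum_map_le fun c _ => by split_ifs; exacts [le_rfl, (hw c).le]⟩
  have key := carve_cost (pts := pts) (w := w) (r := r) (T := T) (fun c => (hw c).le) hδ hb.le
    (fun rem v => by
      refine grow_spec (V := fun R => vol pts w r rem v R + W / pts.length)
        (B := W / pts.length * (1 + δ) ^ T) hδ (fun R => ?_) T 0 ?_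
      · have h1 : vol pts w r rem v R + W / pts.length ≤ W / pts.length * (pts.length + 1) := by
          have := (hvol rem v R).2
          have h2 : W / pts.length * pts.length = W := by field_simp
          linarith
        exact h1.trans_lt (mul_lt_mul_of_pos_left hT hb)
      · have := (hvol rem v 0).1
        gcongr
        linarith) pts.length pts
  refine key.trans ?_
  have h2 : (pts.length : ℝ) * (δ * (W / pts.length)) = δ * W := by field_simp
  have h3 := mul_le_mul_of_nonneg_left (hle pts) (by positivity : 0 ≤ 1 + δ)
  linarith

/-- The hypotheses under which region growing within `T` steps cuts little. -/
structure GrowParams (pts : List X) (r δ : ℝ) (T : ℕ) : Prop where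
  mem (x : X) : x ∈ pts
  ne_nil : pts ≠ []
  r_nonneg : 0 ≤ r
  δ_nonneg : 0 ≤ δ
  lt_pow : (pts.length : ℝ) + 1 < (1 + δ) ^ T

theorem GrowParams.exhausts {pts : List X} {r δ : ℝ} {T f : ℕ} {w : X → ℝ} {P : List (X × ℝ)}
    (h : GrowParams pts r δ T) (hP : P ∈ mwu pts r δ T f w) (S : List X) : Exhausts P S := by
  obtain ⟨w', base, rfl⟩ := exists_carve_of_mem_mwu hP
  intro x _
  exact exhausts_carve pts w' r δ base T
    (fun V => (grow_mem_Icc V (by linarith [h.r_nonneg]) δ T 0).1) h.r_nonneg le_rfl x (h.mem x)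

theorem GrowParams.meet_bounds {pts : List X} {r δ : ℝ} {T f : ℕ} {w : X → ℝ}
    {P : List (X × ℝ)} (h : GrowParams pts r δ T) (hP : P ∈ mwu pts r δ T f w) (c : X) :
    (1 : ℝ) ≤ meet (near c r pts) P ∧ (meet (near c r pts) P : ℝ) ≤ pts.length := by
  constructor
  · exact_mod_cast one_le_meet
      (List.ne_nil_of_mem (mem_near.2 ⟨h.mem c, by simpa using h.r_nonneg⟩)) (h.exhausts hP _)
  · obtain ⟨w', base, rfl⟩ := exists_carve_of_mem_mwu hP
    exact_mod_cast (meet_le_length _ _).trans (length_carve_le _ _ _ _ _ _ _ _)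

theorem two_rpow_le_one_add {x : ℝ} (h0 : 0 ≤ x) (h1 : x ≤ 1) : (2 : ℝ) ^ x ≤ 1 + x := by
  have := rpow_one_add_le_one_add_mul_self (s := 1) (by norm_num) h0 h1
  norm_num at this
  linarith

/-- The potential argument of the multiplicative weights method: the weight of `c` grows with the
number of cuts of its ball, while the total weight grows slowly. -/
theorem mwu_potential {pts : List X} {r δ : ℝ} {T : ℕ} (h : GrowParams pts r δ T) (f : ℕ)
    (w : X → ℝ) (hw : ∀ c, 0 < w c) (c : X) :
    w c * 2 ^ (((mwu pts r δ T f w).map fun P => (meet (near c r pts) P : ℝ) - 1).sum /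
      pts.length) ≤ (pts.map w).sum * (1 + 2 * δ / pts.length) ^ f := by
  have hn : (0 : ℝ) < pts.length := by
    exact_mod_cast List.length_pos_iff.2 h.ne_nil
  have hδ := h.δ_nonneg
  induction f generalizing w with
  | zero =>
    simp only [mwu, List.map_nil, List.sum_nil, zero_div, Real.rpow_zero, mul_one, pow_zero]
    refine List.single_le_sum (fun x hx => ?_) _ (List.mem_map_of_mem (h.mem c))
    obtain ⟨c, -, rfl⟩ := List.mem_map.1 hx
    exact (hw c).le
  | succ f ih =>
    have hmem : carve pts w r δ ((pts.map w).sum / pts.length) T pts.length pts ∈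
        mwu pts r δ T (f + 1) w := by simp [mwu]
    have hb := fun c => h.meet_bounds hmem c
    have hcost := carve_cost_total (r := r) hw hδ h.ne_nil h.lt_pow
    simp only [mwu, List.map_cons, List.sum_cons]
    set P := carve pts w r δ ((pts.map w).sum / pts.length) T pts.length pts
    have hb' : ∀ c, 0 ≤ ((meet (near c r pts) P : ℝ) - 1) / pts.length ∧
        ((meet (near c r pts) P : ℝ) - 1) / pts.length ≤ 1 := fun c =>
      ⟨div_nonneg (by linarith [(hb c).1]) hn.le,
        (div_le_one hn).2 (by linarith [(hb c).2])⟩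
    have hw' : ∀ c, 0 < upd pts r P w c := fun c =>
      mul_pos (hw c) (by linarith [(hb' c).1])
    have hIH := ih (upd pts r P w) hw'
    have hsum : (pts.map (upd pts r P w)).sum ≤
        (pts.map w).sum * (1 + 2 * δ / pts.length) := by
      have h1 : (pts.map (upd pts r P w)).sum = (1 - 1 / pts.length) * (pts.map w).sum +
          1 / pts.length * (pts.map fun c => w c * (meet (near c r pts) P : ℝ)).sum := by
        rw [← sum_map_mul_left', ← sum_map_mul_left', ← sum_map_add']
        congr 1
        refine List.map_congr_left fun c _ => ?_
        simp only [upd]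
        ring
      rw [h1]
      have h2 := mul_le_mul_of_nonneg_left hcost (by positivity : 0 ≤ 1 / (pts.length : ℝ))
      refine (add_le_add_right h2 _).trans (le_of_eq ?_)
      ring
    rw [add_div, Real.rpow_add two_pos, ← mul_assoc]
    calc _ ≤ upd pts r P w c * 2 ^ (((mwu pts r δ T f (upd pts r P w)).map
            fun P => (meet (near c r pts) P : ℝ) - 1).sum / pts.length) := by
          gcongr
          exact mul_le_mul_of_nonneg_left (two_rpow_le_one_add (hb' c).1 (hb' c).2) (hw c).le
      _ ≤ _ := hIH
      _ ≤ (pts.map w).sum * (1 + 2 * δ / pts.length) * (1 + 2 * δ / pts.length) ^ f := by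
          gcongr
      _ = _ := by ring

/-- Every ball of radius `r` meets few parts of the partitions of the family on average. -/
theorem mwu_average {pts : List X} {r δ : ℝ} {T : ℕ} (h : GrowParams pts r δ T) {f lg : ℕ}
    (hlg : (pts.length : ℝ) ≤ 2 ^ lg) (hf : pts.length * lg ≤ δ * f) (c : X) :
    ((mwu pts r δ T f fun _ => 1).map fun P => (meet (near c r pts) P : ℝ) - 1).sum ≤
      5 * δ * f := by
  have hn : (0 : ℝ) < pts.length := by
    exact_mod_cast List.length_pos_iff.2 h.ne_nil
  have hδ := h.δ_nonneg
  have hp := mwu_potential h f (fun _ => 1) (fun _ => one_pos) c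
  set E := ((mwu pts r δ T f fun _ => 1).map fun P => (meet (near c r pts) P : ℝ) - 1).sum
  have h1 : (1 + 2 * δ / pts.length : ℝ) ≤ 2 ^ (4 * δ / pts.length) := by
    have h2 : (2 : ℝ) ^ (4 * δ / pts.length) = Real.exp (Real.log 2 * (4 * δ / pts.length)) := by
      rw [Real.rpow_def_of_pos two_pos]
    have h3 := Real.add_one_le_exp (2 * δ / pts.length)
    rw [h2]
    refine (by linarith : 1 + 2 * δ / pts.length ≤ _).trans (h3.trans (Real.exp_le_exp.2 ?_))
    have h4 : (1 : ℝ) / 2 ≤ Real.log 2 := by linarith [Real.log_two_gt_d9]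
    have h5 : 0 ≤ δ / pts.length := by positivity
    calc 2 * δ / pts.length = 1 / 2 * (4 * δ / pts.length) := by ring
      _ ≤ _ := by gcongr
  have h6 : (2 : ℝ) ^ (E / pts.length) ≤ 2 ^ (lg + 4 * δ / pts.length * f) := by
    simp only [one_mul, List.map_const', List.sum_replicate, nsmul_eq_mul, mul_one] at hp
    rw [Real.rpow_add two_pos, Real.rpow_mul two_pos.le, Real.rpow_natCast, Real.rpow_natCast]
    exact hp.trans (by gcongr)
  have h7 := (Real.rpow_le_rpow_left_iff one_lt_two).1 h6
  rw [div_le_iff₀ hn] at h7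
  have h8 : (lg + 4 * δ / pts.length * f) * pts.length = pts.length * lg + 4 * δ * f := by
    field_simp
  linarith

end

noncomputable section

variable {X : Type}

/-! ### Tables of candidate solutions -/

/-- The sum of the `α`-th powers of the radii of a list of balls, given as pairs of a centre and a
radius. -/
def candCost (α : ℝ) (b : List (X × ℝ)) : ℝ := (b.map fun q => q.2 ^ α).sum

/-- Insert a candidate into a table that keeps, for each number of balls, only a cheapest
candidate. -/
def ins (α : ℝ) (c : List (X × ℝ)) : List (List (X × ℝ)) → List (List (X × ℝ))
  | [] => [c]
  | t :: T =>
    if c.length ≤ t.length ∧ t.length ≤ c.length then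
      if candCost α c ≤ candCost α t then c :: T else t :: T
    else t :: ins α c T

/-- Insert the unions of the candidate `a` with the candidates of `T` into `acc`. -/
def row (α : ℝ) (a : List (X × ℝ)) (T acc : List (List (X × ℝ))) : List (List (X × ℝ)) :=
  T.foldr (fun b acc => ins α (a ++ b) acc) acc

/-- Insert the unions of a candidate of `T₁` and a candidate of `T₂` into `acc`. -/
def conv (α : ℝ) (T₁ T₂ acc : List (List (X × ℝ))) : List (List (X × ℝ)) :=
  T₁.foldr (fun a acc => row α a T₂ acc) acc

/-- Some candidate in the table `T` is at least as good as `b` in both respects. -/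
def Dominates (α : ℝ) (T : List (List (X × ℝ))) (b : List (X × ℝ)) : Prop :=
  ∃ t ∈ T, t.length ≤ b.length ∧ candCost α t ≤ candCost α b

/-- The candidates of the table have at most `n` balls, and no two have the same number of balls. -/
def Small (n : ℕ) (T : List (List (X × ℝ))) : Prop :=
  (T.map List.length).Nodup ∧ ∀ t ∈ T, t.length ≤ n

theorem candCost_append (α : ℝ) (a b : List (X × ℝ)) :
    candCost α (a ++ b) = candCost α a + candCost α b := by
  simp [candCost]

theorem candCost_nonneg {α : ℝ} {b : List (X × ℝ)} (h : ∀ q ∈ b, 0 ≤ q.2) :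
    0 ≤ candCost α b :=
  sum_map_nonneg fun q hq => Real.rpow_nonneg (h q hq) α

theorem mem_ins {α : ℝ} {c t : List (X × ℝ)} {T : List (List (X × ℝ))} (h : t ∈ ins α c T) :
    t = c ∨ t ∈ T := by
  induction T with
  | nil => simpa [ins] using h
  | cons s T ih =>
    simp only [ins] at h
    split_ifs at h
    · rcases List.mem_cons.1 h with h | h
      · exact .inl h
      · exact .inr (List.mem_cons_of_mem _ h)
    · exact .inr h
    · rcases List.mem_cons.1 h with h | h
      · exact .inr (h ▸ List.mem_cons_self)
      · exact (ih h).imp_right (List.mem_cons_of_mem _)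

theorem mem_row {α : ℝ} {a t : List (X × ℝ)} {T acc : List (List (X × ℝ))}
    (h : t ∈ row α a T acc) : t ∈ acc ∨ ∃ b ∈ T, t = a ++ b := by
  induction T with
  | nil => exact .inl h
  | cons b T ih =>
    rcases mem_ins h with h | h
    · exact .inr ⟨b, List.mem_cons_self, h⟩
    · rcases ih h with h | ⟨b, hb, h⟩
      · exact .inl h
      · exact .inr ⟨b, List.mem_cons_of_mem _ hb, h⟩

theorem mem_conv {α : ℝ} {t : List (X × ℝ)} {T₁ T₂ acc : List (List (X × ℝ))}
    (h : t ∈ conv α T₁ T₂ acc) : t ∈ acc ∨ ∃ a ∈ T₁, ∃ b ∈ T₂, t = a ++ b := by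
  induction T₁ with
  | nil => exact .inl h
  | cons a T ih =>
    rcases mem_row h with h | ⟨b, hb, h⟩
    · rcases ih h with h | ⟨a, ha, h⟩
      · exact .inl h
      · exact .inr ⟨a, List.mem_cons_of_mem _ ha, h⟩
    · exact .inr ⟨a, List.mem_cons_self, b, hb, h⟩

theorem Small.ins {α : ℝ} {n : ℕ} {c : List (X × ℝ)} {T : List (List (X × ℝ))} (h : Small n T)
    (hc : c.length ≤ n) : Small n (ins α c T) := by
  refine ⟨?_, fun t ht => (mem_ins ht).elim (fun h => h ▸ hc) (h.2 t)⟩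
  have hd := h.1
  clear h
  induction T with
  | nil => simp [KClustering.ins]
  | cons s T ih =>
    rw [List.map_cons, List.nodup_cons] at hd
    simp only [KClustering.ins]
    split_ifs with h1
    · rw [List.map_cons, List.nodup_cons, le_antisymm h1.1 h1.2]; exact hd
    · rwa [List.map_cons, List.nodup_cons]
    · rw [List.map_cons, List.nodup_cons]
      refine ⟨fun hs => ?_, ih hd.2⟩
      obtain ⟨t, ht, hts⟩ := List.mem_map.1 hs
      rcases mem_ins ht with rfl | ht
      · exact h1 ⟨hts.le, hts.ge⟩
      · exact hd.1 (hts ▸ List.mem_map_of_mem ht)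

theorem Small.row {α : ℝ} {n : ℕ} {a : List (X × ℝ)} {T acc : List (List (X × ℝ))}
    (h : Small n acc) (hT : ∀ b ∈ T, a.length + b.length ≤ n) : Small n (row α a T acc) := by
  induction T with
  | nil => exact h
  | cons b T ih =>
    exact (ih fun b hb => hT b (List.mem_cons_of_mem _ hb)).ins
      (by simpa using hT b List.mem_cons_self)

theorem Small.conv {α : ℝ} {n : ℕ} {T₁ T₂ acc : List (List (X × ℝ))}
    (h : Small n acc) (hT : ∀ a ∈ T₁, ∀ b ∈ T₂, a.length + b.length ≤ n) :
    Small n (conv α T₁ T₂ acc) := by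
  induction T₁ with
  | nil => exact h
  | cons a T ih =>
    exact (ih fun b hb => hT b (List.mem_cons_of_mem _ hb)).row (hT a List.mem_cons_self)

theorem Small.length_le {n : ℕ} {T : List (List (X × ℝ))} (h : Small n T) : T.length ≤ n + 1 := by
  have h1 := List.toFinset_card_of_nodup h.1
  have h2 : (T.map List.length).toFinset ⊆ Finset.range (n + 1) := by
    intro k hk
    obtain ⟨t, ht, rfl⟩ := List.mem_map.1 (List.mem_toFinset.1 hk)
    exact Finset.mem_range.2 (Nat.lt_succ_of_le (h.2 t ht))
  have h3 := Finset.card_le_card h2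
  rwa [h1, List.length_map, Finset.card_range] at h3

theorem Small.mono {m n : ℕ} {T : List (List (X × ℝ))} (h : Small m T) (hmn : m ≤ n) :
    Small n T :=
  ⟨h.1, fun t ht => (h.2 t ht).trans hmn⟩

theorem small_nil (n : ℕ) : Small n ([] : List (List (X × ℝ))) := ⟨by simp, by simp⟩

theorem small_unit (n : ℕ) : Small n [([] : List (X × ℝ))] := ⟨by simp, by simp⟩

theorem dominates_of_mem {α : ℝ} {T : List (List (X × ℝ))} {b : List (X × ℝ)} (h : b ∈ T) :
    Dominates α T b := ⟨b, h, le_rfl, le_rfl⟩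

theorem dominates_ins_self (α : ℝ) (c : List (X × ℝ)) (T : List (List (X × ℝ))) :
    Dominates α (ins α c T) c := by
  induction T with
  | nil => exact dominates_of_mem (by simp [ins])
  | cons s T ih =>
    simp only [ins]
    split_ifs with h1 h2
    · exact dominates_of_mem List.mem_cons_self
    · exact ⟨s, List.mem_cons_self, h1.2, (not_le.1 h2).le⟩
    · obtain ⟨t, ht, h⟩ := ih
      exact ⟨t, List.mem_cons_of_mem _ ht, h⟩

theorem Dominates.ins {α : ℝ} {b : List (X × ℝ)} {T : List (List (X × ℝ))}
    (h : Dominates α T b) (c : List (X × ℝ)) : Dominates α (ins α c T) b := by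
  obtain ⟨t, ht, hl, hc⟩ := h
  induction T with
  | nil => simp at ht
  | cons s T ih =>
    simp only [KClustering.ins]
    rcases List.mem_cons.1 ht with rfl | ht'
    · split_ifs with h1 h2
      · exact ⟨c, List.mem_cons_self, h1.1.trans hl, h2.trans hc⟩
      · exact ⟨t, List.mem_cons_self, hl, hc⟩
      · exact ⟨t, List.mem_cons_self, hl, hc⟩
    · split_ifs
      · exact ⟨t, List.mem_cons_of_mem _ ht', hl, hc⟩
      · exact ⟨t, List.mem_cons_of_mem _ ht', hl, hc⟩
      · obtain ⟨u, hu, h⟩ := ih ht'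
        exact ⟨u, List.mem_cons_of_mem _ hu, h⟩

theorem Dominates.row {α : ℝ} {b : List (X × ℝ)} {acc : List (List (X × ℝ))}
    (h : Dominates α acc b) (a : List (X × ℝ)) (T : List (List (X × ℝ))) :
    Dominates α (row α a T acc) b := by
  induction T with
  | nil => exact h
  | cons c T ih => exact ih.ins _

theorem Dominates.conv {α : ℝ} {b : List (X × ℝ)} {acc : List (List (X × ℝ))}
    (h : Dominates α acc b) (T₁ T₂ : List (List (X × ℝ))) :
    Dominates α (conv α T₁ T₂ acc) b := by
  induction T₁ with
  | nil => exact h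
  | cons c T ih => exact ih.row _ _

theorem dominates_row {α : ℝ} {a b : List (X × ℝ)} {T acc : List (List (X × ℝ))} (hb : b ∈ T) :
    Dominates α (row α a T acc) (a ++ b) := by
  induction T with
  | nil => simp at hb
  | cons c T ih =>
    rcases List.mem_cons.1 hb with rfl | hb
    · exact dominates_ins_self _ _ _
    · exact (ih hb).ins _

theorem dominates_conv {α : ℝ} {a b : List (X × ℝ)} {T₁ T₂ acc : List (List (X × ℝ))}
    (ha : a ∈ T₁) (hb : b ∈ T₂) : Dominates α (conv α T₁ T₂ acc) (a ++ b) := by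
  induction T₁ with
  | nil => simp at ha
  | cons c T ih =>
    rcases List.mem_cons.1 ha with rfl | ha
    · exact dominates_row hb
    · exact (ih ha).row _ _

/-- The weight of a list of balls: `a` for each ball plus `lam` times their cost. -/
def weight (α a lam : ℝ) (b : List (X × ℝ)) : ℝ := (b.map fun q => a + lam * q.2 ^ α).sum

theorem weight_nonneg {α a lam : ℝ} (ha : 0 ≤ a) (hlam : 0 ≤ lam) {b : List (X × ℝ)}
    (hb : ∀ q ∈ b, 0 ≤ q.2) : 0 ≤ weight α a lam b :=
  sum_map_nonneg fun q hq => add_nonneg ha (mul_nonneg hlam (Real.rpow_nonneg (hb q hq) α))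

theorem weight_eq (α a lam : ℝ) (b : List (X × ℝ)) :
    weight α a lam b = a * b.length + lam * candCost α b := by
  rw [weight, sum_map_add', sum_map_mul_left', candCost]
  simp [mul_comm]

theorem candCost_filter (α : ℝ) (p : X × ℝ → Bool) (b : List (X × ℝ)) :
    candCost α b = candCost α (b.filter p) + candCost α (b.filter fun q => !p q) := by
  induction b with
  | nil => simp [candCost]
  | cons q b ih =>
    cases h : p q
    · simp [candCost, h] at ih ⊢; linarith
    · simp [candCost, h] at ih ⊢; linarith

theorem length_filter_add (p : X × ℝ → Bool) (b : List (X × ℝ)) :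
    b.length = (b.filter p).length + (b.filter fun q => !p q).length := by
  induction b with
  | nil => simp
  | cons q b ih =>
    cases h : p q
    · simp [h]; omega
    · simp [h]; omega

/-- The table `T` contains a solution that exceeds the number and the cost of the balls `b` by
amounts of weight at most `θ` times the weight of `b`. -/
def Approx (α a lam θ : ℝ) (b : List (X × ℝ)) (T : List (List (X × ℝ))) : Prop :=
  ∃ t ∈ T, ∃ e₁ e₂ : ℝ, 0 ≤ e₁ ∧ 0 ≤ e₂ ∧ (t.length : ℝ) ≤ b.length + e₁ ∧
    candCost α t ≤ candCost α b + e₂ ∧ a * e₁ + lam * e₂ ≤ θ * weight α a lam b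

theorem Approx.of_le {α a lam θ : ℝ} (ha : 0 ≤ a) (hlam : 0 ≤ lam) (hθ : 0 ≤ θ)
    {b : List (X × ℝ)} (hb : ∀ q ∈ b, 0 ≤ q.2) {T : List (List (X × ℝ))}
    (h : Dominates α T b) : Approx α a lam θ b T := by
  obtain ⟨t, ht, h1, h2⟩ := h
  refine ⟨t, ht, 0, 0, le_rfl, le_rfl, by simpa using h1, by simpa using h2, ?_⟩
  simpa using mul_nonneg hθ (weight_nonneg ha hlam hb)

/-- A cheapest candidate among those with at most `K` balls, if there is one. -/
def pick (α K : ℝ) : List (List (X × ℝ)) → Option (List (X × ℝ))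
  | [] => none
  | t :: T =>
    if (t.length : ℝ) ≤ K then
      match pick α K T with
      | none => some t
      | some u => if candCost α t ≤ candCost α u then some t else some u
    else pick α K T

theorem exists_pick_eq_some {α K : ℝ} {T : List (List (X × ℝ))} {t : List (X × ℝ)} (ht : t ∈ T)
    (hK : (t.length : ℝ) ≤ K) :
    ∃ u ∈ T, pick α K T = some u ∧ (u.length : ℝ) ≤ K ∧ candCost α u ≤ candCost α t := by
  induction T generalizing t with
  | nil => simp at ht
  | cons s T ih =>
    rw [pick]
    rcases List.mem_cons.1 ht with rfl | ht
    · rw [if_pos hK]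
      by_cases hex : ∃ s ∈ T, (s.length : ℝ) ≤ K
      · obtain ⟨s, hs, hsK⟩ := hex
        obtain ⟨u, hu, hpu, huK, -⟩ := ih hs hsK
        rw [hpu]
        dsimp only
        split_ifs with h
        · exact ⟨t, List.mem_cons_self, rfl, hK, le_rfl⟩
        · exact ⟨u, List.mem_cons_of_mem _ hu, rfl, huK, (not_le.1 h).le⟩
      · have hnone : ∀ T' : List (List (X × ℝ)), (∀ s ∈ T', ¬ (s.length : ℝ) ≤ K) →
            pick α K T' = none := by
          intro T' h
          induction T' with
          | nil => rfl
          | cons s T' ih' =>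
            rw [pick, if_neg (h s List.mem_cons_self)]
            exact ih' fun s hs => h s (List.mem_cons_of_mem _ hs)
        rw [hnone T fun s hs hK => hex ⟨s, hs, hK⟩]
        exact ⟨t, List.mem_cons_self, rfl, hK, le_rfl⟩
    · obtain ⟨u, hu, hpu, huK, hut⟩ := ih ht hK
      rw [hpu]
      split_ifs with h
      · dsimp only
        split_ifs with h'
        · exact ⟨s, List.mem_cons_self, rfl, h, h'.trans hut⟩
        · exact ⟨u, List.mem_cons_of_mem _ hu, rfl, huK, hut⟩
      · exact ⟨u, List.mem_cons_of_mem _ hu, rfl, huK, hut⟩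

/-! ### The recursive solver -/

variable [MetricSpace X]

/-- Solve the parts of the partition `P` of `S` separately and combine the tables. -/
def splitSolve (α : ℝ) (sol : List X → List (List (X × ℝ))) :
    List X → List (X × ℝ) → List (List (X × ℝ))
  | [], _ => [[]]
  | _ :: _, [] => []
  | x :: S, q :: P =>
    conv α (sol (near q.1 q.2 (x :: S))) (splitSolve α sol (far q.1 q.2 (x :: S)) P) []

/-- Try all partitions of the family `F`. -/
def famSolve (α : ℝ) (sol : List X → List (List (X × ℝ))) (F : List (List (X × ℝ))) (S : List X) :
    List (List (X × ℝ)) :=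
  F.foldr (fun P acc => conv α (splitSolve α sol S P) [[]] acc) []

/-- Try all choices of at most `m` balls, each of them with a point of `S` on its boundary, and
apply `base` to the points of `S` that are not covered by these balls. -/
def guess (α : ℝ) (pts : List X) (base : List X → List (List (X × ℝ))) :
    ℕ → List X → List (List (X × ℝ))
  | _, [] => [[]]
  | 0, x :: S => base (x :: S)
  | m + 1, y :: S =>
    pts.foldr (fun c acc => (y :: S).foldr (fun x acc =>
      conv α (guess α pts base m (far c (dist c x) (y :: S))) [[(c, dist c x)]] acc) acc)
      (base (y :: S))

/-- The table of solutions for a set of points, given the families of partitions of the remaining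
scales. -/
def solve (α : ℝ) (pts : List X) (M : ℕ) :
    List (List (List (X × ℝ))) → List X → List (List (X × ℝ))
  | [] => guess α pts (fun _ => []) M
  | F :: Fs => guess α pts (famSolve α (solve α pts M Fs) F) M

/-- `b` is a cover of `S` by at most `|S|` balls of nonnegative radius. -/
def Valid (S : List X) (b : List (X × ℝ)) : Prop :=
  (∀ x ∈ S, ∃ q ∈ b, dist q.1 x ≤ q.2) ∧ (∀ q ∈ b, 0 ≤ q.2) ∧ b.length ≤ S.length

/-- All candidates of the table are covers of `S`, and no two have the same number of balls. -/
def ValidTable (S : List X) (T : List (List (X × ℝ))) : Prop :=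
  (∀ t ∈ T, Valid S t) ∧ Small S.length T

theorem validTable_unit : ValidTable ([] : List X) [[]] :=
  ⟨fun t ht => by obtain rfl := List.mem_singleton.1 ht; simp [Valid], small_unit _⟩

theorem ValidTable.conv {α : ℝ} {S S₁ S₂ : List X} {T₁ T₂ acc : List (List (X × ℝ))}
    (hacc : ValidTable S acc) (h₁ : ∀ a ∈ T₁, Valid S₁ a) (h₂ : ∀ b ∈ T₂, Valid S₂ b)
    (hS : ∀ x ∈ S, x ∈ S₁ ∨ x ∈ S₂) (hl : S₁.length + S₂.length ≤ S.length) :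
    ValidTable S (conv α T₁ T₂ acc) := by
  refine ⟨fun t ht => ?_, hacc.2.conv fun a ha b hb => ?_⟩
  · rcases mem_conv ht with h | ⟨a, ha, b, hb, rfl⟩
    · exact hacc.1 t h
    · refine ⟨fun x hx => ?_, fun q hq => ?_, ?_⟩
      · rcases hS x hx with hx | hx
        · obtain ⟨q, hq, h⟩ := (h₁ a ha).1 x hx
          exact ⟨q, List.mem_append_left _ hq, h⟩
        · obtain ⟨q, hq, h⟩ := (h₂ b hb).1 x hx
          exact ⟨q, List.mem_append_right _ hq, h⟩
      · exact (List.mem_append.1 hq).elim ((h₁ a ha).2.1 q) ((h₂ b hb).2.1 q)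
      · have := (h₁ a ha).2.2
        have := (h₂ b hb).2.2
        simp only [List.length_append]; omega
  · have := (h₁ a ha).2.2
    have := (h₂ b hb).2.2
    omega

theorem validTable_splitSolve {α : ℝ} {sol : List X → List (List (X × ℝ))}
    (h : ∀ S, ValidTable S (sol S)) (S : List X) (P : List (X × ℝ)) :
    ValidTable S (splitSolve α sol S P) := by
  induction P generalizing S with
  | nil =>
    cases S with
    | nil => exact validTable_unit
    | cons x S => exact ⟨by simp [splitSolve], small_nil _⟩
  | cons q P ih =>
    cases S with
    | nil => exact validTable_unit
    | cons x S =>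
      refine ValidTable.conv ⟨by simp, small_nil _⟩ (h _).1 (ih _).1 (fun y hy => ?_)
        (length_near_add_far _ _ _).le
      rw [mem_near, mem_far]
      rcases le_or_gt (dist q.1 y) q.2 with h | h
      · exact .inl ⟨hy, h⟩
      · exact .inr ⟨hy, h⟩

theorem validTable_famSolve {α : ℝ} {sol : List X → List (List (X × ℝ))}
    (h : ∀ S, ValidTable S (sol S)) (F : List (List (X × ℝ))) (S : List X) :
    ValidTable S (famSolve α sol F S) := by
  induction F with
  | nil => exact ⟨by simp [famSolve], small_nil _⟩
  | cons P F ih =>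
    exact ih.conv (validTable_splitSolve h S P).1 validTable_unit.1 (fun x hx => .inl hx) (by simp)

theorem validTable_ball {α : ℝ} {S : List X} {T acc : List (List (X × ℝ))} {c x : X} (hx : x ∈ S)
    (hT : ValidTable (far c (dist c x) S) T) (hacc : ValidTable S acc) :
    ValidTable S (conv α T [[(c, dist c x)]] acc) := by
  refine hacc.conv (S₂ := near c (dist c x) S) hT.1 (fun b hb => ?_) (fun y hy => ?_) ?_
  · obtain rfl := List.mem_singleton.1 hb
    refine ⟨fun y hy => ⟨_, List.mem_singleton_self _, (mem_near.1 hy).2⟩, ?_, ?_⟩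
    · intro q hq
      obtain rfl := List.mem_singleton.1 hq
      exact dist_nonneg
    · exact List.length_pos_of_mem (mem_near.2 ⟨hx, le_rfl⟩)
  · rw [mem_near, mem_far]
    rcases le_or_gt (dist c y) (dist c x) with h | h
    · exact .inr ⟨hy, h⟩
    · exact .inl ⟨hy, h⟩
  · rw [add_comm]; exact (length_near_add_far _ _ _).le

theorem validTable_inner {α : ℝ} {c : X} {S : List X} {g : X → List (List (X × ℝ))}
    {acc : List (List (X × ℝ))} (hg : ∀ x ∈ S, ValidTable (far c (dist c x) S) (g x))
    (hacc : ValidTable S acc) (l : List X) (hl : ∀ x ∈ l, x ∈ S) :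
    ValidTable S (l.foldr (fun x acc => conv α (g x) [[(c, dist c x)]] acc) acc) := by
  induction l with
  | nil => exact hacc
  | cons x l ih =>
    exact validTable_ball (hl x List.mem_cons_self) (hg x (hl x List.mem_cons_self))
      (ih fun y hy => hl y (List.mem_cons_of_mem _ hy))

theorem validTable_outer {α : ℝ} {S : List X} {g : X → X → List (List (X × ℝ))}
    {acc : List (List (X × ℝ))} (hg : ∀ c, ∀ x ∈ S, ValidTable (far c (dist c x) S) (g c x))
    (hacc : ValidTable S acc) (l : List X) :
    ValidTable S (l.foldr (fun c acc =>
      S.foldr (fun x acc => conv α (g c x) [[(c, dist c x)]] acc) acc) acc) := by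
  induction l with
  | nil => exact hacc
  | cons c l ih => exact validTable_inner (hg c) ih S fun _ h => h

theorem validTable_guess {α : ℝ} {pts : List X} {base : List X → List (List (X × ℝ))}
    (h : ∀ S, ValidTable S (base S)) (m : ℕ) (S : List X) :
    ValidTable S (guess α pts base m S) := by
  induction m generalizing S with
  | zero =>
    cases S with
    | nil => exact validTable_unit
    | cons x S => exact h _
  | succ m ih =>
    cases S with
    | nil => exact validTable_unit
    | cons x S => exact validTable_outer (fun c x _ => ih _) (h _) pts

theorem validTable_solve (α : ℝ) (pts : List X) (M : ℕ) (Fs : List (List (List (X × ℝ))))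
    (S : List X) : ValidTable S (solve α pts M Fs S) := by
  induction Fs generalizing S with
  | nil => exact validTable_guess (fun S => ⟨by simp, small_nil _⟩) M S
  | cons F Fs ih => exact validTable_guess (validTable_famSolve ih F) M S

/-! ### The quality of the solution -/

/-- If the balls of `G` are at most `m` in number and leave the points `S'` of `S` uncovered, then
`guess` finds a solution that is as good as `G` together with any candidate for `S'`. -/
theorem guess_le {α : ℝ} (hα : 0 ≤ α) {pts : List X} (hpts : ∀ x, x ∈ pts)
    {base : List X → List (List (X × ℝ))} (G : List (X × ℝ)) (hG : ∀ q ∈ G, 0 ≤ q.2)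
    {m : ℕ} {S : List X} (hm : G.length ≤ m) {u : List (X × ℝ)} (hu0 : 0 ≤ candCost α u)
    (hu : G.foldl (fun S q => far q.1 q.2 S) S = [] ∧ u = [] ∨
      u ∈ base (G.foldl (fun S q => far q.1 q.2 S) S)) :
    ∃ t ∈ guess α pts base m S, t.length ≤ G.length + u.length ∧
      candCost α t ≤ candCost α G + candCost α u := by
  induction G generalizing m S with
  | nil =>
    cases S with
    | nil => exact ⟨[], by simp [guess], by simp, by simpa [candCost] using hu0⟩
    | cons x S =>
      have hu : u ∈ base (x :: S) := by simpa using hu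
      cases m with
      | zero => exact ⟨u, hu, by simp, by simp [candCost]⟩
      | succ m =>
        have : Dominates α (guess α pts base (m + 1) (x :: S)) u := by
          have h2 : ∀ (c : X) (l : List X) (acc : List (List (X × ℝ))), Dominates α acc u →
              Dominates α (l.foldr (fun y acc => conv α
                (guess α pts base m (far c (dist c y) (x :: S))) [[(c, dist c y)]] acc) acc) u := by
            intro c l acc hacc
            induction l with
            | nil => exact hacc
            | cons z l ihl => exact ihl.conv _ _
          have h3 : ∀ l : List X, Dominates α (l.foldr (fun c acc => (x :: S).foldr (fun y acc =>
              conv α (guess α pts base m (far c (dist c y) (x :: S))) [[(c, dist c y)]] acc) acc)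
              (base (x :: S))) u := by
            intro l
            induction l with
            | nil => exact dominates_of_mem hu
            | cons c l ihl => exact h2 c (x :: S) _ ihl
          exact h3 pts
        obtain ⟨t, ht, h1, h2⟩ := this
        exact ⟨t, ht, by simpa using h1, by simpa [candCost] using h2⟩
  | cons q G ih =>
    have hG' := fun q hq => hG q (List.mem_cons_of_mem _ hq)
    have hq0 := Real.rpow_nonneg (hG q List.mem_cons_self) α
    have hcost : candCost α (q :: G) = q.2 ^ α + candCost α G := by simp [candCost]
    rw [List.length_cons] at hm
    rw [List.foldl_cons] at hu
    by_cases hn : near q.1 q.2 S = []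
    · have hfar : far q.1 q.2 S = S := by
        refine List.filter_eq_self.2 fun x hx => ?_
        simp only [decide_eq_true_eq]
        exact fun h => List.not_mem_nil (hn ▸ mem_near.2 ⟨hx, h⟩)
      rw [hfar] at hu
      obtain ⟨t, ht, h1, h2⟩ := ih hG' (m := m) (by omega) hu
      exact ⟨t, ht, by rw [List.length_cons]; omega, by rw [hcost]; linarith⟩
    · obtain ⟨x, hx, hmax⟩ : ∃ x ∈ near q.1 q.2 S, ∀ y ∈ near q.1 q.2 S,
          dist q.1 y ≤ dist q.1 x := by
        classical
        obtain ⟨x, hx, h⟩ := Finset.exists_max_image (near q.1 q.2 S).toFinset (dist q.1)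
          (by simpa using hn)
        exact ⟨x, by simpa using hx, fun y hy => h y (by simpa using hy)⟩
      rw [mem_near] at hx
      -- shrinking the ball until it has a point of `S` on its boundary changes nothing
      have hfar : far q.1 q.2 S = far q.1 (dist q.1 x) S := by
        refine List.filter_congr fun y hy => ?_
        have : dist q.1 y ≤ q.2 ↔ dist q.1 y ≤ dist q.1 x :=
          ⟨fun h => hmax y (mem_near.2 ⟨hy, h⟩), fun h => h.trans hx.2⟩
        simp only [this]
      rw [hfar] at hu
      cases m with
      | zero => omega
      | succ m =>
        obtain ⟨t, ht, h1, h2⟩ := ih hG' (m := m) (by omega) hu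
        have hdom : Dominates α (guess α pts base (m + 1) S) (t ++ [(q.1, dist q.1 x)]) := by
          cases S with
          | nil => simp at hx
          | cons y S =>
            have key : ∀ (b : List (X × ℝ)), ∀ (c : X) (l : List X) (acc : List (List (X × ℝ))),
                (Dominates α acc b ∨ c = q.1 ∧ x ∈ l ∧ b = t ++ [(q.1, dist q.1 x)]) →
                Dominates α (l.foldr (fun z acc => conv α
                  (guess α pts base m (far c (dist c z) (y :: S)))
                    [[(c, dist c z)]] acc) acc) b := by
              intro b c l acc h
              induction l with
              | nil => exact h.elim id fun h => by simp at h
              | cons z l ihl =>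
                rcases h with h | ⟨rfl, h, rfl⟩
                · exact (ihl (.inl h)).conv _ _
                · rcases List.mem_cons.1 h with rfl | h
                  · exact dominates_conv ht (List.mem_singleton_self _)
                  · exact (ihl (.inr ⟨rfl, h, rfl⟩)).conv _ _
            have key2 : ∀ l : List X, q.1 ∈ l → Dominates α (l.foldr (fun c acc =>
                (y :: S).foldr (fun z acc => conv α
                  (guess α pts base m (far c (dist c z) (y :: S)))
                    [[(c, dist c z)]] acc) acc) (base (y :: S))) (t ++ [(q.1, dist q.1 x)]) := by
              intro l hl
              induction l with
              | nil => simp at hl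
              | cons c l ihl =>
                rcases List.mem_cons.1 hl with h | h
                · exact key _ _ _ _ (.inr ⟨h.symm, hx.1, rfl⟩)
                · exact key _ _ _ _ (.inl (ihl h))
            exact key2 pts (hpts _)
        obtain ⟨s, hs, h3, h4⟩ := hdom
        refine ⟨s, hs, ?_, ?_⟩
        · simp only [List.length_append, List.length_cons, List.length_nil] at h3 ⊢
          omega
        · rw [candCost_append] at h4
          rw [hcost]
          have h5 : candCost α [(q.1, dist q.1 x)] = dist q.1 x ^ α := by simp [candCost]
          have h6 := Real.rpow_le_rpow dist_nonneg hx.2 hα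
          linarith

/-- Splitting the sum of `f` over the balls, with multiplicity the number of parts met, into the
contributions of the first part and of the others. -/
theorem sum_meet_cons (f : X × ℝ → ℝ) (q : X × ℝ) (P : List (X × ℝ))
    (L : List ((X × ℝ) × List X)) :
    (L.map fun l => f l.1 * (meet l.2 (q :: P) : ℝ)).sum =
      (((L.filter fun l => !(near q.1 q.2 l.2).isEmpty).map Prod.fst).map f).sum +
      ((L.map fun l => (l.1, far q.1 q.2 l.2)).map fun l => f l.1 * (meet l.2 P : ℝ)).sum := by
  induction L with
  | nil => simp
  | cons l L ih =>
    rw [List.map_cons, List.sum_cons, ih]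
    by_cases h : near q.1 q.2 l.2 = []
    · simp [meet, h]; ring
    · have h' : (near q.1 q.2 l.2).isEmpty = false := by simpa using h
      simp [meet, h, h']; ring

/-- The parts of a partition can be solved separately.  Every ball `l.1` comes with a list `l.2` of
points containing the ones it has to cover, and it is used once for each part that `l.2` meets. -/
theorem splitSolve_le {α a lam θ : ℝ} (ha : 0 ≤ a) (hlam : 0 ≤ lam) (hθ : 0 ≤ θ)
    {sol : List X → List (List (X × ℝ))} {D : ℝ}
    (hsol : ∀ (S : List X) (b : List (X × ℝ)), (∀ x ∈ S, ∀ y ∈ S, dist x y ≤ D) →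
      (∀ q ∈ b, 0 ≤ q.2) → (∀ x ∈ S, ∃ q ∈ b, dist q.1 x ≤ q.2) → Approx α a lam θ b (sol S))
    (P : List (X × ℝ)) (hP : ∀ q ∈ P, 2 * q.2 ≤ D) (S : List X) (hS : Exhausts P S)
    (L : List ((X × ℝ) × List X)) (hL : ∀ l ∈ L, 0 ≤ l.1.2)
    (hcov : ∀ x ∈ S, ∃ l ∈ L, dist l.1.1 x ≤ l.1.2 ∧ x ∈ l.2) :
    ∃ t ∈ splitSolve α sol S P, ∃ e₁ e₂ : ℝ, 0 ≤ e₁ ∧ 0 ≤ e₂ ∧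
      (t.length : ℝ) ≤ (L.map fun l => 1 * (meet l.2 P : ℝ)).sum + e₁ ∧
      candCost α t ≤ (L.map fun l => l.1.2 ^ α * (meet l.2 P : ℝ)).sum + e₂ ∧
      a * e₁ + lam * e₂ ≤ θ * (L.map fun l => (a + lam * l.1.2 ^ α) * (meet l.2 P : ℝ)).sum := by
  have hnil : ∀ (P : List (X × ℝ)) (L : List ((X × ℝ) × List X)), (∀ l ∈ L, 0 ≤ l.1.2) →
      ∃ t ∈ splitSolve α sol [] P, ∃ e₁ e₂ : ℝ, 0 ≤ e₁ ∧ 0 ≤ e₂ ∧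
      (t.length : ℝ) ≤ (L.map fun l => 1 * (meet l.2 P : ℝ)).sum + e₁ ∧
      candCost α t ≤ (L.map fun l => l.1.2 ^ α * (meet l.2 P : ℝ)).sum + e₂ ∧
      a * e₁ + lam * e₂ ≤
        θ * (L.map fun l => (a + lam * l.1.2 ^ α) * (meet l.2 P : ℝ)).sum := by
    intro P L hL
    have hr : ∀ l ∈ L, 0 ≤ l.1.2 ^ α := fun l hl => Real.rpow_nonneg (hL l hl) α
    refine ⟨[], by simp [splitSolve], 0, 0, le_rfl, le_rfl, ?_, ?_, ?_⟩
    · simpa using sum_map_nonneg (l := L) fun l _ => Nat.cast_nonneg (meet l.2 P)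
    · simpa [candCost] using
        sum_map_nonneg (l := L) fun l hl => mul_nonneg (hr l hl) (Nat.cast_nonneg (meet l.2 P))
    · rw [mul_zero, mul_zero, add_zero]
      exact mul_nonneg hθ (sum_map_nonneg fun l hl => mul_nonneg
        (add_nonneg ha (mul_nonneg hlam (hr l hl))) (Nat.cast_nonneg _))
  induction P generalizing S L with
  | nil =>
    cases S with
    | nil => exact hnil [] L hL
    | cons x S =>
      obtain ⟨q, hq, -⟩ := hS x List.mem_cons_self
      simp at hq
  | cons q P ih =>
    cases S with
    | nil => exact hnil _ L hL
    | cons x S =>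
      set S' := x :: S with hS'
      obtain ⟨t₂, ht₂, e₁, e₂, he₁, he₂, hlen, hcost, he⟩ :=
        ih (fun q hq => hP q (List.mem_cons_of_mem _ hq)) (far q.1 q.2 S') hS.far
          (L.map fun l => (l.1, far q.1 q.2 l.2))
          (fun l hl => by
            obtain ⟨l', hl', rfl⟩ := List.mem_map.1 hl
            exact hL l' hl')
          (fun y hy => by
            rw [mem_far] at hy
            obtain ⟨l, hl, h1, h2⟩ := hcov y hy.1
            exact ⟨_, List.mem_map_of_mem hl, h1, mem_far.2 ⟨h2, hy.2⟩⟩)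
      set b := (L.filter fun l => !(near q.1 q.2 l.2).isEmpty).map Prod.fst with hb
      obtain ⟨t₁, ht₁, f₁, f₂, hf₁, hf₂, hlen', hcost', hf⟩ := hsol (near q.1 q.2 S') b
        (fun y hy z hz => by
          rw [mem_near] at hy hz
          have := dist_triangle_left y z q.1
          have := hP q List.mem_cons_self
          linarith [hy.2, hz.2])
        (fun p hp => by
          obtain ⟨l, hl, rfl⟩ := List.mem_map.1 hp
          exact hL l (List.mem_filter.1 hl).1)
        (fun y hy => by
          rw [mem_near] at hy
          obtain ⟨l, hl, h1, h2⟩ := hcov y hy.1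
          refine ⟨l.1, List.mem_map_of_mem (List.mem_filter.2 ⟨hl, ?_⟩), h1⟩
          simpa using List.ne_nil_of_mem (mem_near.2 ⟨h2, hy.2⟩))
      obtain ⟨t, ht, htl, htc⟩ := dominates_conv (α := α) (acc := []) ht₁ ht₂
      refine ⟨t, ht, f₁ + e₁, f₂ + e₂, by positivity, by positivity, ?_, ?_, ?_⟩
      · rw [sum_meet_cons (fun _ => 1)]
        have h1 : ((b.map fun _ => (1 : ℝ))).sum = b.length := by simp
        rw [h1]
        have h2 : (t.length : ℝ) ≤ t₁.length + t₂.length := by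
          rw [List.length_append] at htl; exact_mod_cast htl
        linarith
      · rw [sum_meet_cons (fun p => p.2 ^ α)]
        rw [candCost_append] at htc
        have h1 : (b.map fun p => p.2 ^ α).sum = candCost α b := rfl
        rw [h1]
        linarith
      · rw [sum_meet_cons (fun p => a + lam * p.2 ^ α), mul_add]
        have h1 : (b.map fun p => a + lam * p.2 ^ α).sum = weight α a lam b := rfl
        rw [h1]
        linarith

/-- The families of partitions `Fs` are suitable for sets of diameter at most `D`.  In the family
for this scale, balls of radius at most `r` are rarely cut, and a ball of radius `D` costs no more
than `M` balls of radius `r`. -/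
def GoodLevels (α : ℝ) (pts : List X) (η : ℝ) (M : ℕ) : List (List (List (X × ℝ))) → ℝ → Prop
  | [], D => ∀ x y : X, dist x y ≤ D → x = y
  | F :: Fs, D =>
    (∃ r : ℝ, 0 ≤ r ∧ D ^ α ≤ M * r ^ α ∧ F ≠ [] ∧
      (∀ P ∈ F, Exhausts P pts ∧ (∀ q ∈ P, 2 * q.2 ≤ D / 2) ∧
        ∀ c, (1 : ℝ) ≤ meet (near c r pts) P) ∧
      ∀ c, (F.map fun P => (meet (near c r pts) P : ℝ) - 1).sum ≤ η * F.length) ∧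
    GoodLevels α pts η M Fs (D / 2)

theorem sum_map_sum_comm {ι κ : Type*} (l : List ι) (k : List κ) (f : ι → κ → ℝ) :
    (l.map fun i => (k.map fun j => f i j).sum).sum =
      (k.map fun j => (l.map fun i => f i j).sum).sum := by
  induction l with
  | nil => simp
  | cons i l ih => simp only [List.map_cons, List.sum_cons, ih, ← sum_map_add']

/-- Averaging: some partition of the family cuts the balls of `b` rarely, weighted by `f`. -/
theorem exists_partition {F : List (List (X × ℝ))} (hF : F ≠ []) {pts : List X} {r η : ℝ}
    (h : ∀ c, (F.map fun P => (meet (near c r pts) P : ℝ) - 1).sum ≤ η * F.length)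
    (f : X × ℝ → ℝ) (b : List (X × ℝ)) (hf : ∀ q ∈ b, 0 ≤ f q) :
    ∃ P ∈ F, (b.map fun q => f q * ((meet (near q.1 r pts) P : ℝ) - 1)).sum ≤
      η * (b.map f).sum := by
  refine List.exists_le_of_sum_le hF _ _ ?_
  rw [sum_map_sum_comm, List.map_const', List.sum_replicate, nsmul_eq_mul]
  calc _ ≤ (b.map fun q => (η * F.length) * f q).sum := by
        refine sum_map_le fun q hq => ?_
        rw [sum_map_mul_left', mul_comm]
        exact mul_le_mul_of_nonneg_right (h q.1) (hf q hq)
    _ = _ := by rw [sum_map_mul_left']; ring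

theorem famSolve_le {α a lam θ η : ℝ} (ha : 0 ≤ a) (hlam : 0 ≤ lam) (hθ : 0 ≤ θ)
    {sol : List X → List (List (X × ℝ))} {D r : ℝ} {pts : List X} (hpts : ∀ x, x ∈ pts)
    {F : List (List (X × ℝ))} (hF : F ≠ [])
    (hFP : ∀ P ∈ F, Exhausts P pts ∧ (∀ q ∈ P, 2 * q.2 ≤ D) ∧
        ∀ c, (1 : ℝ) ≤ meet (near c r pts) P)
    (havg : ∀ c, (F.map fun P => (meet (near c r pts) P : ℝ) - 1).sum ≤ η * F.length)
    (hsol : ∀ (S : List X) (b : List (X × ℝ)), (∀ x ∈ S, ∀ y ∈ S, dist x y ≤ D) →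
      (∀ q ∈ b, 0 ≤ q.2) → (∀ x ∈ S, ∃ q ∈ b, dist q.1 x ≤ q.2) → Approx α a lam θ b (sol S))
    (S : List X) (b : List (X × ℝ)) (hb : ∀ q ∈ b, 0 ≤ q.2) (hbr : ∀ q ∈ b, q.2 ≤ r)
    (hcov : ∀ x ∈ S, ∃ q ∈ b, dist q.1 x ≤ q.2) :
    Approx α a lam ((1 + θ) * (1 + η) - 1) b (famSolve α sol F S) := by
  have hr : ∀ q ∈ b, 0 ≤ q.2 ^ α := fun q hq => Real.rpow_nonneg (hb q hq) α
  obtain ⟨P, hPF, hP⟩ := exists_partition hF havg (fun q => a + lam * q.2 ^ α) b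
    (fun q hq => add_nonneg ha (mul_nonneg hlam (hr q hq)))
  obtain ⟨hex, hrad, hone⟩ := hFP P hPF
  obtain ⟨t, ht, e₁, e₂, he₁, he₂, hlen, hcost, he⟩ := splitSolve_le ha hlam hθ hsol P hrad S
    (fun x _ => hex x (hpts x)) (b.map fun q => (q, near q.1 r pts))
    (fun l hl => by
      obtain ⟨q, hq, rfl⟩ := List.mem_map.1 hl
      exact hb q hq)
    (fun x hx => by
      obtain ⟨q, hq, h⟩ := hcov x hx
      exact ⟨_, List.mem_map_of_mem hq, h, mem_near.2 ⟨hpts x, h.trans (hbr q hq)⟩⟩)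
  have hdom : Dominates α (famSolve α sol F S) t := by
    clear hF hFP havg
    induction F with
    | nil => simp at hPF
    | cons P' F ihF =>
      rcases List.mem_cons.1 hPF with rfl | h
      · have := dominates_conv (α := α) (b := []) (T₂ := [[]])
          (acc := F.foldr (fun P acc => conv α (splitSolve α sol S P) [[]] acc) []) ht
          (List.mem_singleton_self _)
        rwa [List.append_nil] at this
      · exact (ihF h).conv _ _
  obtain ⟨u, hu, hul, huc⟩ := hdom
  -- the excess of a sum with multiplicities over the plain sum
  have hsplit : ∀ f : X × ℝ → ℝ,
      ((b.map fun q => (q, near q.1 r pts)).map fun l => f l.1 * (meet l.2 P : ℝ)).sum =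
        (b.map f).sum + (b.map fun q => f q * ((meet (near q.1 r pts) P : ℝ) - 1)).sum := by
    intro f
    rw [← sum_map_add', List.map_map]
    congr 1
    refine List.map_congr_left fun q _ => ?_
    simp only [Function.comp_apply]
    ring
  have h1 := hsplit fun _ => 1
  have h2 := hsplit fun q => q.2 ^ α
  have h3 := hsplit fun q => a + lam * q.2 ^ α
  rw [h1] at hlen
  rw [h2] at hcost
  rw [h3] at he
  set E₁ := (b.map fun q => 1 * ((meet (near q.1 r pts) P : ℝ) - 1)).sum with hE₁
  set E₂ := (b.map fun q => q.2 ^ α * ((meet (near q.1 r pts) P : ℝ) - 1)).sum with hE₂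
  have hE : (b.map fun q => (a + lam * q.2 ^ α) * ((meet (near q.1 r pts) P : ℝ) - 1)).sum =
      a * E₁ + lam * E₂ := by
    rw [hE₁, hE₂, ← sum_map_mul_left', ← sum_map_mul_left', ← sum_map_add']
    congr 1
    refine List.map_congr_left fun q _ => ?_
    ring
  have hW : (b.map fun q => a + lam * q.2 ^ α).sum = weight α a lam b := rfl
  rw [hE, hW] at hP he
  have hE₁0 : 0 ≤ E₁ := sum_map_nonneg fun q _ => by linarith [hone q.1]
  have hE₂0 : 0 ≤ E₂ := sum_map_nonneg fun q hq =>
    mul_nonneg (hr q hq) (by linarith [hone q.1])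
  refine ⟨u, hu, E₁ + e₁, E₂ + e₂, by positivity, by positivity, ?_, ?_, ?_⟩
  · have h4 : (u.length : ℝ) ≤ t.length := by exact_mod_cast hul
    have h5 : (b.map fun _ => (1 : ℝ)).sum = b.length := by simp
    linarith
  · have h5 : (b.map fun q => q.2 ^ α).sum = candCost α b := rfl
    linarith
  · nlinarith [mul_le_mul_of_nonneg_left hP hθ]

theorem mem_foldl_far {G : List (X × ℝ)} {S : List X} {x : X} :
    x ∈ G.foldl (fun S q => far q.1 q.2 S) S ↔ x ∈ S ∧ ∀ q ∈ G, q.2 < dist q.1 x := by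
  induction G generalizing S with
  | nil => simp
  | cons q G ih => simp [ih, mem_far, and_assoc]

theorem dominates_guess_of_diam_le {α : ℝ} (hα : 0 ≤ α) {pts : List X} (hpts : ∀ x, x ∈ pts)
    (base : List X → List (List (X × ℝ))) {M : ℕ} (hM : 1 ≤ M) {S : List X} {b : List (X × ℝ)}
    (hb : ∀ q ∈ b, 0 ≤ q.2) (hcov : ∀ x ∈ S, ∃ q ∈ b, dist q.1 x ≤ q.2) {R : ℝ} (hR : 0 ≤ R)
    (hS : ∀ x ∈ S, ∀ y ∈ S, dist x y ≤ R) (hcost : R ^ α ≤ candCost α b) :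
    Dominates α (guess α pts base M S) b := by
  cases S with
  | nil =>
    exact ⟨[], by cases M <;> simp [guess], by simp, by
      simpa [candCost] using candCost_nonneg (α := α) hb⟩
  | cons s S =>
    obtain ⟨t, ht, h1, h2⟩ := guess_le hα hpts (base := base) [(s, R)] (by simpa using hR)
      (m := M) (S := s :: S) (u := []) (by simpa using hM) (by simp [candCost])
      (.inl ⟨List.eq_nil_iff_forall_not_mem.2 fun x hx => by
        rw [mem_foldl_far] at hx
        have h1 := hx.2 (s, R) (List.mem_singleton_self _)
        exact absurd (hS s List.mem_cons_self x hx.1) (not_le.2 h1), rfl⟩)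
    obtain ⟨q, hq, -⟩ := hcov s List.mem_cons_self
    have hlen : 0 < b.length := List.length_pos_of_mem hq
    refine ⟨t, ht, h1.trans (by simp only [List.length_cons, List.length_nil]; omega),
      h2.trans ?_⟩
    simpa [candCost] using hcost

/-- The solution found for a set `S` of diameter at most `D` is almost as good as any cover of `S`.
If the cover has more than `M` balls that are large for this scale, then a single ball of radius `D`
is better.  Otherwise the large balls are guessed, and the small ones are rarely cut by a suitable
partition. -/
theorem approx_solve {α a lam η : ℝ} (hα : 1 ≤ α) (ha : 0 ≤ a) (hlam : 0 ≤ lam) (hη : 0 ≤ η)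
    {pts : List X} (hpts : ∀ x, x ∈ pts) {M : ℕ} (hM : 1 ≤ M)
    (Fs : List (List (List (X × ℝ)))) (D : ℝ) (hD : 0 ≤ D) (h : GoodLevels α pts η M Fs D)
    (S : List X) (b : List (X × ℝ)) (hS : ∀ x ∈ S, ∀ y ∈ S, dist x y ≤ D)
    (hb : ∀ q ∈ b, 0 ≤ q.2) (hcov : ∀ x ∈ S, ∃ q ∈ b, dist q.1 x ≤ q.2) :
    Approx α a lam ((1 + η) ^ Fs.length - 1) b (solve α pts M Fs S) := by
  have hα0 : 0 ≤ α := by linarith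
  have hθ : ∀ l : ℕ, 0 ≤ (1 + η) ^ l - 1 := fun l => by
    linarith [one_le_pow₀ (n := l) (by linarith : 1 ≤ 1 + η)]
  induction Fs generalizing D S b with
  | nil =>
    refine .of_le ha hlam (hθ _) hb
      (dominates_guess_of_diam_le hα0 hpts _ hM hb hcov le_rfl (fun x hx y hy => ?_) ?_)
    · rw [h x y (hS x hx y hy), dist_self]
    · rw [Real.zero_rpow (by linarith)]
      exact candCost_nonneg hb
  | cons F Fs ih =>
    obtain ⟨⟨r, hr, hMr, hF, hFP, havg⟩, hFs⟩ := h
    set G := b.filter fun q => r < q.2 with hG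
    set b' := b.filter fun q => !decide (r < q.2) with hb'
    have hsumc := candCost_filter α (fun q => decide (r < q.2)) b
    have hsuml := length_filter_add (fun q => decide (r < q.2)) b
    rw [← hG, ← hb'] at hsumc hsuml
    have hG0 : ∀ q ∈ G, 0 ≤ q.2 := fun q hq => hb q (List.mem_filter.1 hq).1
    have hb'0 : ∀ q ∈ b', 0 ≤ q.2 := fun q hq => hb q (List.mem_filter.1 hq).1
    rcases le_or_gt G.length M with hGM | hGM
    · set S' := G.foldl (fun S q => far q.1 q.2 S) S with hS'
      have hcov' : ∀ x ∈ S', ∃ q ∈ b', dist q.1 x ≤ q.2 := by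
        intro x hx
        rw [hS', mem_foldl_far] at hx
        obtain ⟨q, hq, hqx⟩ := hcov x hx.1
        refine ⟨q, List.mem_filter.2 ⟨hq, ?_⟩, hqx⟩
        by_contra hlt
        have hlt : r < q.2 := by simpa using hlt
        exact absurd hqx (not_le.2 (hx.2 q (List.mem_filter.2 ⟨hq, by simpa using hlt⟩)))
      obtain ⟨u, hu, e₁, e₂, he₁, he₂, hlen, hcost, he⟩ := famSolve_le (α := α) ha hlam
        (hθ Fs.length) hpts hF hFP havg (ih (D / 2) (by positivity) hFs)
        S' b' hb'0 (fun q hq => by simpa using (List.mem_filter.1 hq).2) hcov'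
      have huv := (validTable_famSolve (validTable_solve α pts M Fs) F S').1 u hu
      obtain ⟨t, ht, h1, h2⟩ := guess_le hα0 hpts G hG0 hGM (candCost_nonneg (α := α) huv.2.1)
        (.inr hu)
      refine ⟨t, ht, e₁, e₂, he₁, he₂, ?_, by linarith, he.trans ?_⟩
      · have h1 : (t.length : ℝ) ≤ G.length + u.length := by exact_mod_cast h1
        have h3 : (b.length : ℝ) = G.length + b'.length := by exact_mod_cast hsuml
        linarith
      · have h3 : weight α a lam b' ≤ weight α a lam b := by
          rw [weight_eq, weight_eq]
          have h4 := candCost_nonneg (α := α) hG0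
          gcongr
          · omega
          · linarith
        have h4 : (1 + ((1 + η) ^ Fs.length - 1)) * (1 + η) - 1 =
            (1 + η) ^ (F :: Fs).length - 1 := by
          rw [List.length_cons, pow_succ]; ring
        rw [h4]
        exact mul_le_mul_of_nonneg_left h3 (hθ _)
    · refine .of_le ha hlam (hθ _) hb (dominates_guess_of_diam_le hα0 hpts _ hM hb hcov hD hS ?_)
      have h1 : (G.map fun _ => r ^ α).sum ≤ candCost α G := sum_map_le fun q hq =>
        Real.rpow_le_rpow hr (of_decide_eq_true (List.mem_filter.1 hq).2).le hα0
      rw [List.map_const', List.sum_replicate, nsmul_eq_mul] at h1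
      have h2 : (M : ℝ) * r ^ α ≤ G.length * r ^ α := by
        have := Real.rpow_nonneg hr α
        gcongr
      linarith [candCost_nonneg (α := α) hb'0]

end

noncomputable section

variable {X : Type} [MetricSpace X]

/-! ### The choice of the parameters -/

/-- The families of partitions for the scales `D, D / 2, …`; the radius of the balls that should
rarely be cut is the `κ`-th part of the scale. -/
def levels (pts : List X) (κ δ : ℝ) (T f : ℕ) : ℕ → ℝ → List (List (List (X × ℝ)))
  | 0, _ => []
  | m + 1, D => mwu pts (D / κ) δ T f (fun _ => 1) :: levels pts κ δ T f m (D / 2)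

theorem length_levels (pts : List X) (κ δ : ℝ) (T f m : ℕ) (D : ℝ) :
    (levels pts κ δ T f m D).length = m := by
  induction m generalizing D with
  | zero => rfl
  | succ m ih => simp [levels, ih]

theorem goodLevels_levels {α : ℝ} {pts : List X} {κ δ : ℝ} {T f M lg : ℕ}
    (hpts : ∀ x, x ∈ pts) (hne : pts ≠ []) (hκ : 0 < κ) (hδ : 0 ≤ δ)
    (hT : (pts.length : ℝ) + 1 < (1 + δ) ^ T) (hκT : 4 * (2 * T + 1) ≤ κ)
    (hM : κ ^ α ≤ M) (hf0 : f ≠ 0)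
    (hlg : (pts.length : ℝ) ≤ 2 ^ lg) (hf : pts.length * lg ≤ δ * f) (m : ℕ) (D : ℝ) (hD : 0 ≤ D)
    (hsep : ∀ x y : X, dist x y ≤ D / 2 ^ m → x = y) :
    GoodLevels α pts (5 * δ) M (levels pts κ δ T f m D) D := by
  induction m generalizing D with
  | zero => simpa [levels, GoodLevels] using hsep
  | succ m ih =>
    have hp : GrowParams pts (D / κ) δ T := ⟨hpts, hne, by positivity, hδ, hT⟩
    refine ⟨⟨D / κ, by positivity, ?_, ?_, fun P hP => ⟨hp.exhausts hP _, ?_, fun c =>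
      (hp.meet_bounds hP c).1⟩, fun c => ?_⟩, ih (D / 2) (by positivity) ?_⟩
    · rw [Real.div_rpow hD hκ.le]
      have h1 : 0 < κ ^ α := Real.rpow_pos_of_pos hκ α
      calc D ^ α = κ ^ α * (D ^ α / κ ^ α) := by field_simp
        _ ≤ _ := by gcongr
    · rw [← List.length_pos_iff, length_mwu]; omega
    · intro q hq
      obtain ⟨w, base, rfl⟩ := exists_carve_of_mem_mwu hP
      have h1 := carve_radius_le pts w (by positivity : 0 ≤ D / κ) δ base T hq
      have h2 : 4 * (2 * T + 1) * (D / κ) ≤ D := by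
        calc 4 * (2 * T + 1) * (D / κ) ≤ κ * (D / κ) := by gcongr
          _ = D := by field_simp
      linarith
    · rw [length_mwu]
      exact mwu_average hp hlg hf c
    · rw [pow_succ', ← div_div] at hsep
      exact hsep

/-- The parameters that the algorithm computes from the number `n` of points, the accuracy `ε`, the
number `m` of scales and the bound `lg` for the binary logarithm of `n`. -/
def delta (ε : ℝ) (m : ℕ) : ℝ := min ε 1 / (20 * m)

/-- The number of steps of the region growing, before rounding up. -/
def growSteps (ε : ℝ) (m lg : ℕ) : ℝ := (lg + 1) / delta ε m

/-- The ratio of a scale and the radius of the balls that are regarded as small for it. -/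
def ratio (ε : ℝ) (m lg : ℕ) : ℝ := 8 * (growSteps ε m lg + 2)

/-- The number of rounds of the multiplicative weights method, before rounding up. -/
def rounds (n : ℕ) (ε : ℝ) (m lg : ℕ) : ℝ := n * lg / delta ε m

/-- The table of solutions computed for the whole space. -/
def table (α : ℝ) (pts : List X) (ε : ℝ) (m lg : ℕ) (D : ℝ) : List (List (X × ℝ)) :=
  solve α pts ⌈ratio ε m lg ^ α⌉₊
    (levels pts (ratio ε m lg) (delta ε m) ⌈growSteps ε m lg⌉₊ ⌈rounds pts.length ε m lg⌉₊ m D) pts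

theorem two_le_one_add_rpow {δ : ℝ} (h0 : 0 < δ) (h1 : δ ≤ 1) : 2 ≤ (1 + δ) ^ (1 / δ) := by
  have := one_add_mul_self_le_rpow_one_add (s := δ) (by linarith) (p := 1 / δ)
    (by rw [le_div_iff₀ h0]; linarith)
  have h : 1 / δ * δ = 1 := by field_simp
  linarith

theorem delta_pos {ε : ℝ} (hε : 0 < ε) {m : ℕ} (hm : 1 ≤ m) : 0 < delta ε m := by
  have : (0 : ℝ) < m := by exact_mod_cast hm
  exact div_pos (lt_min hε one_pos) (by positivity)

theorem delta_le_one (ε : ℝ) {m : ℕ} (hm : 1 ≤ m) : delta ε m ≤ 1 := by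
  have : (1 : ℝ) ≤ m := by exact_mod_cast hm
  exact (div_le_one (by positivity)).2 ((min_le_right _ _).trans (by linarith))

theorem growSteps_pos {ε : ℝ} (hε : 0 < ε) {m : ℕ} (hm : 1 ≤ m) (lg : ℕ) :
    0 < growSteps ε m lg := by
  have := delta_pos hε hm
  unfold growSteps
  positivity

/-- The table contains solutions that are almost as good as any given cover. -/
theorem exists_mem_table {α : ℝ} (hα : 1 ≤ α) {pts : List X} (hpts : ∀ x, x ∈ pts)
    (hne : pts ≠ []) {ε : ℝ} (hε : 0 < ε) {m lg : ℕ} (hm : 1 ≤ m)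
    (hlg : (pts.length : ℝ) < 2 ^ lg) {D : ℝ} (hD : ∀ x y : X, dist x y ≤ D)
    (hsep : ∀ x y : X, dist x y ≤ D / 2 ^ m → x = y) {k : ℕ} (hk : 1 ≤ k)
    {b : List (X × ℝ)} (hb : ∀ q ∈ b, 0 ≤ q.2) (hcov : ∀ x : X, ∃ q ∈ b, dist q.1 x ≤ q.2)
    (hbk : b.length ≤ k) {c : ℝ} (hc : 0 < c) (hbc : candCost α b ≤ c) :
    ∃ t ∈ table α pts ε m lg D, (t.length : ℝ) ≤ (1 + ε) * k ∧ candCost α t ≤ (1 + ε) * c := by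
  have hα0 : 0 ≤ α := by linarith
  have hδ := delta_pos hε hm
  have hδ1 := delta_le_one ε hm
  have hm0 : (1 : ℝ) ≤ m := by exact_mod_cast hm
  have hk0 : (1 : ℝ) ≤ k := by exact_mod_cast hk
  have hg := growSteps_pos hε hm lg
  have hn : 1 ≤ pts.length := List.length_pos_iff.2 hne
  have hn1 : (1 : ℝ) ≤ pts.length := by exact_mod_cast hn
  have hlg1 : 1 ≤ lg := by
    by_contra h
    obtain rfl : lg = 0 := by omega
    rw [pow_zero] at hlg; linarith
  have hlg1' : (1 : ℝ) ≤ lg := by exact_mod_cast hlg1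
  have hratio : 1 ≤ ratio ε m lg := by unfold ratio; linarith
  have hrounds : 0 < rounds pts.length ε m lg := by unfold rounds; positivity
  have hD0 : 0 ≤ D := by
    obtain ⟨x, -⟩ := List.exists_mem_of_ne_nil _ hne
    exact dist_nonneg.trans (hD x x)
  have hgood := goodLevels_levels (α := α) (pts := pts) (κ := ratio ε m lg) (δ := delta ε m)
    (T := ⌈growSteps ε m lg⌉₊) (f := ⌈rounds pts.length ε m lg⌉₊) (M := ⌈ratio ε m lg ^ α⌉₊)
    (lg := lg) hpts hne (by linarith) hδ.le
    (by
      have h1 : (pts.length : ℝ) + 1 ≤ 2 ^ lg := by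
        have : pts.length + 1 ≤ 2 ^ lg := by exact_mod_cast hlg
        exact_mod_cast this
      calc (pts.length : ℝ) + 1 ≤ 2 ^ lg := h1
        _ < 2 ^ (lg + 1) := pow_lt_pow_right₀ one_lt_two (Nat.lt_succ_self _)
        _ ≤ ((1 + delta ε m) ^ (1 / delta ε m)) ^ (lg + 1) := by
            gcongr; exact two_le_one_add_rpow hδ hδ1
        _ = (1 + delta ε m) ^ growSteps ε m lg := by
            rw [← Real.rpow_natCast, ← Real.rpow_mul (by linarith)]
            congr 1
            unfold growSteps; push_cast; ring
        _ ≤ (1 + delta ε m) ^ (⌈growSteps ε m lg⌉₊ : ℝ) :=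
            Real.rpow_le_rpow_of_exponent_le (by linarith) (Nat.le_ceil _)
        _ = _ := Real.rpow_natCast _ _)
    (by
      have := Nat.ceil_lt_add_one hg.le
      unfold ratio; linarith)
    (Nat.le_ceil _) (Nat.ceil_pos.2 hrounds).ne' hlg.le
    (by
      have h1 := Nat.le_ceil (rounds pts.length ε m lg)
      calc (pts.length : ℝ) * lg = delta ε m * rounds pts.length ε m lg := by
            unfold rounds; field_simp
        _ ≤ _ := by gcongr) m D hD0 hsep
  obtain ⟨t, ht, e₁, e₂, he₁, he₂, hlen, hcost, he⟩ := approx_solve hα (a := 1 / k) (lam := 1 / c)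
    (by positivity) (by positivity) (by positivity) hpts
    (Nat.ceil_pos.2 (Real.rpow_pos_of_pos (by linarith) α)) _ D hD0 hgood pts b
    (fun x _ y _ => hD x y) hb (fun x _ => hcov x)
  rw [length_levels] at he
  have hW : weight α (1 / k) (1 / c) b ≤ 2 := by
    rw [weight_eq]
    have h1 : 1 / (k : ℝ) * b.length ≤ 1 := by
      rw [one_div_mul_eq_div, div_le_one (by linarith)]; exact_mod_cast hbk
    have h2 : 1 / c * candCost α b ≤ 1 := by
      rw [one_div_mul_eq_div, div_le_one hc]; exact hbc
    linarith
  have hε' : 0 < min ε 1 := lt_min hε one_pos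
  have hpow : (1 + 5 * delta ε m) ^ m - 1 ≤ min ε 1 / 2 := by
    have h1 : (1 + 5 * delta ε m) ^ m ≤ Real.exp (min ε 1 / 4) := by
      calc (1 + 5 * delta ε m) ^ m ≤ Real.exp (5 * delta ε m) ^ m := by
            gcongr; linarith [Real.add_one_le_exp (5 * delta ε m)]
        _ = Real.exp (min ε 1 / 4) := by
            rw [← Real.exp_nat_mul]; congr 1; unfold delta; field_simp; norm_num
    have h2 := Real.abs_exp_sub_one_le (x := min ε 1 / 4)
      (by rw [abs_of_pos (by positivity)]; linarith [min_le_right ε 1])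
    rw [abs_of_pos (by positivity : 0 < min ε 1 / 4)] at h2
    linarith [le_abs_self (Real.exp (min ε 1 / 4) - 1)]
  have hsmall : 1 / (k : ℝ) * e₁ + 1 / c * e₂ ≤ ε := by
    have h0 := weight_nonneg (α := α) (a := 1 / k) (lam := 1 / c) (by positivity) (by positivity) hb
    calc _ ≤ _ := he
      _ ≤ min ε 1 / 2 * 2 := by gcongr
      _ ≤ ε := by linarith [min_le_left ε 1]
  have h1 : 0 ≤ 1 / (k : ℝ) * e₁ := by positivity
  have h2 : 0 ≤ 1 / c * e₂ := by positivity
  have h3 : 1 / (k : ℝ) * e₁ ≤ ε := by linarith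
  have h4 : 1 / c * e₂ ≤ ε := by linarith
  rw [one_div_mul_eq_div, div_le_iff₀ (by linarith)] at h3
  rw [one_div_mul_eq_div, div_le_iff₀ hc] at h4
  refine ⟨t, ht, ?_, by linarith⟩
  have h5 : (b.length : ℝ) ≤ k := by exact_mod_cast hbk
  linarith

end

noncomputable section

/-! ### The program -/

/-- The list of the values of the given expressions. -/
def tup : List Expr → Expr
  | [] => .nil
  | a :: l => .bin .cons a (tup l)

/-- Component `k` of the list that is the value of `a`. -/
def proj : ℕ → Expr → Expr
  | 0, a => .un .fst a
  | k + 1, a => proj k (.un .snd a)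

/-- Component `k` of the list held by variable `i`. -/
def arg (i k : ℕ) : Expr := proj k (.var i)

/-- The distance of two points; a point is a pair of its index and its row of the distance
matrix. -/
def distE (x y : Expr) : Expr := .call 0 (tup [.un .snd x, .un .fst y])

/-- Arguments `[l, i]`: entry `i` of the list `l`. -/
def nthBody : Expr :=
  .ifLe (arg 0 1) (.const 0) (proj 0 (arg 0 0))
    (.call 0 (tup [.un .snd (arg 0 0), .bin .sub (arg 0 1) (.const 1)]))

/-- Arguments `[c, R, S]`: the pair of `near c R S` and `far c R S`. -/
def partBody : Expr :=
  .ifNil (arg 0 2) (.bin .cons .nil .nil)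
    (.letIn (.call 1 (tup [arg 0 0, arg 0 1, .un .snd (arg 0 2)]))
      (.ifLe (distE (arg 1 0) (proj 0 (arg 1 2))) (arg 1 1)
        (.bin .cons (.bin .cons (proj 0 (arg 1 2)) (.un .fst (.var 0))) (.un .snd (.var 0)))
        (.bin .cons (.un .fst (.var 0)) (.bin .cons (proj 0 (arg 1 2)) (.un .snd (.var 0))))))

/-- Arguments `[v, R, r, rem, wl]`: `vol`, for the points and weights listed in `wl`. -/
def volBody : Expr :=
  .ifNil (arg 0 4) (.const 0)
    (.letIn (.call 2 (tup [arg 0 0, arg 0 1, arg 0 2, arg 0 3, .un .snd (arg 0 4)]))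
      (.ifLe (distE (arg 1 0) (.un .fst (proj 0 (arg 1 4)))) (arg 1 1)
        (.ifNil (.un .fst (.call 1 (tup [.un .fst (proj 0 (arg 1 4)), arg 1 2, arg 1 3])))
          (.var 0)
          (.bin .add (.un .snd (proj 0 (arg 1 4))) (.var 0)))
        (.var 0)))

/-- Arguments `[fuel, R, r, δ, base, v, rem, wl]`: `grow`. -/
def growBody : Expr :=
  .ifNil (arg 0 0) (arg 0 1)
    (.letIn (.bin .add (arg 0 1) (.bin .mul (.const 2) (arg 0 2)))
      (.ifLe
        (.bin .add (.call 2 (tup [arg 1 5, .var 0, arg 1 2, arg 1 6, arg 1 7])) (arg 1 4))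
        (.bin .mul (.bin .add (.const 1) (arg 1 3))
          (.bin .add (.call 2 (tup [arg 1 5, arg 1 1, arg 1 2, arg 1 6, arg 1 7])) (arg 1 4)))
        (arg 1 1)
        (.call 3 (tup [.un .snd (arg 1 0), .var 0, arg 1 2, arg 1 3, arg 1 4, arg 1 5, arg 1 6,
          arg 1 7]))))

/-- Arguments `[rem, r, δ, base, T, wl]`: `carve`. -/
def carveBody : Expr :=
  .ifNil (arg 0 0) .nil
    (.letIn (.bin .add (.call 3 (tup [arg 0 4, .const 0, arg 0 1, arg 0 2, arg 0 3,
        proj 0 (arg 0 0), arg 0 0, arg 0 5])) (arg 0 1))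
      (.bin .cons (.bin .cons (proj 0 (arg 1 0)) (.var 0))
        (.call 4 (tup [.un .snd (.call 1 (tup [proj 0 (arg 1 0), .var 0, arg 1 0])),
          arg 1 1, arg 1 2, arg 1 3, arg 1 4, arg 1 5]))))

/-- Arguments `[U, P]`: `meet`. -/
def meetBody : Expr :=
  .ifNil (arg 0 1) (.const 0)
    (.letIn (.call 1 (tup [.un .fst (proj 0 (arg 0 1)), .un .snd (proj 0 (arg 0 1)), arg 0 0]))
      (.bin .add (.ifNil (.un .fst (.var 0)) (.const 0) (.const 1))
        (.call 5 (tup [.un .snd (.var 0), .un .snd (arg 1 1)]))))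

/-- Arguments `[wl, pts, r, n, P]`: the list of the points with the weights given by `upd`. -/
def updBody : Expr :=
  .ifNil (arg 0 0) .nil
    (.bin .cons
      (.bin .cons (.un .fst (proj 0 (arg 0 0)))
        (.bin .mul (.un .snd (proj 0 (arg 0 0)))
          (.bin .add (.const 1) (.bin .div
            (.bin .sub (.call 5 (tup [.un .fst (.call 1 (tup [.un .fst (proj 0 (arg 0 0)),
              arg 0 2, arg 0 1])), arg 0 4])) (.const 1)) (arg 0 3)))))
      (.call 6 (tup [.un .snd (arg 0 0), arg 0 1, arg 0 2, arg 0 3, arg 0 4])))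

/-- Arguments `[fuel, wl, pts, r, δ, T, n, D]`, where `D` is a bound for all distances: `mwu`. -/
def mwuBody : Expr :=
  .ifNil (arg 0 0) .nil
    (.letIn (.call 4 (tup [arg 0 2, arg 0 3, arg 0 4,
        .bin .div (.call 2 (tup [proj 0 (arg 0 2), arg 0 7, arg 0 3, arg 0 2, arg 0 1])) (arg 0 6),
        arg 0 5, arg 0 1]))
      (.bin .cons (.var 0)
        (.call 7 (tup [.un .snd (arg 1 0),
          .call 6 (tup [arg 1 1, arg 1 2, arg 1 3, arg 1 6, .var 0]),
          arg 1 2, arg 1 3, arg 1 4, arg 1 5, arg 1 6, arg 1 7]))))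

/-- Arguments `[m, D, κ, f, wl, pts, δ, T, n, D₀]`, where `D₀` is a bound for all distances:
`levels`. -/
def levelsBody : Expr :=
  .ifNil (arg 0 0) .nil
    (.bin .cons
      (.call 7 (tup [arg 0 3, arg 0 4, arg 0 5, .bin .div (arg 0 1) (arg 0 2), arg 0 6, arg 0 7,
        arg 0 8, arg 0 9]))
      (.call 8 (tup [.un .snd (arg 0 0), .bin .div (arg 0 1) (.const 2), arg 0 2, arg 0 3, arg 0 4,
        arg 0 5, arg 0 6, arg 0 7, arg 0 8, arg 0 9])))

/-- Argument: a list of points.  The list of these points with weights `1`. -/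
def onesBody : Expr :=
  .ifNil (.var 0) .nil
    (.bin .cons (.bin .cons (.un .fst (.var 0)) (.const 1)) (.call 9 (.un .snd (.var 0))))

/-- Arguments `[rows, i]`: the list of the given rows, numbered from `i`. -/
def indexBody : Expr :=
  .ifNil (arg 0 0) .nil
    (.bin .cons (.bin .cons (arg 0 1) (proj 0 (arg 0 0)))
      (.call 10 (tup [.un .snd (arg 0 0), .bin .add (arg 0 1) (.const 1)])))

/-- Arguments `[row, mx, mn]`: the pair of `mx` and `mn`, updated by the maximum and by the least
positive element of the row. -/
def scanRowBody : Expr :=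
  .ifNil (arg 0 0) (.bin .cons (arg 0 1) (arg 0 2))
    (.letIn (proj 0 (arg 0 0))
      (.call 11 (tup [.un .snd (arg 1 0),
        .ifLe (.var 0) (arg 1 1) (arg 1 1) (.var 0),
        .ifLe (.var 0) (.const 0) (arg 1 2) (.ifLe (.var 0) (arg 1 2) (.var 0) (arg 1 2))])))

/-- Arguments `[rows, mx, mn]`: the same for a list of rows. -/
def scanBody : Expr :=
  .ifNil (arg 0 0) (.bin .cons (arg 0 1) (arg 0 2))
    (.letIn (.call 11 (tup [proj 0 (arg 0 0), arg 0 1, arg 0 2]))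
      (.call 12 (tup [.un .snd (arg 1 0), .un .fst (.var 0), .un .snd (.var 0)])))

/-- Arguments `[D, d]`: how often `D` has to be halved until it is smaller than `d`. -/
def halvingsBody : Expr :=
  .ifLe (arg 0 1) (arg 0 0)
    (.bin .add (.const 1) (.call 13 (tup [.bin .div (arg 0 0) (.const 2), arg 0 1])))
    (.const 0)

/-- Argument: a number `x`.  A list of length `⌈x⌉₊`. -/
def unaryBody : Expr :=
  .ifLe (.var 0) (.const 0) .nil (.bin .cons .nil (.call 14 (.bin .sub (.var 0) (.const 1))))

/-- Arguments `[a, b]`: the concatenation of two lists. -/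
def appendBody : Expr :=
  .ifNil (arg 0 0) (arg 0 1)
    (.bin .cons (proj 0 (arg 0 0)) (.call 15 (tup [.un .snd (arg 0 0), arg 0 1])))

/-- Arguments `[c, T]`: `ins`. -/
def insBody : Expr :=
  let skip := .bin .cons (proj 0 (arg 0 1)) (.call 16 (tup [arg 0 0, .un .snd (arg 0 1)]))
  .ifNil (arg 0 1) (.bin .cons (arg 0 0) .nil)
    (.ifLe (.un .fst (arg 0 0)) (.un .fst (proj 0 (arg 0 1)))
      (.ifLe (.un .fst (proj 0 (arg 0 1))) (.un .fst (arg 0 0))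
        (.ifLe (proj 1 (arg 0 0)) (proj 1 (proj 0 (arg 0 1)))
          (.bin .cons (arg 0 0) (.un .snd (arg 0 1)))
          (arg 0 1))
        skip)
      skip)

/-- Arguments `[a, T, acc]`: `row`. -/
def rowBody : Expr :=
  .ifNil (arg 0 1) (arg 0 2)
    (.call 16 (tup [
      .bin .cons (.bin .add (.un .fst (arg 0 0)) (.un .fst (proj 0 (arg 0 1))))
        (.bin .cons (.bin .add (proj 1 (arg 0 0)) (proj 1 (proj 0 (arg 0 1))))
          (.call 15 (tup [.un .snd (.un .snd (arg 0 0)),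
            .un .snd (.un .snd (proj 0 (arg 0 1)))]))),
      .call 17 (tup [arg 0 0, .un .snd (arg 0 1), arg 0 2])]))

/-- Arguments `[T₁, T₂, acc]`: `conv`. -/
def convBody : Expr :=
  .ifNil (arg 0 0) (arg 0 2)
    (.call 17 (tup [proj 0 (arg 0 0), arg 0 1,
      .call 18 (tup [.un .snd (arg 0 0), arg 0 1, arg 0 2])]))

/-- The table whose only candidate is the empty list of balls. -/
def unitE : Expr := .bin .cons (.bin .cons (.const 0) (.bin .cons (.const 0) .nil)) .nil

/-- Arguments `[S, P, Fs, pts, M]`: `splitSolve` with `solve α pts M Fs`. -/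
def splitBody : Expr :=
  .ifNil (arg 0 0) unitE
    (.ifNil (arg 0 1) .nil
      (.letIn (.call 1 (tup [.un .fst (proj 0 (arg 0 1)), .un .snd (proj 0 (arg 0 1)), arg 0 0]))
        (.call 18 (tup [
          .call 21 (tup [.un .fst (.var 0), arg 1 4, arg 1 2, arg 1 3, arg 1 4]),
          .call 19 (tup [.un .snd (.var 0), .un .snd (arg 1 1), arg 1 2, arg 1 3, arg 1 4]),
          .nil]))))

/-- Arguments `[F, S, Fs, pts, M]`: `famSolve` with `solve α pts M Fs`. -/
def famBody : Expr :=
  .ifNil (arg 0 0) .nil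
    (.call 18 (tup [
      .call 19 (tup [arg 0 1, proj 0 (arg 0 0), arg 0 2, arg 0 3, arg 0 4]),
      unitE,
      .call 20 (tup [.un .snd (arg 0 0), arg 0 1, arg 0 2, arg 0 3, arg 0 4])]))

/-- Arguments `[S, m, Fs, pts, M]`: the function `guess` used in `solve α pts M Fs`. -/
def guessBody : Expr :=
  .ifNil (arg 0 0) unitE
    (.letIn
      (.ifNil (arg 0 2) .nil
        (.call 20 (tup [proj 0 (arg 0 2), arg 0 0, .un .snd (arg 0 2), arg 0 3, arg 0 4])))
      (.ifNil (arg 1 1) (.var 0)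
        (.call 22 (tup [arg 1 3, arg 1 0, .un .snd (arg 1 1), arg 1 2, arg 1 3, arg 1 4, .var 0]))))

/-- Arguments `[l, S, m, Fs, pts, M, acc]`: the loop over the centres in `guess`. -/
def outerBody : Expr :=
  .ifNil (arg 0 0) (arg 0 6)
    (.call 23 (tup [arg 0 1, proj 0 (arg 0 0), arg 0 1, arg 0 2, arg 0 3, arg 0 4, arg 0 5,
      .call 22 (tup [.un .snd (arg 0 0), arg 0 1, arg 0 2, arg 0 3, arg 0 4, arg 0 5, arg 0 6])]))

/-- Arguments `[l, c, S, m, Fs, pts, M, acc]`: the loop over the boundary points in `guess`. -/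
def innerBody : Expr :=
  .ifNil (arg 0 0) (arg 0 7)
    (.letIn (distE (arg 0 1) (proj 0 (arg 0 0)))
      (.call 18 (tup [
        .call 21 (tup [.un .snd (.call 1 (tup [arg 1 1, .var 0, arg 1 2])),
          arg 1 3, arg 1 4, arg 1 5, arg 1 6]),
        .bin .cons (.bin .cons (.const 1) (.bin .cons (.un .pow (.var 0))
          (.bin .cons (.bin .cons (.un .fst (arg 1 1)) (.var 0)) .nil))) .nil,
        .call 23 (tup [.un .snd (arg 1 0), arg 1 1, arg 1 2, arg 1 3, arg 1 4, arg 1 5, arg 1 6,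
          arg 1 7])])))

/-- Arguments `[K, T]`: `pick`. -/
def pickBody : Expr :=
  .ifNil (arg 0 1) .nil
    (.letIn (.call 24 (tup [arg 0 0, .un .snd (arg 0 1)]))
      (.ifLe (.un .fst (proj 0 (arg 1 1))) (arg 1 0)
        (.ifNil (.var 0) (proj 0 (arg 1 1))
          (.ifLe (proj 1 (proj 0 (arg 1 1))) (proj 1 (.var 0)) (proj 0 (arg 1 1)) (.var 0)))
        (.var 0)))

/-- The body of `setupBody`, where variable `0` holds `delta ε m`. -/
def scalesBody : Expr :=
  .letIn (.bin .div (.bin .add (arg 1 4) (.const 1)) (.var 0))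
    (.letIn (.bin .mul (.const 8) (.bin .add (.var 0) (.const 2)))
      (.bin .cons (.call 14 (.un .pow (.var 0)))
        (.call 8 (tup [.call 14 (arg 3 3), arg 3 5, .var 0,
          .call 14 (.bin .div (.bin .mul (arg 3 1) (arg 3 4)) (.var 2)),
          .call 9 (arg 3 0), arg 3 0, .var 2, .call 14 (.var 1), arg 3 1, arg 3 5]))))

/-- Arguments `[pts, n, ε, m, lg, D]`: the families of partitions for all scales, preceded by the
bound for the number of guesses, in unary. -/
def setupBody : Expr :=
  .letIn (.bin .div (.ifLe (arg 0 2) (.const 1) (arg 0 2) (.const 1))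
      (.bin .mul (.const 20) (arg 0 3))) scalesBody

/-- Arguments `[rows, pts, n, k, ε]`: a cheapest candidate in the table of solutions, among those
with at most `(1 + ε) k` balls. -/
def runBody : Expr :=
  .letIn (.letIn (proj 1 (proj 0 (arg 0 0))) (.call 12 (tup [arg 1 0, .var 0, .var 0])))
    (.letIn (.call 25 (tup [arg 1 1, arg 1 2, arg 1 4,
        .call 13 (tup [.un .fst (.var 0), .un .snd (.var 0)]),
        .call 13 (tup [arg 1 2, .const 1]), .un .fst (.var 0)]))
      (.call 24 (tup [.bin .mul (.bin .add (.const 1) (arg 2 4)) (arg 2 3),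
        .call 21 (tup [arg 2 1, .un .fst (.var 0), .un .snd (.var 0), arg 2 1,
          .un .fst (.var 0)])])))

/-- The procedures, in the order in which `.call` refers to them. -/
def procs : List Expr :=
  [nthBody, partBody, volBody, growBody, carveBody, meetBody, updBody, mwuBody, levelsBody,
    onesBody, indexBody, scanRowBody, scanBody, halvingsBody, unaryBody, appendBody, insBody,
    rowBody, convBody, splitBody, famBody, guessBody, outerBody, innerBody, pickBody, setupBody,
    runBody]

/-- The clustering algorithm.  The points are numbered, the table of candidates is computed, and the
number and the cost of the balls are stripped from the encoding of the chosen candidate. -/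
def algorithm : Program where
  procs := procs
  main :=
    .letIn (.call 10 (tup [.un .snd (.un .snd (.un .snd (.var 0))), .const 0]))
      (.un .snd (.un .snd (.call 26 (tup [.un .snd (.un .snd (.un .snd (.var 1))), .var 0,
        proj 0 (.var 1), proj 1 (.var 1), proj 2 (.var 1)]))))

/-- Component `k` of a list, as an operation on values; compare `proj`. -/
def comp : ℕ → Val → Val
  | 0, v => v.fst
  | k + 1, v => comp k v.snd

theorem wp_proj {α : ℝ} {P : List Expr} (k : ℕ) (a : Expr) (env : List Val)
    (Q : Val → ℕ → Prop) : wp α P (proj k a) env Q ↔ wp α P a env fun v t => Q (comp k v) t := by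
  induction k generalizing a with
  | zero => rfl
  | succ k ih => exact ih _

/-! ### Encoding of the data -/

variable {X : Type} {n : ℕ}

/-- The balls of a candidate, in the output format. -/
def encB (e : Fin n ≃ X) (b : List (X × ℝ)) : Val :=
  Val.ofList (b.map fun q => .cons (.num ((e.symm q.1 : ℕ) : ℝ)) (.num q.2))

/-- A candidate is encoded by its number of balls, its cost and its balls. -/
def encC (α : ℝ) (e : Fin n ≃ X) (b : List (X × ℝ)) : Val :=
  .cons (.num b.length) (.cons (.num (candCost α b)) (encB e b))

/-- Tables of candidates. -/
def encT (α : ℝ) (e : Fin n ≃ X) (T : List (List (X × ℝ))) : Val := Val.ofList (T.map (encC α e))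

section

variable (α : ℝ) (e : Fin n ≃ X)

theorem encB_nil : encB e [] = .nil := rfl
theorem encB_cons (q : X × ℝ) (b : List (X × ℝ)) :
    encB e (q :: b) = .cons (.cons (.num ((e.symm q.1 : ℕ) : ℝ)) (.num q.2)) (encB e b) := rfl
theorem encT_nil : encT α e [] = .nil := rfl
theorem encT_cons (b : List (X × ℝ)) (T : List (List (X × ℝ))) :
    encT α e (b :: T) = .cons (encC α e b) (encT α e T) := rfl

end

variable [MetricSpace X]

/-- A point is encoded by its index and its row of the distance matrix. -/
def encP (e : Fin n ≃ X) (x : X) : Val :=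
  .cons (.num ((e.symm x : ℕ) : ℝ)) (Val.ofList (List.ofFn fun j => .num (dist x (e j))))

/-- Lists of points. -/
def encL (e : Fin n ≃ X) (l : List X) : Val := Val.ofList (l.map (encP e))

/-- Points with weights. -/
def encW (e : Fin n ≃ X) (w : X → ℝ) (l : List X) : Val :=
  Val.ofList (l.map fun x => .cons (encP e x) (.num (w x)))

/-- A partition, given by the list of the balls that are carved out. -/
def encPart (e : Fin n ≃ X) (P : List (X × ℝ)) : Val :=
  Val.ofList (P.map fun q => .cons (encP e q.1) (.num q.2))

/-- Families of partitions. -/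
def encF (e : Fin n ≃ X) (F : List (List (X × ℝ))) : Val := Val.ofList (F.map (encPart e))

/-- The families for several scales. -/
def encFs (e : Fin n ≃ X) (Fs : List (List (List (X × ℝ)))) : Val := Val.ofList (Fs.map (encF e))

/-- Natural numbers in unary. -/
def unary (k : ℕ) : Val := Val.ofList (List.replicate k .nil)

section

theorem comp_zero (a b : Val) : comp 0 (.cons a b) = a := rfl
theorem comp_succ (k : ℕ) (a b : Val) : comp (k + 1) (.cons a b) = comp k b := rfl

variable (e : Fin n ≃ X)

theorem fst_cons (a b : Val) : (Val.cons a b).fst = a := rfl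
theorem snd_cons (a b : Val) : (Val.cons a b).snd = b := rfl
theorem toReal_num (x : ℝ) : (Val.num x).toReal = x := rfl
theorem ofList_nil : Val.ofList [] = .nil := rfl
theorem ofList_cons (a : Val) (l : List Val) : Val.ofList (a :: l) = .cons a (Val.ofList l) := rfl
theorem encL_nil : encL e [] = .nil := rfl
theorem encL_cons (x : X) (l : List X) : encL e (x :: l) = .cons (encP e x) (encL e l) := rfl
theorem encW_nil (w : X → ℝ) : encW e w [] = .nil := rfl
theorem encW_cons (w : X → ℝ) (x : X) (l : List X) :
    encW e w (x :: l) = .cons (.cons (encP e x) (.num (w x))) (encW e w l) := rfl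
theorem encPart_nil : encPart e [] = .nil := rfl
theorem encPart_cons (q : X × ℝ) (P : List (X × ℝ)) :
    encPart e (q :: P) = .cons (.cons (encP e q.1) (.num q.2)) (encPart e P) := rfl
theorem encF_nil : encF e [] = .nil := rfl
theorem encF_cons (P : List (X × ℝ)) (F : List (List (X × ℝ))) :
    encF e (P :: F) = .cons (encPart e P) (encF e F) := rfl
theorem encFs_nil : encFs e [] = .nil := rfl
theorem encFs_cons (F : List (List (X × ℝ))) (Fs : List (List (List (X × ℝ)))) :
    encFs e (F :: Fs) = .cons (encF e F) (encFs e Fs) := rfl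
theorem unary_zero : unary 0 = .nil := rfl
theorem unary_succ (k : ℕ) : unary (k + 1) = .cons .nil (unary k) := rfl

theorem encL_eq_nil {l : List X} : encL e l = .nil ↔ l = [] := by
  cases l <;> simp [encL_nil, encL_cons]

end

end

noncomputable section

attribute [local simp ↓] wp_var_zero wp_var_succ wp_const wp_nil wp_un wp_bin wp_letIn wp_ifNil
  wp_ifLe wp_call wp_proj tup arg distE

attribute [local simp] caseNil_nil caseNil_cons comp_zero comp_succ UnOp.apply BinOp.apply fst_cons
  snd_cons toReal_num ofList_nil ofList_cons encL_nil encL_cons encW_nil encW_cons encPart_nil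
  encPart_cons encF_nil encF_cons encFs_nil encFs_cons encB_nil encB_cons encT_nil encT_cons
  unary_zero unary_succ

variable {X : Type} [MetricSpace X] {n : ℕ}

/-! ### Correctness of the program: partitions -/

theorem halts_nth (α : ℝ) (l : List ℝ) (i : ℕ) (hi : i < l.length) :
    Halts α procs 0 (Val.ofList [Val.ofList (l.map .num), .num i]) (.num l[i]) (300 * (i + 1)) := by
  induction i generalizing l with
  | zero =>
    refine .of_wp rfl (by decide) ?_
    cases l with
    | nil => simp at hi
    | cons x l =>
      simp [nthBody]
      exact .intro (fun _ => trivial) (fun h => absurd h (lt_irrefl _))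
  | succ i ih =>
    refine .of_wp rfl (by decide) ?_
    cases l with
    | nil => simp at hi
    | cons x l =>
      simp [nthBody]
      refine .intro (fun h => ?_) (fun _ => ?_)
      · have : 0 < (i : ℝ) + 1 := by positivity
        linarith
      · refine .intro (ih l (by simpa using hi)) ?_
        simp
        omega

/-- Time bound for the computation of a distance. -/
def tDist (n : ℕ) : ℕ := 300 * n

theorem halts_dist (α : ℝ) (e : Fin n ≃ X) (x y : X) :
    Halts α procs 0 (Val.ofList [(encP e x).snd, (encP e y).fst]) (.num (dist x y)) (tDist n) := by
  have h := halts_nth α (List.ofFn fun j => dist x (e j)) (e.symm y) (by simp)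
  simp only [List.map_ofFn, List.getElem_ofFn, Fin.eta, Equiv.apply_symm_apply] at h
  exact h.mono (by have := (e.symm y).2; unfold tDist; omega)

/-- Time bound for `partBody`. -/
def tPart (n : ℕ) : ℕ := (n + 1) * (tDist n + 300)

theorem halts_part (α : ℝ) (e : Fin n ≃ X) (c : X) (R : ℝ) (S : List X) (hS : S.length ≤ n) :
    Halts α procs 1 (Val.ofList [encP e c, .num R, encL e S])
      (.cons (encL e (near c R S)) (encL e (far c R S))) (tPart n) := by
  suffices h : ∀ S : List X, Halts α procs 1 (Val.ofList [encP e c, .num R, encL e S])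
      (.cons (encL e (near c R S)) (encL e (far c R S))) ((S.length + 1) * (tDist n + 300)) from
    (h S).mono (by unfold tPart; gcongr)
  intro S
  induction S with
  | nil =>
    refine .of_wp rfl (by decide) ?_
    simp [partBody, near, far]
  | cons x S ih =>
    refine .of_wp rfl (by decide) ?_
    simp [partBody]
    refine .intro ih ?_
    simp
    refine .intro (halts_dist α e c x) ?_
    simp
    refine .intro (fun h => ?_) (fun h => ?_)
    · simp [h, near, far, not_lt.2 h]; linarith
    · simp [h, near, far, not_le.2 h]; linarith

/-- Time bound for `volBody`. -/
def tVol (n : ℕ) : ℕ := (n + 1) * (tPart n + tDist n + 300)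

theorem halts_vol (α : ℝ) (e : Fin n ≃ X) (w : X → ℝ) (r : ℝ) (rem : List X)
    (hrem : rem.length ≤ n) (v : X) (R : ℝ) (l : List X) (hl : l.length ≤ n) :
    Halts α procs 2 (Val.ofList [encP e v, .num R, .num r, encL e rem, encW e w l])
      (.num (vol l w r rem v R)) (tVol n) := by
  suffices h : Halts α procs 2 (Val.ofList [encP e v, .num R, .num r, encL e rem, encW e w l])
      (.num (vol l w r rem v R)) ((l.length + 1) * (tPart n + tDist n + 300)) from
    h.mono (by unfold tVol; gcongr)
  clear hl
  induction l with
  | nil =>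
    refine .of_wp rfl (by decide) ?_
    simp [volBody, vol]
  | cons x l ih =>
    refine .of_wp rfl (by decide) ?_
    simp [volBody]
    refine .intro ih ?_
    simp
    refine .intro (halts_dist α e v x) ?_
    simp
    refine .intro (fun h => ?_) (fun h => ?_)
    · refine .intro (halts_part α e x r rem hrem) ?_
      simp
      refine .intro (fun hn => ?_) (fun hn => ?_)
      · simp [(encL_eq_nil e).1 hn, vol]; linarith
      · have hn' : near x r rem ≠ [] := fun h => hn ((encL_eq_nil e).2 h)
        simp [hn', vol, h]; linarith
    · simp [not_le.2 h, vol]; linarith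

/-- Time bound for `growBody`. -/
def tGrow (n T : ℕ) : ℕ := (T + 1) * (2 * tVol n + 300)

theorem halts_grow (α : ℝ) (e : Fin n ≃ X) (w : X → ℝ) (r δ base : ℝ) (rem : List X)
    (hrem : rem.length ≤ n) (v : X) (l : List X) (hl : l.length ≤ n) (T : ℕ) (R : ℝ) :
    Halts α procs 3 (Val.ofList [unary T, .num R, .num r, .num δ, .num base, encP e v, encL e rem,
      encW e w l]) (.num (grow (fun R => vol l w r rem v R + base) (2 * r) δ T R)) (tGrow n T) := by
  unfold tGrow
  induction T generalizing R with
  | zero =>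
    refine .of_wp rfl (by decide) ?_
    simp [growBody, grow]
  | succ T ih =>
    refine .of_wp rfl (by decide) ?_
    simp [growBody, grow]
    refine .intro (halts_vol α e w r rem hrem v _ l hl) ?_
    simp
    refine .intro (halts_vol α e w r rem hrem v _ l hl) ?_
    simp
    refine .intro (fun h => ?_) (fun h => ?_)
    · simp [not_lt.2 h]; nlinarith [Nat.zero_le (T * tVol n)]
    · refine .intro (ih _) ?_
      simp [not_le.2 h]; linarith

/-- Time bound for `carveBody`. -/
def tCarve (n T : ℕ) : ℕ := (n + 1) * (tGrow n T + tPart n + 300)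

theorem halts_carve (α : ℝ) (e : Fin n ≃ X) (w : X → ℝ) {r : ℝ} (hr : 0 ≤ r) (δ base : ℝ)
    (pts : List X) (hpts : pts.length ≤ n) (T : ℕ) (rem : List X) (hrem : rem.length ≤ n) :
    Halts α procs 4 (Val.ofList [encL e rem, .num r, .num δ, .num base, unary T, encW e w pts])
      (encPart e (carve pts w r δ base T n rem)) (tCarve n T) := by
  suffices h : ∀ f : ℕ, ∀ rem : List X, rem.length ≤ n → rem.length ≤ f →
      Halts α procs 4 (Val.ofList [encL e rem, .num r, .num δ, .num base, unary T, encW e w pts])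
      (encPart e (carve pts w r δ base T f rem)) ((f + 1) * (tGrow n T + tPart n + 300)) from
    h n rem hrem hrem
  clear hrem rem
  intro f
  induction f with
  | zero =>
    intro rem hrem hf
    obtain rfl := List.length_eq_zero_iff.1 (Nat.le_zero.1 hf)
    refine .of_wp rfl (by decide) ?_
    simp [carveBody, carve]
  | succ f ih =>
    intro rem hrem hf
    refine .of_wp rfl (by decide) ?_
    cases rem with
    | nil =>
      simp [carveBody, carve]
      nlinarith [Nat.zero_le ((f + 1) * (tGrow n T + tPart n))]
    | cons v rem =>
      simp [carveBody]
      refine .intro (halts_grow α e w r δ base (v :: rem) hrem v pts hpts T 0) ?_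
      simp [carve]
      refine .intro (halts_part α e v _ (v :: rem) hrem) ?_
      set ρ := grow (fun R => vol pts w r (v :: rem) v R + base) (2 * r) δ T 0 + r with hρ
      have h0 : 0 ≤ ρ := add_nonneg
        (grow_mem_Icc (fun R => vol pts w r (v :: rem) v R + base) (by linarith) δ T 0).1 hr
      have hlt : (far v ρ (v :: rem)).length < (v :: rem).length :=
        length_far_lt List.mem_cons_self (by simpa using h0)
      simp
      refine .intro (ih _ (by omega) (by omega)) ?_
      simp
      linarith

/-- Time bound for `meetBody`. -/
def tMeet (n : ℕ) : ℕ := (n + 1) * (tPart n + 300)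

theorem halts_meet (α : ℝ) (e : Fin n ≃ X) (U : List X) (hU : U.length ≤ n) (P : List (X × ℝ))
    (hP : P.length ≤ n) :
    Halts α procs 5 (Val.ofList [encL e U, encPart e P]) (.num (meet U P)) (tMeet n) := by
  suffices h : Halts α procs 5 (Val.ofList [encL e U, encPart e P]) (.num (meet U P))
      ((P.length + 1) * (tPart n + 300)) from h.mono (by unfold tMeet; gcongr)
  clear hP
  induction P generalizing U with
  | nil =>
    refine .of_wp rfl (by decide) ?_
    simp [meetBody, meet]
  | cons q P ih =>
    refine .of_wp rfl (by decide) ?_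
    simp [meetBody]
    refine .intro (halts_part α e q.1 q.2 U hU) ?_
    simp
    refine .intro (fun hn => ?_) (fun hn => ?_)
    · refine .intro (ih _ ((length_far_le _ _ _).trans hU)) ?_
      simp [meet, (encL_eq_nil e).1 hn]; linarith
    · have hn' : near q.1 q.2 U ≠ [] := fun h => hn ((encL_eq_nil e).2 h)
      refine .intro (ih _ ((length_far_le _ _ _).trans hU)) ?_
      simp [meet, hn']; linarith

/-- Time bound for `updBody`. -/
def tUpd (n : ℕ) : ℕ := (n + 1) * (tPart n + tMeet n + 300)

theorem halts_upd (α : ℝ) (e : Fin n ≃ X) (w : X → ℝ) (r : ℝ) (pts : List X)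
    (hpts : pts.length = n) (P : List (X × ℝ)) (hP : P.length ≤ n) (l : List X)
    (hl : l.length ≤ n) :
    Halts α procs 6 (Val.ofList [encW e w l, encL e pts, .num r, .num n, encPart e P])
      (encW e (upd pts r P w) l) (tUpd n) := by
  suffices h : Halts α procs 6 (Val.ofList [encW e w l, encL e pts, .num r, .num n, encPart e P])
      (encW e (upd pts r P w) l) ((l.length + 1) * (tPart n + tMeet n + 300)) from
    h.mono (by unfold tUpd; gcongr)
  clear hl
  induction l with
  | nil =>
    refine .of_wp rfl (by decide) ?_
    simp [updBody]
  | cons x l ih =>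
    refine .of_wp rfl (by decide) ?_
    simp [updBody]
    refine .intro (halts_part α e x r pts hpts.le) ?_
    simp
    refine .intro (halts_meet α e _ ((length_near_le _ _ _).trans hpts.le) P hP) ?_
    simp
    refine .intro ih ?_
    simp [upd, hpts]; linarith

theorem vol_eq_sum {pts : List X} (hpts : ∀ x, x ∈ pts) (w : X → ℝ) {r : ℝ} (hr : 0 ≤ r) (v : X)
    {D : ℝ} (hD : ∀ x y : X, dist x y ≤ D) : vol pts w r pts v D = (pts.map w).sum := by
  unfold vol
  congr 1
  refine List.map_congr_left fun c _ => ?_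
  rw [if_pos ⟨hD v c, List.ne_nil_of_mem (mem_near.2 ⟨hpts c, by simpa using hr⟩)⟩]

/-- Time bound for `mwuBody`. -/
def tMwu (n T f : ℕ) : ℕ := (f + 1) * (tVol n + tCarve n T + tUpd n + 300)

theorem halts_mwu (α : ℝ) (e : Fin n ≃ X) {r : ℝ} (hr : 0 ≤ r) (δ : ℝ)
    {pts : List X} (hpts : ∀ x, x ∈ pts) (hne : pts ≠ []) (hn : pts.length = n) (T : ℕ) {D : ℝ}
    (hD : ∀ x y : X, dist x y ≤ D) (f : ℕ) (w : X → ℝ) :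
    Halts α procs 7 (Val.ofList [unary f, encW e w pts, encL e pts, .num r, .num δ, unary T,
      .num n, .num D]) (encF e (mwu pts r δ T f w)) (tMwu n T f) := by
  unfold tMwu
  induction f generalizing w with
  | zero =>
    refine .of_wp rfl (by decide) ?_
    simp [mwuBody, mwu]
  | succ f ih =>
    refine .of_wp rfl (by decide) ?_
    obtain ⟨v, l, rfl⟩ := List.exists_cons_of_ne_nil hne
    have h1 := halts_vol α e w r (v :: l) hn.le v D (v :: l) hn.le
    rw [vol_eq_sum hpts w hr v hD] at h1
    simp [mwuBody]
    refine .intro h1 ?_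
    simp
    refine .intro (halts_carve α e w hr δ _ (v :: l) hn.le T (v :: l) hn.le) ?_
    refine .intro (halts_upd α e w r (v :: l) hn _ (length_carve_le _ _ _ _ _ _ _ _) (v :: l)
      hn.le) ?_
    simp
    refine .intro (ih _) ?_
    simp only [List.length_cons] at hn
    simp [mwu, hn]
    linarith

/-- Time bound for `levelsBody`. -/
def tLevels (n T f m : ℕ) : ℕ := (m + 1) * (tMwu n T f + 300)

theorem halts_levels (α : ℝ) (e : Fin n ≃ X) {κ : ℝ} (hκ : 0 ≤ κ) (δ : ℝ)
    {pts : List X} (hpts : ∀ x, x ∈ pts) (hne : pts ≠ []) (hn : pts.length = n) (T : ℕ) {D₀ : ℝ}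
    (hD₀ : ∀ x y : X, dist x y ≤ D₀) (f m : ℕ) {D : ℝ} (hD : 0 ≤ D) :
    Halts α procs 8 (Val.ofList [unary m, .num D, .num κ, unary f, encW e (fun _ => 1) pts,
      encL e pts, .num δ, unary T, .num n, .num D₀]) (encFs e (levels pts κ δ T f m D))
      (tLevels n T f m) := by
  unfold tLevels
  induction m generalizing D with
  | zero =>
    refine .of_wp rfl (by decide) ?_
    simp [levelsBody, levels]
  | succ m ih =>
    refine .of_wp rfl (by decide) ?_
    simp [levelsBody]
    refine .intro (halts_mwu α e (div_nonneg hD hκ) δ hpts hne hn T hD₀ f fun _ => 1) ?_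
    refine .intro (ih (by positivity)) ?_
    simp [levels]
    linarith

/-! ### Correctness of the program: preprocessing -/

omit [MetricSpace X] in
theorem ceil_eq_succ_of_pos {x : ℝ} (hx : 0 < x) : ⌈x⌉₊ = ⌈x - 1⌉₊ + 1 := by
  have h := Nat.ceil_pos.2 hx
  have : ⌈x - 1⌉₊ = ⌈x⌉₊ - 1 := by
    exact Nat.ceil_sub_one x
  omega

theorem halts_unary (α x : ℝ) :
    Halts α procs 14 (.num x) (unary ⌈x⌉₊) ((⌈x⌉₊ + 1) * 300) := by
  obtain ⟨N, hN⟩ : ∃ N, ⌈x⌉₊ = N := ⟨_, rfl⟩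
  induction N generalizing x with
  | zero =>
    refine .of_wp rfl (by decide) ?_
    rw [hN]
    simp [unaryBody]
    exact .intro (fun _ => trivial) fun h => absurd (Nat.ceil_pos.2 h) (by omega)
  | succ N ih =>
    refine .of_wp rfl (by decide) ?_
    have hx : 0 < x := Nat.ceil_pos.1 (by omega)
    have h1 := ceil_eq_succ_of_pos hx
    simp [unaryBody]
    refine .intro (fun h => absurd hx (not_lt.2 h)) fun _ => ?_
    refine .intro (ih (x - 1) (by omega)) ?_
    rw [h1]
    simp
    linarith

theorem halts_halvings (α : ℝ) {d : ℝ} (j : ℕ) (D : ℝ) (hj : D / 2 ^ j < d) :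
    ∃ m : ℕ, Halts α procs 13 (Val.ofList [.num D, .num d]) (.num m) ((m + 1) * 300) ∧
      D / 2 ^ m < d ∧ ∀ i < m, d ≤ D / 2 ^ i := by
  induction j generalizing D with
  | zero =>
    rw [pow_zero, div_one] at hj
    refine ⟨0, .of_wp rfl (by decide) ?_, by simpa using hj, by simp⟩
    simp [halvingsBody]
    exact .intro (fun h => absurd hj (not_lt.2 h)) fun _ => trivial
  | succ j ih =>
    rcases lt_or_ge D d with h | h
    · refine ⟨0, .of_wp rfl (by decide) ?_, by simpa using h, by simp⟩
      simp [halvingsBody]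
      exact .intro (fun h' => absurd h (not_lt.2 h')) fun _ => trivial
    · obtain ⟨m, hm, h1, h2⟩ := ih (D / 2) (by rwa [div_div, ← pow_succ'])
      refine ⟨m + 1, .of_wp rfl (by decide) ?_, by rwa [pow_succ', ← div_div], fun i hi => ?_⟩
      · simp [halvingsBody]
        refine .intro (fun _ => .intro hm ?_) fun h' => absurd h (not_le.2 h')
        simp
        constructor
        · ring
        · linarith
      · cases i with
        | zero => simpa using h
        | succ i =>
          rw [pow_succ', ← div_div]
          exact h2 i (by omega)

/-- `mx'` is the maximum of `mx` and the elements of `l`, and `mn'` the minimum of `mn` and the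
positive elements of `l`. -/
def ScanRel (l : List ℝ) (mx mn mx' mn' : ℝ) : Prop :=
  (mx ≤ mx' ∧ (∀ x ∈ l, x ≤ mx') ∧ (mx' = mx ∨ mx' ∈ l)) ∧
    mn' ≤ mn ∧ (∀ x ∈ l, 0 < x → mn' ≤ x) ∧ (mn' = mn ∨ mn' ∈ l ∧ 0 < mn')

theorem ScanRel.append {l l' : List ℝ} {mx mn mx' mn' mx'' mn'' : ℝ}
    (h : ScanRel l mx mn mx' mn') (h' : ScanRel l' mx' mn' mx'' mn'') :
    ScanRel (l ++ l') mx mn mx'' mn'' := by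
  obtain ⟨⟨h1, h2, h3⟩, h4, h5, h6⟩ := h
  obtain ⟨⟨k1, k2, k3⟩, k4, k5, k6⟩ := h'
  refine ⟨⟨h1.trans k1, fun x hx => ?_, ?_⟩, k4.trans h4, fun x hx h0 => ?_, ?_⟩
  · exact (List.mem_append.1 hx).elim (fun h => (h2 x h).trans k1) (k2 x)
  · rcases k3 with rfl | k
    · exact h3.imp_right (List.mem_append_left _)
    · exact .inr (List.mem_append_right _ k)
  · exact (List.mem_append.1 hx).elim (fun h => k4.trans (h5 x h h0)) fun h => k5 x h h0
  · rcases k6 with rfl | k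
    · exact h6.imp_right fun h => ⟨List.mem_append_left _ h.1, h.2⟩
    · exact .inr ⟨List.mem_append_right _ k.1, k.2⟩

theorem scanRel_singleton (x mx mn : ℝ) :
    ScanRel [x] mx mn (if x ≤ mx then mx else x)
      (if x ≤ 0 then mn else if x ≤ mn then x else mn) := by
  unfold ScanRel
  split_ifs with h1 h2 h3 h2 h3 <;> simp_all <;> grind

theorem halts_scanRow (α : ℝ) (l : List ℝ) (mx mn : ℝ) :
    ∃ mx' mn', Halts α procs 11 (Val.ofList [Val.ofList (l.map .num), .num mx, .num mn])
      (.cons (.num mx') (.num mn')) ((l.length + 1) * 300) ∧ ScanRel l mx mn mx' mn' := by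
  induction l generalizing mx mn with
  | nil =>
    refine ⟨mx, mn, .of_wp rfl (by decide) ?_, by simp [ScanRel]⟩
    simp [scanRowBody]
  | cons x l ih =>
    have hs := scanRel_singleton x mx mn
    set mx₁ := if x ≤ mx then mx else x with hmx
    set mn₁ := if x ≤ 0 then mn else if x ≤ mn then x else mn with hmn
    obtain ⟨mx', mn', h, h'⟩ := ih mx₁ mn₁
    refine ⟨mx', mn', .of_wp rfl (by decide) ?_, hs.append h'⟩
    have key : ∀ a b : ℝ, a = mx₁ → b = mn₁ → calls α procs 11
        ((Val.ofList (List.map Val.num l)).cons ((Val.num a).cons ((Val.num b).cons Val.nil)))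
        fun w' t => w' = (Val.num mx').cons (Val.num mn') ∧
          t + 300 ≤ (l.length + 1 + 1) * 300 := by
      rintro a b rfl rfl
      refine .intro h ?_
      simp; linarith
    simp [scanRowBody]
    refine .intro (fun h1 => ?_) (fun h1 => ?_)
    · have h1' : mx = mx₁ := by rw [hmx, if_pos h1]
      refine .intro (fun h2 => ?_) (fun h2 => .intro (fun h3 => ?_) (fun h3 => ?_))
      · exact key _ _ h1' (by rw [hmn, if_pos h2])
      · exact key _ _ h1' (by rw [hmn, if_neg (not_le.2 h2), if_pos h3])
      · exact key _ _ h1' (by rw [hmn, if_neg (not_le.2 h2), if_neg (not_le.2 h3)])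
    · have h1' : x = mx₁ := by rw [hmx, if_neg (not_le.2 h1)]
      refine .intro (fun h2 => ?_) (fun h2 => .intro (fun h3 => ?_) (fun h3 => ?_))
      · exact key _ _ h1' (by rw [hmn, if_pos h2])
      · exact key _ _ h1' (by rw [hmn, if_neg (not_le.2 h2), if_pos h3])
      · exact key _ _ h1' (by rw [hmn, if_neg (not_le.2 h2), if_neg (not_le.2 h3)])

theorem halts_scan (α : ℝ) (n : ℕ) (l : List (List ℝ)) (hl : ∀ r ∈ l, r.length ≤ n) (mx mn : ℝ) :
    ∃ mx' mn', Halts α procs 12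
      (Val.ofList [Val.ofList (l.map fun r => Val.ofList (r.map .num)), .num mx, .num mn])
      (.cons (.num mx') (.num mn')) ((l.length + 1) * ((n + 1) * 300 + 300)) ∧
      ScanRel l.flatten mx mn mx' mn' := by
  induction l generalizing mx mn with
  | nil =>
    refine ⟨mx, mn, .of_wp rfl (by decide) ?_, by simp [ScanRel]⟩
    simp [scanBody]
  | cons r l ih =>
    obtain ⟨mx₁, mn₁, h, hs⟩ := halts_scanRow α r mx mn
    obtain ⟨mx', mn', h', hs'⟩ := ih (fun r hr => hl r (List.mem_cons_of_mem _ hr)) mx₁ mn₁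
    refine ⟨mx', mn', .of_wp rfl (by decide) ?_, by simpa using hs.append hs'⟩
    simp [scanBody]
    refine .intro h ?_
    simp
    refine .intro h' ?_
    have := hl r List.mem_cons_self
    simp
    nlinarith

/-- The given values, paired with their positions, counted from `i`. -/
def numbered : List Val → ℕ → List Val
  | [], _ => []
  | a :: l, i => .cons (.num i) a :: numbered l (i + 1)

theorem numbered_ofFn {n : ℕ} (g : Fin n → Val) (i : ℕ) :
    numbered (List.ofFn g) i = List.ofFn fun j => .cons (.num ((i + j : ℕ) : ℝ)) (g j) := by
  induction n generalizing i with
  | zero => simp [numbered]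
  | succ n ih =>
    rw [List.ofFn_succ, numbered, ih, List.ofFn_succ]
    simp only [Fin.val_zero, add_zero, Fin.val_succ, add_assoc, add_comm 1]

theorem halts_index (α : ℝ) (l : List Val) (i : ℕ) :
    Halts α procs 10 (Val.ofList [Val.ofList l, .num i]) (Val.ofList (numbered l i))
      ((l.length + 1) * 300) := by
  induction l generalizing i with
  | nil =>
    refine .of_wp rfl (by decide) ?_
    simp [indexBody, numbered]
  | cons a l ih =>
    refine .of_wp rfl (by decide) ?_
    have h := ih (i + 1)
    push_cast at h
    simp [indexBody, numbered]
    refine .intro h ?_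
    simp
    linarith

theorem halts_ones (α : ℝ) (e : Fin n ≃ X) (l : List X) :
    Halts α procs 9 (encL e l) (encW e (fun _ => 1) l) ((l.length + 1) * 300) := by
  induction l with
  | nil =>
    refine .of_wp rfl (by decide) ?_
    simp [onesBody]
  | cons a l ih =>
    refine .of_wp rfl (by decide) ?_
    simp [onesBody]
    refine .intro ih ?_
    simp
    linarith

/-! ### Correctness of the program: tables of candidates -/

theorem halts_append (α : ℝ) (a b : List Val) :
    Halts α procs 15 (Val.ofList [Val.ofList a, Val.ofList b]) (Val.ofList (a ++ b))
      ((a.length + 1) * 300) := by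
  induction a with
  | nil =>
    refine .of_wp rfl (by decide) ?_
    simp [appendBody]
  | cons x a ih =>
    refine .of_wp rfl (by decide) ?_
    simp [appendBody]
    refine .intro ih ?_
    simp
    linarith

omit [MetricSpace X] in
theorem halts_ins (α : ℝ) (e : Fin n ≃ X) (c : List (X × ℝ)) (T : List (List (X × ℝ))) :
    Halts α procs 16 (Val.ofList [encC α e c, encT α e T]) (encT α e (ins α c T))
      ((T.length + 1) * 300) := by
  induction T with
  | nil =>
    refine .of_wp rfl (by decide) ?_
    simp [insBody, ins]
  | cons t T ih =>
    refine .of_wp rfl (by decide) ?_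
    have key : ¬ (c.length ≤ t.length ∧ t.length ≤ c.length) →
        calls α procs 16 ((encC α e c).cons ((encT α e T).cons Val.nil)) fun w' t' =>
          (encC α e t).cons w' = encT α e (ins α c (t :: T)) ∧
            t' + 300 ≤ (T.length + 1 + 1) * 300 := by
      intro h
      refine .intro ih ?_
      rw [ins, if_neg h]
      simp
      linarith
    simp [insBody, encC]
    refine .intro (fun h1 => .intro (fun h2 => ?_) (fun h2 => ?_)) (fun h1 => ?_)
    · have h : c.length ≤ t.length ∧ t.length ≤ c.length :=
        ⟨by exact_mod_cast h1, by exact_mod_cast h2⟩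
      refine .intro (fun h3 => ?_) (fun h3 => ?_)
      · simp [ins, h, h3, encC]
      · simp [ins, h, not_le.2 h3, encC]
    · refine key fun h => absurd h.2 (not_le.2 (by exact_mod_cast h2))
    · refine key fun h => absurd h.1 (not_le.2 (by exact_mod_cast h1))

/-- Time bound for `rowBody`. -/
def tRow (n : ℕ) : ℕ := (n + 2) * ((n + 1) * 300 + (n + 2) * 300 + 300)

omit [MetricSpace X] in
theorem halts_row (α : ℝ) (e : Fin n ≃ X) (a : List (X × ℝ)) (T acc : List (List (X × ℝ)))
    (hT : T.length ≤ n + 1) (hab : ∀ b ∈ T, a.length + b.length ≤ n) (hacc : Small n acc) :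
    Halts α procs 17 (Val.ofList [encC α e a, encT α e T, encT α e acc])
      (encT α e (row α a T acc)) (tRow n) := by
  suffices h : Halts α procs 17 (Val.ofList [encC α e a, encT α e T, encT α e acc])
      (encT α e (row α a T acc)) ((T.length + 1) * ((n + 1) * 300 + (n + 2) * 300 + 300)) from
    h.mono (Nat.mul_le_mul_right _ (by omega))
  clear hT
  induction T with
  | nil =>
    refine .of_wp rfl (by decide) ?_
    simp [rowBody, row]
  | cons b T ih =>
    refine .of_wp rfl (by decide) ?_
    have h1 := halts_append α (a.map fun q => .cons (.num ((e.symm q.1 : ℕ) : ℝ)) (.num q.2))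
      (b.map fun q => .cons (.num ((e.symm q.1 : ℕ) : ℝ)) (.num q.2))
    rw [← List.map_append, List.length_map] at h1
    have h2 := halts_ins α e (a ++ b) (row α a T acc)
    have h3 : (row α a T acc).length ≤ n + 1 :=
      (hacc.row fun b hb => hab b (List.mem_cons_of_mem _ hb)).length_le
    have h4 := hab b List.mem_cons_self
    have h5 : encC α e (a ++ b) = .cons (.num (a.length + b.length))
      (.cons (.num (candCost α a + candCost α b)) (encB e (a ++ b))) := by
      simp [encC, candCost_append]
    rw [h5] at h2
    have ih := ih fun b hb => hab b (List.mem_cons_of_mem _ hb)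
    simp only [encC] at ih
    simp [rowBody, encC]
    refine .intro h1 ?_
    refine .intro ih ?_
    refine .intro h2 ?_
    refine ⟨rfl, ?_⟩
    nlinarith

/-- Time bound for `convBody`. -/
def tConv (n : ℕ) : ℕ := (n + 2) * (tRow n + 300)

omit [MetricSpace X] in
theorem halts_conv (α : ℝ) (e : Fin n ≃ X) (T₁ T₂ acc : List (List (X × ℝ)))
    (hT₁ : T₁.length ≤ n + 1) (hT₂ : T₂.length ≤ n + 1)
    (hab : ∀ a ∈ T₁, ∀ b ∈ T₂, a.length + b.length ≤ n) (hacc : Small n acc) :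
    Halts α procs 18 (Val.ofList [encT α e T₁, encT α e T₂, encT α e acc])
      (encT α e (conv α T₁ T₂ acc)) (tConv n) := by
  suffices h : Halts α procs 18 (Val.ofList [encT α e T₁, encT α e T₂, encT α e acc])
      (encT α e (conv α T₁ T₂ acc)) ((T₁.length + 1) * (tRow n + 300)) from
    h.mono (Nat.mul_le_mul_right _ (by omega))
  clear hT₁
  induction T₁ with
  | nil =>
    refine .of_wp rfl (by decide) ?_
    simp [convBody, conv]
  | cons a T ih =>
    refine .of_wp rfl (by decide) ?_
    have hab' := fun a ha => hab a (List.mem_cons_of_mem _ ha)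
    simp [convBody]
    refine .intro (ih hab') ?_
    refine .intro (halts_row α e a T₂ _ hT₂ (hab a List.mem_cons_self) (hacc.conv hab')) ?_
    refine ⟨rfl, ?_⟩
    linarith

/-- The encoding of the result of `pick`. -/
def encO (α : ℝ) (e : Fin n ≃ X) : Option (List (X × ℝ)) → Val
  | none => .nil
  | some u => encC α e u

omit [MetricSpace X] in
theorem halts_pick (α : ℝ) (e : Fin n ≃ X) (K : ℝ) (T : List (List (X × ℝ))) :
    Halts α procs 24 (Val.ofList [.num K, encT α e T]) (encO α e (pick α K T))
      ((T.length + 1) * 300) := by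
  induction T with
  | nil =>
    refine .of_wp rfl (by decide) ?_
    simp [pickBody, pick, encO]
  | cons t T ih =>
    refine .of_wp rfl (by decide) ?_
    simp [pickBody, encC]
    refine .intro ih ?_
    cases hp : pick α K T with
    | none =>
      simp [encO]
      refine .intro (fun h => ?_) (fun h => ?_)
      · simp [pick, h, hp, encC]; linarith
      · simp [pick, not_le.2 h, hp]; linarith
    | some u =>
      simp [encO, encC]
      refine .intro (fun h => .intro (fun h' => ?_) (fun h' => ?_)) (fun h => ?_)
      · simp [pick, h, hp, h']; linarith
      · simp [pick, h, hp, not_le.2 h']; linarith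
      · simp [pick, not_le.2 h, hp]; linarith

/-! ### Correctness of the program: the solver -/

omit [MetricSpace X] in
theorem encT_unit (α : ℝ) (e : Fin n ≃ X) :
    encT α e [[]] = .cons (.cons (.num 0) (.cons (.num 0) .nil)) .nil := by
  simp [encC, candCost]

theorem halts_split {α : ℝ} {e : Fin n ≃ X} {Fs : List (List (List (X × ℝ)))} {pts : List X}
    {M s : ℕ} {sol : List X → List (List (X × ℝ))}
    (hsol : ∀ S : List X, S.length ≤ n →
      Halts α procs 21 (Val.ofList [encL e S, unary M, encFs e Fs, encL e pts, unary M])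
        (encT α e (sol S)) s)
    (hv : ∀ S, ValidTable S (sol S)) (S : List X) (hS : S.length ≤ n) (P : List (X × ℝ)) :
    Halts α procs 19 (Val.ofList [encL e S, encPart e P, encFs e Fs, encL e pts, unary M])
      (encT α e (splitSolve α sol S P)) ((P.length + 1) * (s + tPart n + tConv n + 300)) := by
  induction P generalizing S with
  | nil =>
    refine .of_wp rfl (by decide) ?_
    cases S with
    | nil => simp [splitBody, splitSolve, unitE, encC, candCost]
    | cons x S => simp [splitBody, splitSolve]
  | cons q P ih =>
    refine .of_wp rfl (by decide) ?_
    cases S with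
    | nil =>
      simp [splitBody, splitSolve, unitE, encC, candCost]
      nlinarith [Nat.zero_le ((P.length + 1) * (s + tPart n + tConv n))]
    | cons x S =>
      have h1 := length_near_add_far q.1 q.2 (x :: S)
      have hv₁ := (hv (near q.1 q.2 (x :: S)))
      have hv₂ := validTable_splitSolve (α := α) hv (far q.1 q.2 (x :: S)) P
      have hc := halts_conv α e (sol (near q.1 q.2 (x :: S)))
        (splitSolve α sol (far q.1 q.2 (x :: S)) P) [] (hv₁.2.length_le.trans (by omega))
        (hv₂.2.length_le.trans (by omega))
        (fun a ha b hb => by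
          have := hv₁.2.2 a ha
          have := hv₂.2.2 b hb
          omega) (small_nil n)
      simp [splitBody]
      refine .intro (halts_part α e q.1 q.2 (x :: S) hS) ?_
      simp
      refine .intro (hsol _ (by omega)) ?_
      refine .intro (ih _ (by omega)) ?_
      refine .intro hc ?_
      refine ⟨rfl, ?_⟩
      linarith

/-- Time bound for `famBody`, with `f` partitions and time `s` for the solution of a part. -/
def tFam (n f s : ℕ) : ℕ :=
  (f + 1) * ((n + 1) * (s + tPart n + tConv n + 300) + tConv n + 300)

theorem halts_fam {α : ℝ} {e : Fin n ≃ X} {Fs : List (List (List (X × ℝ)))} {pts : List X}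
    {M s : ℕ} {sol : List X → List (List (X × ℝ))}
    (hsol : ∀ S : List X, S.length ≤ n →
      Halts α procs 21 (Val.ofList [encL e S, unary M, encFs e Fs, encL e pts, unary M])
        (encT α e (sol S)) s)
    (hv : ∀ S, ValidTable S (sol S)) (S : List X) (hS : S.length ≤ n) (F : List (List (X × ℝ)))
    (hF : ∀ P ∈ F, P.length ≤ n) :
    Halts α procs 20 (Val.ofList [encF e F, encL e S, encFs e Fs, encL e pts, unary M])
      (encT α e (famSolve α sol F S)) (tFam n F.length s) := by
  unfold tFam
  induction F with
  | nil =>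
    refine .of_wp rfl (by decide) ?_
    simp [famBody, famSolve]
  | cons P F ih =>
    refine .of_wp rfl (by decide) ?_
    have hv₁ := validTable_splitSolve (α := α) hv S P
    have hv₂ := validTable_famSolve (α := α) hv F S
    have hc := halts_conv α e (splitSolve α sol S P) [[]] (famSolve α sol F S)
      (hv₁.2.length_le.trans (by omega)) (by simp)
      (fun a ha b hb => by
        have := hv₁.2.2 a ha
        obtain rfl := List.mem_singleton.1 hb
        simp only [List.length_nil]; omega) (hv₂.2.mono hS)
    rw [encT_unit] at hc
    simp [famBody, unitE]
    refine .intro (halts_split hsol hv S hS P) ?_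
    refine .intro (ih fun P hP => hF P (List.mem_cons_of_mem _ hP)) ?_
    refine .intro hc ?_
    refine ⟨rfl, ?_⟩
    have hP : (P.length + 1) * (s + tPart n + tConv n + 300) ≤
        (n + 1) * (s + tPart n + tConv n + 300) :=
      Nat.mul_le_mul_right _ (by linarith [hF P List.mem_cons_self])
    linarith

/-- Time bound for `innerBody`, with time `s` for a recursive call. -/
def tInner (n s : ℕ) : ℕ := (n + 1) * (s + tPart n + tDist n + tConv n + 300)

theorem halts_inner {α : ℝ} {e : Fin n ≃ X} {Fs : List (List (List (X × ℝ)))} {pts : List X}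
    {M m s : ℕ} {sol : List X → List (List (X × ℝ))}
    (hsol : ∀ S : List X, S.length ≤ n →
      Halts α procs 21 (Val.ofList [encL e S, unary m, encFs e Fs, encL e pts, unary M])
        (encT α e (sol S)) s)
    (hv : ∀ S, ValidTable S (sol S)) (S : List X) (hS : S.length ≤ n) (c : X)
    {acc : List (List (X × ℝ))} (hacc : ValidTable S acc) (l : List X) (hl : ∀ x ∈ l, x ∈ S)
    (hln : l.length ≤ n) :
    Halts α procs 23 (Val.ofList [encL e l, encP e c, encL e S, unary m, encFs e Fs, encL e pts,
        unary M, encT α e acc])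
      (encT α e (l.foldr (fun x acc =>
        conv α (sol (far c (dist c x) S)) [[(c, dist c x)]] acc) acc)) (tInner n s) := by
  suffices h : Halts α procs 23 (Val.ofList [encL e l, encP e c, encL e S, unary m, encFs e Fs,
        encL e pts, unary M, encT α e acc])
      (encT α e (l.foldr (fun x acc =>
        conv α (sol (far c (dist c x) S)) [[(c, dist c x)]] acc) acc))
      ((l.length + 1) * (s + tPart n + tDist n + tConv n + 300)) from
    h.mono (Nat.mul_le_mul_right _ (by omega))
  clear hln
  induction l with
  | nil =>
    refine .of_wp rfl (by decide) ?_
    simp [innerBody]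
  | cons x l ih =>
    refine .of_wp rfl (by decide) ?_
    have hx := hl x List.mem_cons_self
    have hl' := fun y hy => hl y (List.mem_cons_of_mem _ hy)
    have hv₁ := hv (far c (dist c x) S)
    have hlt := length_far_lt (c := c) hx le_rfl
    have hc := halts_conv α e (sol (far c (dist c x) S)) [[(c, dist c x)]]
      (l.foldr (fun x acc => conv α (sol (far c (dist c x) S)) [[(c, dist c x)]] acc) acc)
      (hv₁.2.length_le.trans (by omega)) (by simp)
      (fun a ha b hb => by
        have := hv₁.2.2 a ha
        obtain rfl := List.mem_singleton.1 hb
        simp only [List.length_cons, List.length_nil]; omega)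
      ((validTable_inner (fun x _ => hv _) hacc l hl').2.mono hS)
    have h1 : encT α e [[(c, dist c x)]] = .cons (.cons (.num 1) (.cons (.num (dist c x ^ α))
        (.cons (.cons (encP e c).fst (.num (dist c x))) .nil))) .nil := by
      simp [encC, candCost, encP]
    rw [h1] at hc
    simp [innerBody]
    refine .intro (halts_dist α e c x) ?_
    simp
    refine .intro (halts_part α e c (dist c x) S hS) ?_
    simp
    refine .intro (hsol _ (by omega)) ?_
    refine .intro (ih hl') ?_
    refine .intro hc ?_
    refine ⟨rfl, ?_⟩
    linarith

/-- Time bound for `outerBody`, with time `s` for a recursive call. -/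
def tOuter (n s : ℕ) : ℕ := (n + 1) * (tInner n s + 300)

theorem halts_outer {α : ℝ} {e : Fin n ≃ X} {Fs : List (List (List (X × ℝ)))} {pts : List X}
    {M m s : ℕ} {sol : List X → List (List (X × ℝ))}
    (hsol : ∀ S : List X, S.length ≤ n →
      Halts α procs 21 (Val.ofList [encL e S, unary m, encFs e Fs, encL e pts, unary M])
        (encT α e (sol S)) s)
    (hv : ∀ S, ValidTable S (sol S)) (S : List X) (hS : S.length ≤ n)
    {acc : List (List (X × ℝ))} (hacc : ValidTable S acc) (l : List X) (hln : l.length ≤ n) :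
    Halts α procs 22 (Val.ofList [encL e l, encL e S, unary m, encFs e Fs, encL e pts,
        unary M, encT α e acc])
      (encT α e (l.foldr (fun c acc => S.foldr (fun x acc =>
        conv α (sol (far c (dist c x) S)) [[(c, dist c x)]] acc) acc) acc)) (tOuter n s) := by
  suffices h : Halts α procs 22 (Val.ofList [encL e l, encL e S, unary m, encFs e Fs, encL e pts,
        unary M, encT α e acc])
      (encT α e (l.foldr (fun c acc => S.foldr (fun x acc =>
        conv α (sol (far c (dist c x) S)) [[(c, dist c x)]] acc) acc) acc))
      ((l.length + 1) * (tInner n s + 300)) from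
    h.mono (Nat.mul_le_mul_right _ (by omega))
  clear hln
  induction l with
  | nil =>
    refine .of_wp rfl (by decide) ?_
    simp [outerBody]
  | cons c l ih =>
    refine .of_wp rfl (by decide) ?_
    have hacc' := validTable_outer (α := α) (g := fun c x => sol (far c (dist c x) S))
      (fun c x _ => hv _) hacc l
    simp [outerBody]
    refine .intro ih ?_
    refine .intro (halts_inner hsol hv S hS c hacc' S (fun _ h => h) hS) ?_
    refine ⟨rfl, ?_⟩
    linarith

/-- Time bound for `guessBody`, with time `s` for a call of `famBody`. -/
def tGuess (n s : ℕ) : ℕ → ℕ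
  | 0 => s + 300
  | m + 1 => s + tOuter n (tGuess n s m) + 300

theorem halts_guess {α : ℝ} {e : Fin n ≃ X} {Fs : List (List (List (X × ℝ)))} {pts : List X}
    (hpts : pts.length ≤ n) {M s : ℕ} {base : List X → List (List (X × ℝ))}
    (hbase : (Fs = [] ∧ base = fun _ => []) ∨ ∃ F Fs', Fs = F :: Fs' ∧
      ∀ S : List X, S.length ≤ n →
        Halts α procs 20 (Val.ofList [encF e F, encL e S, encFs e Fs', encL e pts, unary M])
          (encT α e (base S)) s)
    (hv : ∀ S, ValidTable S (base S)) (m : ℕ) (S : List X) (hS : S.length ≤ n) :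
    Halts α procs 21 (Val.ofList [encL e S, unary m, encFs e Fs, encL e pts, unary M])
      (encT α e (guess α pts base m S)) (tGuess n s m) := by
  induction m generalizing S with
  | zero =>
    refine .of_wp rfl (by decide) ?_
    cases S with
    | nil => simp [guessBody, guess, unitE, encC, candCost, tGuess]
    | cons x S =>
      rcases hbase with ⟨rfl, rfl⟩ | ⟨F, Fs', rfl, h⟩
      · simp [guessBody, guess, tGuess]
      · simp [guessBody, guess, tGuess]
        refine .intro (h (x :: S) hS) ?_
        simp
  | succ m ih =>
    refine .of_wp rfl (by decide) ?_
    cases S with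
    | nil => simp [guessBody, guess, unitE, encC, candCost, tGuess]
    | cons x S =>
      have ho := halts_outer ih (validTable_guess (α := α) (pts := pts) hv m) (x :: S) hS
        (hv (x :: S)) pts hpts
      rcases hbase with ⟨rfl, rfl⟩ | ⟨F, Fs', rfl, h⟩
      · simp [guessBody]
        refine .intro ho ⟨rfl, ?_⟩
        simp only [tGuess]; omega
      · simp [guessBody]
        refine .intro (h (x :: S) hS) ?_
        refine .intro ho ⟨rfl, ?_⟩
        simp only [tGuess]; omega

/-- Time bound for `guessBody` with `M` guesses for each of `l` scales and `f` partitions per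
scale. -/
def tSolve (n f M : ℕ) : ℕ → ℕ
  | 0 => tGuess n 0 M
  | l + 1 => tGuess n (tFam n f (tSolve n f M l)) M

theorem halts_solve (α : ℝ) (e : Fin n ≃ X) {pts : List X} (hpts : pts.length ≤ n) (M f : ℕ)
    (Fs : List (List (List (X × ℝ)))) (hFs : ∀ F ∈ Fs, F.length = f ∧ ∀ P ∈ F, P.length ≤ n)
    (S : List X) (hS : S.length ≤ n) :
    Halts α procs 21 (Val.ofList [encL e S, unary M, encFs e Fs, encL e pts, unary M])
      (encT α e (solve α pts M Fs S)) (tSolve n f M Fs.length) := by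
  induction Fs generalizing S with
  | nil =>
    exact halts_guess hpts (.inl ⟨rfl, rfl⟩) (fun S => ⟨by simp, small_nil _⟩) M S hS
  | cons F Fs ih =>
    have hF := hFs F List.mem_cons_self
    have ih := ih fun F hF => hFs F (List.mem_cons_of_mem _ hF)
    refine halts_guess hpts (.inr ⟨F, Fs, rfl, fun S hS => ?_⟩)
      (validTable_famSolve (validTable_solve α pts M Fs) F) M S hS
    rw [← hF.1]
    have := halts_fam (α := α) (e := e) (fun S hS => ih S hS) (validTable_solve α pts M Fs) S hS F
      hF.2
    rw [hF.1] at this ⊢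
    exact this

theorem levels_bounds {pts : List X} {κ δ : ℝ} {T f m : ℕ} {D : ℝ} :
    ∀ F ∈ levels pts κ δ T f m D, F.length = f ∧ ∀ P ∈ F, P.length ≤ pts.length := by
  induction m generalizing D with
  | zero => simp [levels]
  | succ m ih =>
    intro F hF
    rcases List.mem_cons.1 hF with rfl | hF
    · refine ⟨length_mwu _ _ _ _ _ _, fun P hP => ?_⟩
      obtain ⟨w, base, rfl⟩ := exists_carve_of_mem_mwu hP
      exact length_carve_le _ _ _ _ _ _ _ _
    · exact ih F hF

/-- Time bound for `setupBody`. -/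
def tSetup (n T f m M : ℕ) : ℕ :=
  (M + 1) * 300 + (m + 1) * 300 + (f + 1) * 300 + (n + 1) * 300 + (T + 1) * 300 +
    tLevels n T f m + 300

theorem halts_setup (α : ℝ) (e : Fin n ≃ X) {pts : List X} (hpts : ∀ x, x ∈ pts) (hne : pts ≠ [])
    (hn : pts.length = n) {ε : ℝ} (hε : 0 < ε) {m : ℕ} (hm : 1 ≤ m) (lg : ℕ) {D : ℝ}
    (hD : ∀ x y : X, dist x y ≤ D) :
    Halts α procs 25 (Val.ofList [encL e pts, .num n, .num ε, .num m, .num lg, .num D])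
      (.cons (unary ⌈ratio ε m lg ^ α⌉₊) (encFs e (levels pts (ratio ε m lg) (delta ε m)
        ⌈growSteps ε m lg⌉₊ ⌈rounds pts.length ε m lg⌉₊ m D)))
      (tSetup n ⌈growSteps ε m lg⌉₊ ⌈rounds n ε m lg⌉₊ m ⌈ratio ε m lg ^ α⌉₊) := by
  have hg := growSteps_pos hε hm lg
  have hr : 0 ≤ ratio ε m lg := by unfold ratio; linarith
  have hD0 : 0 ≤ D := by
    obtain ⟨x, -⟩ := List.exists_mem_of_ne_nil _ hne
    exact dist_nonneg.trans (hD x x)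
  have h1 := halts_unary α (ratio ε m lg ^ α)
  have h2 := halts_unary α m
  rw [Nat.ceil_natCast] at h2
  have h3 := halts_unary α (rounds n ε m lg)
  have h4 := halts_ones α e pts
  have h5 := halts_unary α (growSteps ε m lg)
  have h6 := halts_levels α e hr (delta ε m) hpts hne hn ⌈growSteps ε m lg⌉₊ hD
    ⌈rounds n ε m lg⌉₊ m hD0
  have hmax : max (ratio ε m lg) 0 = ratio ε m lg := max_eq_left hr
  have key : wp α procs scalesBody
      [.num (delta ε m), Val.ofList [encL e pts, .num n, .num ε, .num m, .num lg, .num D]]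
      fun w' t => w' = (.cons (unary ⌈ratio ε m lg ^ α⌉₊) (encFs e (levels pts (ratio ε m lg)
        (delta ε m) ⌈growSteps ε m lg⌉₊ ⌈rounds pts.length ε m lg⌉₊ m D))) ∧
        t + 300 ≤ (tSetup n ⌈growSteps ε m lg⌉₊ ⌈rounds n ε m lg⌉₊ m ⌈ratio ε m lg ^ α⌉₊) := by
    have e1 : (lg + 1) / delta ε m = growSteps ε m lg := rfl
    have e2 : 8 * (growSteps ε m lg + 2) = ratio ε m lg := rfl
    have e3 : n * lg / delta ε m = rounds n ε m lg := rfl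
    simp [scalesBody, e1, e2, e3, hmax]
    refine .intro h1 ?_
    refine .intro h2 ?_
    refine .intro h3 ?_
    refine .intro h4 ?_
    refine .intro h5 ?_
    refine .intro h6 ?_
    rw [hn]
    refine ⟨⟨rfl, rfl⟩, ?_⟩
    unfold tSetup
    omega
  refine .of_wp rfl (by decide) ?_
  simp [setupBody]
  refine .intro (fun h => ?_) (fun h => ?_)
  · have hd : ε / (20 * m) = delta ε m := by rw [delta, min_eq_left h]
    simpa [hd] using key
  · have hd : (m : ℝ)⁻¹ * 20⁻¹ = delta ε m := by
      rw [delta, min_eq_right h.le, one_div, mul_inv_rev]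
    simpa [hd] using key

/-! ### Correctness of the program: the whole algorithm -/

/-- The distance matrix. -/
def rows (e : Fin n ≃ X) : List (List ℝ) := List.ofFn fun i => List.ofFn fun j => dist (e i) (e j)

theorem mem_flatten_rows {e : Fin n ≃ X} {d : ℝ} :
    d ∈ (rows e).flatten ↔ ∃ x y : X, d = dist x y := by
  constructor
  · intro h
    obtain ⟨r, hr, hd⟩ := List.mem_flatten.1 h
    obtain ⟨i, rfl⟩ := (List.mem_ofFn' _ _).1 hr
    obtain ⟨j, rfl⟩ := (List.mem_ofFn' _ _).1 hd
    exact ⟨_, _, rfl⟩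
  · rintro ⟨x, y, rfl⟩
    refine List.mem_flatten.2 ⟨_, (List.mem_ofFn' _ _).2 ⟨e.symm x, rfl⟩,
      (List.mem_ofFn' _ _).2 ⟨e.symm y, by simp⟩⟩

/-- The largest distance and the least positive distance are found in one pass. -/
theorem exists_scan (α : ℝ) (hn : 2 ≤ n) (e : Fin n ≃ X) :
    ∃ D d : ℝ, 0 < d ∧ (∀ x y : X, dist x y ≤ D) ∧ (∀ x y : X, dist x y < d → x = y) ∧
      d ≤ D ∧ D / d ≤ aspectRatio X ∧ ∃ d₀ r rs, rows e = (0 :: d₀ :: r) :: rs ∧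
      Halts α procs 12 (Val.ofList
        [Val.ofList ((rows e).map fun r => Val.ofList (r.map .num)), .num d₀, .num d₀])
        (.cons (.num D) (.num d)) ((n + 1) * ((n + 1) * 300 + 300)) := by
  obtain ⟨n, rfl⟩ : ∃ k, n = k + 2 := ⟨n - 2, by omega⟩
  have hrows : ∃ r rs, rows e = (0 :: dist (e 0) (e 1) :: r) :: rs := by
    simp [rows, List.ofFn_succ]
  obtain ⟨r, rs, hr⟩ := hrows
  have hd₀ : 0 < dist (e 0) (e 1) := dist_pos.2 (by simp)
  obtain ⟨D, d, hh, ⟨h1, h2, h3⟩, h4, h5, h6⟩ := halts_scan α (n + 2) (rows e)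
    (by
      intro r hr
      obtain ⟨i, rfl⟩ := (List.mem_ofFn' _ _).1 hr
      simp) (dist (e 0) (e 1)) (dist (e 0) (e 1))
  have hD : ∃ x y : X, D = dist x y := h3.elim (fun h => ⟨_, _, h⟩) mem_flatten_rows.1
  have hd : (∃ x y : X, d = dist x y) ∧ 0 < d :=
    h6.elim (fun h => ⟨⟨_, _, h⟩, h ▸ hd₀⟩) (fun h => ⟨mem_flatten_rows.1 h.1, h.2⟩)
  obtain ⟨⟨x, y, hxy⟩, hd0⟩ := hd
  obtain ⟨x', y', hxy'⟩ := hD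
  have hne : x ≠ y := dist_pos.1 (hxy ▸ hd0)
  have : Finite X := .of_equiv _ e
  have hnt : (Set.univ : Set X).Nontrivial := ⟨x, trivial, y, trivial, hne⟩
  have hsep : 0 < (Set.univ : Set X).infsep := (Set.infsep_pos_iff_nontrivial_of_finite).2 hnt
  refine ⟨D, d, hd0, fun x y => h2 _ (mem_flatten_rows.2 ⟨x, y, rfl⟩), fun x y h => ?_, h4.trans h1,
    ?_, _, r, rs, hr, ?_⟩
  · by_contra hxy
    exact absurd h (not_lt.2 (h5 _ (mem_flatten_rows.2 ⟨x, y, rfl⟩) (dist_pos.2 hxy)))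
  · unfold aspectRatio
    gcongr
    · rw [hxy']
      exact Metric.dist_le_diam_of_mem (Set.finite_univ.isBounded) trivial trivial
    · rw [hxy]
      exact Set.infsep_le_dist_of_mem trivial trivial hne
  · simpa [rows] using hh

theorem exists_div_two_pow_lt (D : ℝ) {d : ℝ} (hd : 0 < d) : ∃ j : ℕ, D / 2 ^ j < d := by
  obtain ⟨j, hj⟩ := pow_unbounded_of_one_lt (D / d) one_lt_two
  refine ⟨j, ?_⟩
  rw [div_lt_iff₀ (by positivity)]
  rw [div_lt_iff₀ hd] at hj
  linarith

/-- Time bound for `runBody`. -/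
def tRun (n T f m M lg : ℕ) : ℕ :=
  (n + 1) * ((n + 1) * 300 + 300) + (m + 1) * 300 + (lg + 1) * 300 + tSetup n T f m M +
    tSolve n f M m + (n + 2) * 300 + 300

theorem exists_halts_run (α : ℝ) (hn : 2 ≤ n) (k : ℕ) (e : Fin n ≃ X) {ε : ℝ} (hε : 0 < ε) :
    ∃ (m lg : ℕ) (D : ℝ), 1 ≤ m ∧ (m : ℝ) ≤ logAspect X ∧ (n : ℝ) < 2 ^ lg ∧
      (lg : ℝ) ≤ Real.logb 2 n + 1 ∧ (∀ x y : X, dist x y ≤ D) ∧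
      (∀ x y : X, dist x y ≤ D / 2 ^ m → x = y) ∧
      Halts α procs 26 (Val.ofList [Val.ofList ((rows e).map fun r => Val.ofList (r.map .num)),
          encL e (List.ofFn e), .num n, .num k, .num ε])
        (encO α e (pick α ((1 + ε) * k) (table α (List.ofFn e) ε m lg D)))
        (tRun n ⌈growSteps ε m lg⌉₊ ⌈rounds n ε m lg⌉₊ m ⌈ratio ε m lg ^ α⌉₊ lg) := by
  obtain ⟨D, d, hd, hD, hsep, hdD, hasp, d₀, r, rs, hrows, hscan⟩ := exists_scan α hn e
  obtain ⟨j, hj⟩ := exists_div_two_pow_lt D hd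
  obtain ⟨m, hm, hm1, hm2⟩ := halts_halvings α j D hj
  obtain ⟨j', hj'⟩ := exists_div_two_pow_lt (n : ℝ) one_pos
  obtain ⟨lg, hlg, hlg1, hlg2⟩ := halts_halvings α j' (n : ℝ) hj'
  have hn2 : (2 : ℝ) ≤ n := by exact_mod_cast hn
  have hmpos : 1 ≤ m := by
    by_contra h
    obtain rfl : m = 0 := by omega
    rw [pow_zero, div_one] at hm1; linarith
  have hlgpos : 1 ≤ lg := by
    by_contra h
    obtain rfl : lg = 0 := by omega
    rw [pow_zero, div_one] at hlg1; linarith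
  have hpts : ∀ x, x ∈ List.ofFn e := fun x => (List.mem_ofFn' _ _).2 ⟨e.symm x, by simp⟩
  have hlen : (List.ofFn e).length = n := by simp
  have hne : List.ofFn e ≠ [] := by
    rw [← List.length_pos_iff, hlen]; omega
  have hsetup := halts_setup α e hpts hne hlen hε hmpos lg hD
  have hlev := levels_bounds (pts := List.ofFn e) (κ := ratio ε m lg) (δ := delta ε m)
    (T := ⌈growSteps ε m lg⌉₊) (f := ⌈rounds (List.ofFn e).length ε m lg⌉₊) (m := m) (D := D)
  rw [hlen] at hlev
  have hsolve := halts_solve α e hlen.le ⌈ratio ε m lg ^ α⌉₊ ⌈rounds n ε m lg⌉₊ _ hlev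
    (List.ofFn e) hlen.le
  rw [length_levels] at hsolve
  have hpick := halts_pick α e ((1 + ε) * k) (table α (List.ofFn e) ε m lg D)
  have htab : (table α (List.ofFn e) ε m lg D).length ≤ n + 1 := by
    have := (validTable_solve α (List.ofFn e) ⌈ratio ε m lg ^ α⌉₊ (levels (List.ofFn e)
      (ratio ε m lg) (delta ε m) ⌈growSteps ε m lg⌉₊ ⌈rounds (List.ofFn e).length ε m lg⌉₊ m D)
      (List.ofFn e)).2.length_le
    rw [hlen] at this
    rwa [table, hlen]
  replace hpick := hpick.mono (T' := (n + 2) * 300) (by omega)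
  refine ⟨m, lg, D, hmpos, ?_, ?_, ?_, hD, fun x y h => hsep x y (h.trans_lt hm1), ?_⟩
  · have h := hm2 (m - 1) (by omega)
    rw [le_div_iff₀ (by positivity), mul_comm, ← le_div_iff₀ hd] at h
    have h' := Real.logb_le_logb_of_le one_lt_two (by positivity) (h.trans hasp)
    rw [Real.logb_pow, Real.logb_self_eq_one one_lt_two, Nat.cast_sub hmpos] at h'
    unfold logAspect
    push_cast at h'; linarith
  · rwa [div_lt_one (by positivity)] at hlg1
  · have h := hlg2 (lg - 1) (by omega)
    rw [le_div_iff₀ (by positivity), one_mul] at h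
    have h' := Real.logb_le_logb_of_le one_lt_two (by positivity) h
    rw [Real.logb_pow, Real.logb_self_eq_one one_lt_two, Nat.cast_sub hlgpos] at h'
    push_cast at h'; linarith
  · rw [table, hlen] at hpick ⊢
    rw [hrows] at hscan ⊢
    refine .of_wp rfl (by decide) ?_
    simp [runBody]
    refine .intro hscan ?_
    simp
    refine .intro hm ?_
    refine .intro hlg ?_
    refine .intro hsetup ?_
    simp
    refine .intro hsolve ?_
    refine .intro hpick ?_
    refine ⟨rfl, ?_⟩
    unfold tRun
    omega

theorem runs_algorithm {α : ℝ} {e : Fin n ≃ X} {k : ℕ} {ε : ℝ} {u : List (X × ℝ)} {T : ℕ}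
    (h : Halts α procs 26 (Val.ofList [Val.ofList ((rows e).map fun r => Val.ofList (r.map .num)),
      encL e (List.ofFn e), .num n, .num k, .num ε]) (encC α e u) T) (ω : Tape) :
    ∃ t ≤ (n + 1) * 300 + T + 300, algorithm.Runs α ω (encodeInstance e k ε) (encB e u) t := by
  have h1 := halts_index α ((rows e).map fun r => Val.ofList (r.map .num)) 0
  have h2 : numbered ((rows e).map fun r => Val.ofList (r.map .num)) 0 =
      (List.ofFn e).map (encP e) := by
    simp only [rows, List.map_ofFn, numbered_ofFn]
    congr 1
    funext i
    simp [encP, Function.comp_def]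
  have h3 : encodeInstance e k ε = .cons (.num n) (.cons (.num k) (.cons (.num ε)
      (Val.ofList ((rows e).map fun r => Val.ofList (r.map .num))))) := by
    simp [encodeInstance, rows, Function.comp_def]
  have key : wp α procs algorithm.main [encodeInstance e k ε] fun w' t => w' = encB e u ∧
      t ≤ (n + 1) * 300 + T := by
    rw [h2] at h1
    rw [encL] at h
    simp only [List.map_ofFn] at h
    rw [h3]
    simp [algorithm]
    refine .intro (by simpa using h1) ?_
    refine .intro h ?_
    simp [encC, rows]
  obtain ⟨w, t, ⟨rfl, ht⟩, hrun⟩ := wp_sound _ key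
  obtain ⟨s, hs, hev⟩ := hrun ω 0
  refine ⟨s, ?_, 0, hev⟩
  have : size algorithm.main ≤ 300 := by decide
  omega

end

noncomputable section

/-! ### The running time -/

/-- `f` is at most `N ^ O(E)`, where `N ≥ 2` and `E ≥ 1`. -/
def PowBounded {ι : Type*} (N : ι → ℕ) (E : ι → ℝ) (f : ι → ℕ) : Prop :=
  (∀ i, 2 ≤ N i ∧ 1 ≤ E i) ∧ ∃ C : ℝ, 0 ≤ C ∧ ∀ i, (f i : ℝ) ≤ (N i : ℝ) ^ (C * E i)

namespace PowBounded

variable {ι : Type*} {N : ι → ℕ} {E E' : ι → ℝ} {f g : ι → ℕ}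

theorem mono (hf : PowBounded N E f) (h : ∀ i, g i ≤ f i) : PowBounded N E g := by
  obtain ⟨h0, C, hC, hf⟩ := hf
  exact ⟨h0, C, hC, fun i => le_trans (by exact_mod_cast h i) (hf i)⟩

theorem of_le (h0 : ∀ i, 2 ≤ N i ∧ 1 ≤ E i) (c : ℝ) (h : ∀ i, (f i : ℝ) ≤ c * E i) :
    PowBounded N E f := by
  refine ⟨h0, |c| + 2, by positivity, fun i => ?_⟩
  obtain ⟨hN, hE⟩ := h0 i
  have hN : (2 : ℝ) ≤ N i := by exact_mod_cast hN
  have hc := abs_nonneg c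
  -- Bernoulli's inequality
  have h1 := one_add_mul_self_le_rpow_one_add (s := 1) (by norm_num)
    (p := (|c| + 1) * E i) (by nlinarith)
  calc (f i : ℝ) ≤ c * E i := h i
    _ ≤ |c| * E i := by gcongr; exact le_abs_self c
    _ ≤ (1 + 1 : ℝ) ^ ((|c| + 1) * E i) := by nlinarith
    _ ≤ (N i : ℝ) ^ ((|c| + 1) * E i) := by gcongr; linarith
    _ ≤ (N i : ℝ) ^ ((|c| + 2) * E i) :=
        Real.rpow_le_rpow_of_exponent_le (by linarith) (by gcongr; norm_num)

theorem const (hf : PowBounded N E f) (c : ℕ) : PowBounded N E fun _ => c :=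
  of_le hf.1 c fun i => le_mul_of_one_le_right (Nat.cast_nonneg c) (hf.1 i).2

theorem mul (hf : PowBounded N E f) (hg : PowBounded N E g) :
    PowBounded N E fun i => f i * g i := by
  obtain ⟨h0, C, hC, hf⟩ := hf
  obtain ⟨-, C', hC', hg⟩ := hg
  refine ⟨h0, C + C', by positivity, fun i => ?_⟩
  obtain ⟨hN, hE⟩ := h0 i
  have hN : (2 : ℝ) ≤ N i := by exact_mod_cast hN
  rw [add_mul, Real.rpow_add (by linarith), Nat.cast_mul]
  exact mul_le_mul (hf i) (hg i) (by positivity) (by positivity)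

theorem max_one (hf : PowBounded N E f) : PowBounded N E fun i => max 1 (f i) := by
  obtain ⟨h0, C, hC, hf⟩ := hf
  refine ⟨h0, C, hC, fun i => ?_⟩
  have hN : (1 : ℝ) ≤ N i := by exact_mod_cast (by linarith [(h0 i).1] : 1 ≤ N i)
  have hE := (h0 i).2
  rw [Nat.cast_max, Nat.cast_one]
  exact max_le (Real.one_le_rpow hN (by positivity)) (hf i)

theorem add (hf : PowBounded N E f) (hg : PowBounded N E g) :
    PowBounded N E fun i => f i + g i := by
  refine ((hf.const 2).mul (hf.max_one.mul hg.max_one)).mono fun i => ?_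
  nlinarith [le_max_left 1 (f i), le_max_right 1 (f i), le_max_left 1 (g i), le_max_right 1 (g i)]

theorem add_const (hf : PowBounded N E f) (c : ℕ) : PowBounded N E fun i => f i + c :=
  hf.add (hf.const c)

theorem mul_const (hf : PowBounded N E f) (c : ℕ) : PowBounded N E fun i => f i * c :=
  hf.mul (hf.const c)

theorem pow (hf : PowBounded N E f) (hE' : ∀ i, 1 ≤ E' i) (c : ℝ)
    (h : ∀ i, g i * E i ≤ c * E' i) : PowBounded N E' fun i => f i ^ g i := by
  obtain ⟨h0, C, hC, hf⟩ := hf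
  refine ⟨fun i => ⟨(h0 i).1, hE' i⟩, C * |c|, by positivity, fun i => ?_⟩
  have hN : (1 : ℝ) ≤ N i := by exact_mod_cast (by linarith [(h0 i).1] : 1 ≤ N i)
  have hE := hE' i
  rw [Nat.cast_pow]
  calc (f i : ℝ) ^ g i ≤ ((N i : ℝ) ^ (C * E i)) ^ g i := by gcongr; exact hf i
    _ = (N i : ℝ) ^ (C * (g i * E i)) := by
        rw [← Real.rpow_natCast, ← Real.rpow_mul (by linarith)]; congr 1; ring
    _ ≤ (N i : ℝ) ^ (C * |c| * E' i) := by
        refine Real.rpow_le_rpow_of_exponent_le hN ?_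
        rw [mul_assoc]
        refine mul_le_mul_of_nonneg_left ((h i).trans ?_) hC
        gcongr
        exact le_abs_self c

end PowBounded

section

variable {ι : Type*} {N : ι → ℕ} {E : ι → ℝ} {n T f m : ι → ℕ}

theorem powBounded_self (h0 : ∀ i, 2 ≤ N i ∧ 1 ≤ E i) : PowBounded N E N := by
  refine ⟨h0, 1, zero_le_one, fun i => ?_⟩
  have hN : (1 : ℝ) ≤ N i := by exact_mod_cast (by linarith [(h0 i).1] : 1 ≤ N i)
  calc (N i : ℝ) = (N i : ℝ) ^ (1 : ℝ) := (Real.rpow_one _).symm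
    _ ≤ _ := Real.rpow_le_rpow_of_exponent_le hN (by linarith [(h0 i).2])

theorem powBounded_tDist (hn : PowBounded N E n) : PowBounded N E fun i => tDist (n i) :=
  (hn.const 300).mul hn

theorem powBounded_tPart (hn : PowBounded N E n) : PowBounded N E fun i => tPart (n i) :=
  (hn.add_const 1).mul ((powBounded_tDist hn).add_const 300)

theorem powBounded_tConv (hn : PowBounded N E n) : PowBounded N E fun i => tConv (n i) :=
  (hn.add_const 2).mul (((hn.add_const 2).mul ((((hn.add_const 1).mul_const 300).add
    ((hn.add_const 2).mul_const 300)).add_const 300)).add_const 300)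

theorem powBounded_tSetup (hn : PowBounded N E n) (hT : PowBounded N E T) (hf : PowBounded N E f)
    (hm : PowBounded N E m) {M : ι → ℕ} (hM : PowBounded N E M) :
    PowBounded N E fun i => tSetup (n i) (T i) (f i) (m i) (M i) := by
  have h1 := powBounded_tDist hn
  have h2 := powBounded_tPart hn
  have hvol : PowBounded N E fun i => tVol (n i) :=
    (hn.add_const 1).mul ((h2.add h1).add_const 300)
  have hgrow : PowBounded N E fun i => tGrow (n i) (T i) :=
    (hT.add_const 1).mul (((hn.const 2).mul hvol).add_const 300)
  have hcarve : PowBounded N E fun i => tCarve (n i) (T i) :=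
    (hn.add_const 1).mul ((hgrow.add h2).add_const 300)
  have hmeet : PowBounded N E fun i => tMeet (n i) := (hn.add_const 1).mul (h2.add_const 300)
  have hupd : PowBounded N E fun i => tUpd (n i) :=
    (hn.add_const 1).mul ((h2.add hmeet).add_const 300)
  have hmwu : PowBounded N E fun i => tMwu (n i) (T i) (f i) :=
    (hf.add_const 1).mul (((hvol.add hcarve).add hupd).add_const 300)
  have hlev : PowBounded N E fun i => tLevels (n i) (T i) (f i) (m i) :=
    (hm.add_const 1).mul (hmwu.add_const 300)
  exact (((((((hM.add_const 1).mul_const 300).add ((hm.add_const 1).mul_const 300)).add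
    ((hf.add_const 1).mul_const 300)).add ((hn.add_const 1).mul_const 300)).add
    ((hT.add_const 1).mul_const 300)).add hlev).add_const 300

end

/-- A factor bounding the growth of the running time with each guess of a ball. -/
def guessFactor (n : ℕ) : ℕ :=
  (n + 1) * ((n + 1) * (tPart n + tDist n + tConv n + 300 + 1) + 300) + (300 + 2)

/-- A factor bounding the growth of the running time with each scale, for `f` partitions. -/
def scaleFactor (n f : ℕ) : ℕ :=
  (f + 1) * ((n + 1) * (tPart n + tConv n + 300 + 1) + (tConv n + 300)) + 1

theorem mul_add_le_mul_mul (P Q a b x : ℕ) :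
    Q * (P * (x + a) + b) ≤ Q * (P * (a + 1) + b) * (x + 1) := by
  rw [mul_assoc]
  refine Nat.mul_le_mul_left Q ?_
  have h1 : P * (x + a) ≤ P * ((a + 1) * (x + 1)) := Nat.mul_le_mul_left P (by nlinarith)
  have h2 : b * 1 ≤ b * (x + 1) := Nat.mul_le_mul_left b (by omega)
  linarith

theorem add_mul_add_le_mul_mul {P Q a b c s x : ℕ} (hs : s ≤ x) :
    s + Q * (P * (x + a) + b) + c + 1 ≤ (Q * (P * (a + 1) + b) + (c + 2)) * (x + 1) := by
  have h := mul_add_le_mul_mul P Q a b x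
  nlinarith [Nat.zero_le (c * x)]

theorem tGuess_lt (n s M : ℕ) : tGuess n s M + 1 ≤ guessFactor n ^ (M + 1) * (s + 1) := by
  have h1 : ∀ x, s ≤ x → s + tOuter n x + 300 + 1 ≤ guessFactor n * (x + 1) := by
    intro x hx
    unfold guessFactor tOuter tInner
    rw [show x + tPart n + tDist n + tConv n + 300 =
      x + (tPart n + tDist n + tConv n + 300) by omega]
    exact add_mul_add_le_mul_mul hx
  have h2 : ∀ M, s ≤ tGuess n s M := by
    intro M
    cases M <;> simp only [tGuess] <;> omega
  induction M with
  | zero =>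
    have := h1 s le_rfl
    simp only [tGuess]
    rw [zero_add, pow_one]
    omega
  | succ M ih =>
    calc tGuess n s (M + 1) + 1 ≤ guessFactor n * (tGuess n s M + 1) := h1 _ (h2 M)
      _ ≤ guessFactor n * (guessFactor n ^ (M + 1) * (s + 1)) := by gcongr
      _ = _ := by ring

/-- Only the guesses of balls, whose number enters as an exponent, contribute a factor that is
independent of the number `f` of partitions per scale. -/
theorem tSolve_lt (n f M l : ℕ) :
    tSolve n f M l + 1 ≤ guessFactor n ^ ((M + 1) * (l + 1)) * scaleFactor n f ^ l := by
  induction l with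
  | zero => simpa [tSolve] using tGuess_lt n 0 M
  | succ l ih =>
    have h : tFam n f (tSolve n f M l) + 1 ≤ scaleFactor n f * (tSolve n f M l + 1) := by
      unfold tFam scaleFactor
      rw [show tSolve n f M l + tPart n + tConv n + 300 =
        tSolve n f M l + (tPart n + tConv n + 300) by omega]
      rw [add_assoc _ (tConv n), add_mul (_ * _) 1, one_mul]
      exact add_le_add (mul_add_le_mul_mul _ _ _ _ _) (by omega)
    calc tSolve n f M (l + 1) + 1 ≤ guessFactor n ^ (M + 1) * (tFam n f (tSolve n f M l) + 1) :=
          tGuess_lt n _ M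
      _ ≤ guessFactor n ^ (M + 1) * (scaleFactor n f *
          (guessFactor n ^ ((M + 1) * (l + 1)) * scaleFactor n f ^ l)) := by
          gcongr; exact h.trans (by gcongr)
      _ = _ := by ring

/-- The quantities on which the running time depends, with the bounds that hold for them. -/
structure TimeParams where
  n : ℕ
  m : ℕ
  lg : ℕ
  ε : ℝ
  L : ℝ
  two_le_n : 2 ≤ n
  one_le_m : 1 ≤ m
  m_le : (m : ℝ) ≤ L
  lg_le : (lg : ℝ) ≤ Real.logb 2 n + 1
  ε_pos : 0 < ε

namespace TimeParams

/-- `L log n / ε` -/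
def Lam (p : TimeParams) : ℝ := p.L * Real.logb 2 p.n / min p.ε 1

variable (p : TimeParams)

theorem one_le_logb : 1 ≤ Real.logb 2 p.n := by
  rw [Real.le_logb_iff_rpow_le one_lt_two (by have := p.two_le_n; positivity), Real.rpow_one]
  exact_mod_cast p.two_le_n

theorem one_le_L : 1 ≤ p.L := le_trans (by exact_mod_cast p.one_le_m) p.m_le

theorem min_pos : 0 < min p.ε 1 := lt_min p.ε_pos one_pos

theorem mul_le_Lam : p.L * Real.logb 2 p.n ≤ p.Lam := by
  have h1 := p.one_le_logb
  have h2 := p.one_le_L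
  exact le_div_self (by positivity) p.min_pos (min_le_right _ _)

theorem L_le_Lam : p.L ≤ p.Lam :=
  (le_mul_of_one_le_right (by linarith [p.one_le_L]) p.one_le_logb).trans p.mul_le_Lam

theorem logb_le_Lam : Real.logb 2 p.n ≤ p.Lam :=
  (le_mul_of_one_le_left (by linarith [p.one_le_logb]) p.one_le_L).trans p.mul_le_Lam

theorem one_le_Lam : 1 ≤ p.Lam := p.one_le_L.trans p.L_le_Lam

theorem div_delta_le {x c : ℝ} (hx : 0 ≤ x) (h : x ≤ c * Real.logb 2 p.n) :
    x / delta p.ε p.m ≤ 20 * c * p.Lam := by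
  have h1 := p.min_pos
  have h2 : (1 : ℝ) ≤ p.m := by exact_mod_cast p.one_le_m
  calc x / delta p.ε p.m = 20 * (x * p.m) / min p.ε 1 := by unfold delta; field_simp
    _ ≤ 20 * (c * Real.logb 2 p.n * p.L) / min p.ε 1 := by
        have := p.m_le
        gcongr
        exact hx.trans h
    _ = _ := by unfold Lam; ring

theorem growSteps_le : growSteps p.ε p.m p.lg ≤ 60 * p.Lam := by
  have h := p.div_delta_le (x := p.lg + 1) (c := 3) (by positivity)
    (by linarith [p.lg_le, p.one_le_logb])
  unfold growSteps; linarith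

theorem rounds_le : rounds p.n p.ε p.m p.lg ≤ p.n * (40 * p.Lam) := by
  have h := p.div_delta_le (x := p.lg) (c := 2) (by positivity)
    (by linarith [p.lg_le, p.one_le_logb])
  unfold rounds
  rw [mul_div_assoc]
  gcongr
  linarith

theorem ratio_nonneg : 0 ≤ ratio p.ε p.m p.lg := by
  have := growSteps_pos p.ε_pos p.one_le_m p.lg
  unfold ratio; linarith

theorem ratio_rpow_le {α : ℝ} (hα : 1 ≤ α) :
    ratio p.ε p.m p.lg ^ α ≤ 496 ^ α * p.Lam ^ α := by
  have h1 := p.one_le_Lam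
  rw [← Real.mul_rpow (by norm_num) (by linarith)]
  refine Real.rpow_le_rpow p.ratio_nonneg ?_ (by linarith)
  have := p.growSteps_le
  unfold ratio; linarith

/-- The bound for the number of steps of the algorithm, in terms of the computed parameters. -/
def time (α : ℝ) : ℕ :=
  (p.n + 1) * 300 + tRun p.n ⌈growSteps p.ε p.m p.lg⌉₊ ⌈rounds p.n p.ε p.m p.lg⌉₊ p.m
    ⌈ratio p.ε p.m p.lg ^ α⌉₊ p.lg + 300

theorem powBounded_time {α : ℝ} (hα : 1 ≤ α) :
    PowBounded n (fun p => p.Lam ^ α * p.L) fun p => p.time α := by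
  have hΛα : ∀ p : TimeParams, p.Lam ≤ p.Lam ^ α := fun p =>
    Real.self_le_rpow_of_one_le p.one_le_Lam hα
  have hΛα1 : ∀ p : TimeParams, 1 ≤ p.Lam ^ α := fun p => p.one_le_Lam.trans (hΛα p)
  have hE : ∀ p : TimeParams, p.Lam ^ α ≤ p.Lam ^ α * p.L := fun p =>
    le_mul_of_one_le_right (by linarith [hΛα1 p]) p.one_le_L
  have hE1 : ∀ p : TimeParams, 1 ≤ p.Lam ^ α * p.L := fun p => (hΛα1 p).trans (hE p)
  have h0 : ∀ p : TimeParams, 2 ≤ p.n ∧ 1 ≤ p.Lam ^ α * p.L := fun p => ⟨p.two_le_n, hE1 p⟩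
  have h0' : ∀ p : TimeParams, 2 ≤ p.n ∧ 1 ≤ p.Lam := fun p => ⟨p.two_le_n, p.one_le_Lam⟩
  have hM : ∀ p : TimeParams, (⌈ratio p.ε p.m p.lg ^ α⌉₊ : ℝ) ≤ (496 ^ α + 1) * p.Lam ^ α :=
    fun p => by
      have h1 := Nat.ceil_lt_add_one (Real.rpow_nonneg p.ratio_nonneg α)
      linarith [p.ratio_rpow_le hα, hΛα1 p]
  -- The parameters of the algorithm are bounded.
  have bn := powBounded_self h0
  have bT : PowBounded n (fun p => p.Lam ^ α * p.L) fun p => ⌈growSteps p.ε p.m p.lg⌉₊ :=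
    .of_le h0 61 fun p => by
      have h1 := Nat.ceil_lt_add_one (growSteps_pos p.ε_pos p.one_le_m p.lg).le
      linarith [p.growSteps_le, p.one_le_Lam, hΛα p, hE p]
  have bm : PowBounded n (fun p => p.Lam ^ α * p.L) m :=
    .of_le h0 1 fun p => by linarith [p.m_le, p.L_le_Lam, hΛα p, hE p]
  have blg : PowBounded n (fun p => p.Lam ^ α * p.L) lg :=
    .of_le h0 2 fun p => by
      linarith [p.lg_le, p.one_le_logb, p.logb_le_Lam, hΛα p, hE p]
  have bM : PowBounded n (fun p => p.Lam ^ α * p.L) fun p => ⌈ratio p.ε p.m p.lg ^ α⌉₊ :=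
    .of_le h0 (496 ^ α + 1) fun p => (hM p).trans (by gcongr; exact hE p)
  have hf : ∀ p : TimeParams, ⌈rounds p.n p.ε p.m p.lg⌉₊ ≤ p.n * ⌈40 * p.Lam⌉₊ := fun p => by
    refine Nat.ceil_le.2 (p.rounds_le.trans ?_)
    push_cast
    gcongr
    exact Nat.le_ceil _
  have bf' : PowBounded n Lam fun p => ⌈rounds p.n p.ε p.m p.lg⌉₊ :=
    ((powBounded_self h0').mul (.of_le h0' 41 fun p => by
      have h1 := Nat.ceil_lt_add_one (by linarith [p.one_le_Lam] : 0 ≤ 40 * p.Lam)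
      linarith [p.one_le_Lam])).mono hf
  have bf : PowBounded n (fun p => p.Lam ^ α * p.L) fun p => ⌈rounds p.n p.ε p.m p.lg⌉₊ :=
    ((bf'.pow (g := fun _ => 1) hE1 1 fun p => by
      push_cast; linarith [hΛα p, hE p])).mono fun p => by simp
  -- The two factors in the bound for the time of the recursion.
  have b1 : PowBounded n (fun p => p.Lam ^ α * p.L) fun p =>
      guessFactor p.n ^ ((⌈ratio p.ε p.m p.lg ^ α⌉₊ + 1) * (p.m + 1)) := by
    have hn : PowBounded n (fun _ => 1) n := powBounded_self fun p => ⟨p.two_le_n, le_rfl⟩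
    have h : PowBounded n (fun _ => 1) fun p => guessFactor p.n :=
      ((hn.add_const 1).mul (((hn.add_const 1).mul ((((powBounded_tPart hn).add
        (powBounded_tDist hn)).add (powBounded_tConv hn)).add_const 300 |>.add_const 1)).add_const
        300)).add_const (300 + 2)
    refine h.pow hE1 ((496 ^ α + 2) * 2) fun p => ?_
    push_cast
    rw [mul_one]
    have h1 : (⌈ratio p.ε p.m p.lg ^ α⌉₊ : ℝ) + 1 ≤ (496 ^ α + 2) * p.Lam ^ α := by
      linarith [hM p, hΛα1 p]
    have h2 : (p.m : ℝ) + 1 ≤ 2 * p.L := by linarith [p.m_le, p.one_le_L]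
    calc _ ≤ (496 ^ α + 2) * p.Lam ^ α * (2 * p.L) := mul_le_mul h1 h2 (by positivity)
            (by linarith [hΛα1 p, Nat.cast_nonneg (α := ℝ) ⌈ratio p.ε p.m p.lg ^ α⌉₊])
      _ = _ := by ring
  have b2 : PowBounded n (fun p => p.Lam ^ α * p.L) fun p =>
      scaleFactor p.n ⌈rounds p.n p.ε p.m p.lg⌉₊ ^ p.m := by
    have hn := powBounded_self h0'
    have h : PowBounded n Lam fun p => scaleFactor p.n ⌈rounds p.n p.ε p.m p.lg⌉₊ :=
      ((bf'.add_const 1).mul ((((hn.add_const 1).mul (((powBounded_tPart hn).add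
        (powBounded_tConv hn)).add_const 300 |>.add_const 1)).add
        ((powBounded_tConv hn).add_const 300)))).add_const 1
    refine h.pow hE1 1 fun p => ?_
    rw [one_mul, mul_comm]
    exact mul_le_mul (hΛα p) p.m_le (by positivity) (by linarith [hΛα1 p])
  have bS : PowBounded n (fun p => p.Lam ^ α * p.L) fun p =>
      tSolve p.n ⌈rounds p.n p.ε p.m p.lg⌉₊ ⌈ratio p.ε p.m p.lg ^ α⌉₊ p.m :=
    (b1.mul b2).mono fun p => (Nat.le_succ _).trans (tSolve_lt _ _ _ _)
  exact (((bn.add_const 1).mul_const 300).add (((((((bn.add_const 1).mul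
    (((bn.add_const 1).mul_const 300).add_const 300)).add ((bm.add_const 1).mul_const 300)).add
    ((blg.add_const 1).mul_const 300)).add (powBounded_tSetup bn bT bf bm bM)).add bS).add
    ((bn.add_const 2).mul_const 300) |>.add_const 300)).add_const 300

end TimeParams

end

noncomputable section

variable {X : Type} {n : ℕ}

/-! ### Solutions close to the optimum -/

/-- A candidate with nonnegative radii, as a family of balls. -/
def toBalls (b : List (X × ℝ)) (hb : ∀ q ∈ b, 0 ≤ q.2) : List (Ball X) :=
  b.attach.map fun q => ⟨q.1.1, q.1.2, hb q.1 q.2⟩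

theorem length_toBalls {b : List (X × ℝ)} (hb : ∀ q ∈ b, 0 ≤ q.2) :
    (toBalls b hb).length = b.length := by
  simp [toBalls]

theorem cost_toBalls (α : ℝ) {b : List (X × ℝ)} (hb : ∀ q ∈ b, 0 ≤ q.2) :
    cost α (toBalls b hb) = candCost α b := by
  simp only [cost, toBalls, candCost, List.map_map]
  exact congrArg List.sum (List.attach_map_val (l := b) (f := fun q => q.2 ^ α))

theorem encodeBalls_toBalls (e : Fin n ≃ X) {b : List (X × ℝ)} (hb : ∀ q ∈ b, 0 ≤ q.2) :
    encodeBalls e (toBalls b hb) = encB e b := by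
  simp only [encodeBalls, toBalls, encB, List.map_map]
  exact congrArg Val.ofList
    (List.attach_map_val (l := b) (f := fun q => Val.cons (.num ((e.symm q.1 : ℕ) : ℝ)) (.num q.2)))

variable [MetricSpace X]

theorem covers_toBalls {b : List (X × ℝ)} (hb : ∀ q ∈ b, 0 ≤ q.2)
    (h : ∀ x, ∃ q ∈ b, dist q.1 x ≤ q.2) : Covers (toBalls b hb) := by
  intro x
  obtain ⟨q, hq, hx⟩ := h x
  exact ⟨⟨q.1, q.2, hb q hq⟩, List.mem_map.2 ⟨⟨q, hq⟩, List.mem_attach _ _, rfl⟩,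
    Metric.mem_closedBall'.2 hx⟩

omit [MetricSpace X] in
theorem cost_nonneg (α : ℝ) (B : List (Ball X)) : 0 ≤ cost α B := by
  refine List.sum_nonneg fun x hx => ?_
  obtain ⟨b, -, rfl⟩ := List.mem_map.1 hx
  exact Real.rpow_nonneg b.radius_nonneg α

theorem optCost_nonneg (α : ℝ) (k : ℕ) : 0 ≤ optCost X α k := by
  refine Real.sInf_nonneg ?_
  rintro _ ⟨B, -, -, rfl⟩
  exact cost_nonneg α B

/-- Solutions with cost arbitrarily close to the optimum, as candidates. -/
theorem exists_candCost_lt (α : ℝ) {D : ℝ} (hD : ∀ x y : X, dist x y ≤ D) (x₀ : X) {k : ℕ}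
    (hk : 1 ≤ k) {η : ℝ} (hη : 0 < η) :
    ∃ b : List (X × ℝ), (∀ q ∈ b, 0 ≤ q.2) ∧ (∀ x : X, ∃ q ∈ b, dist q.1 x ≤ q.2) ∧
      b.length ≤ k ∧ candCost α b ≤ optCost X α k + η := by
  -- A single large ball is a solution.
  have hne : {c | ∃ B : List (Ball X), B.length ≤ k ∧ Covers B ∧ cost α B = c}.Nonempty :=
    ⟨_, [⟨x₀, D, dist_nonneg.trans (hD x₀ x₀)⟩], hk,
      fun x => ⟨_, List.mem_singleton_self _, Metric.mem_closedBall.2 (hD _ _)⟩, rfl⟩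
  obtain ⟨_, ⟨B, hBk, hB, rfl⟩, hlt⟩ := exists_lt_of_csInf_lt hne
    (lt_add_of_pos_right (optCost X α k) hη)
  refine ⟨B.map fun b => (b.center, b.radius), ?_, fun x => ?_, by simpa using hBk, ?_⟩
  · intro q hq
    obtain ⟨b, -, rfl⟩ := List.mem_map.1 hq
    exact b.radius_nonneg
  · obtain ⟨b, hb, hx⟩ := hB x
    exact ⟨_, List.mem_map_of_mem hb, Metric.mem_closedBall'.1 hx⟩
  · simpa [candCost, cost, Function.comp_def] using hlt.le

/-- The candidate picked does not depend on the slack `η` for which the solutions are compared with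
the optimum, so that `η` can tend to `0`. -/
theorem pick_table {α : ℝ} (hα : 1 ≤ α) {pts : List X} (hpts : ∀ x, x ∈ pts) (hne : pts ≠ [])
    {ε : ℝ} (hε : 0 < ε) {m lg : ℕ} (hm : 1 ≤ m) (hlg : (pts.length : ℝ) < 2 ^ lg) {D : ℝ}
    (hD : ∀ x y : X, dist x y ≤ D) (hsep : ∀ x y : X, dist x y ≤ D / 2 ^ m → x = y) {k : ℕ}
    (hk : 1 ≤ k) :
    ∃ u, pick α ((1 + ε) * k) (table α pts ε m lg D) = some u ∧ Valid pts u ∧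
      (u.length : ℝ) ≤ (1 + ε) * k ∧ candCost α u ≤ (1 + ε) * optCost X α k := by
  obtain ⟨x₀, -⟩ := List.exists_mem_of_ne_nil _ hne
  have h : ∀ η : ℝ, 0 < η → ∃ u ∈ table α pts ε m lg D,
      pick α ((1 + ε) * k) (table α pts ε m lg D) = some u ∧
      (u.length : ℝ) ≤ (1 + ε) * k ∧ candCost α u ≤ (1 + ε) * (optCost X α k + η) := by
    intro η hη
    obtain ⟨b, hb, hcov, hbk, hbc⟩ := exists_candCost_lt α hD x₀ hk hη
    obtain ⟨t, ht, htk, htc⟩ := exists_mem_table hα hpts hne hε hm hlg hD hsep hk hb hcov hbk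
      (by linarith [optCost_nonneg (X := X) α k]) hbc
    obtain ⟨u, hu, hpick, huk, huc⟩ := exists_pick_eq_some (α := α) ht htk
    exact ⟨u, hu, hpick, huk, huc.trans htc⟩
  obtain ⟨u, hu, hpick, huk, -⟩ := h 1 one_pos
  refine ⟨u, hpick, (validTable_solve α pts _ _ pts).1 u hu, huk, ?_⟩
  refine le_of_forall_pos_le_add fun η hη => ?_
  obtain ⟨u', -, hpick', -, h'⟩ := h (η / (1 + ε)) (by positivity)
  obtain rfl := Option.some.inj (hpick.symm.trans hpick')
  rwa [mul_add, mul_div_cancel₀ _ (by positivity)] at h'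

end

end KClustering

theorem mainTheorem3 (α : ℝ) (hα : 1 ≤ α) :
    ∃ (A : Program) (C : ℝ),
      ∀ (X : Type) [MetricSpace X] (n k : ℕ) (e : Fin n ≃ X) (ε : ℝ),
        2 ≤ n → 1 ≤ k → 0 < ε →
        (∀ ω : Tape, ∃ (out : Val) (t : ℕ),
          A.Runs α ω (encodeInstance e k ε) out t ∧
          (t : ℝ) ≤ (n : ℝ) ^
            (C * ((logAspect X * Real.logb 2 n / min ε 1) ^ α * logAspect X))) ∧
        tapeMeasure {ω : Tape | ¬ ∃ B : List (Ball X),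
          (∃ t : ℕ, A.Runs α ω (encodeInstance e k ε) (encodeBalls e B) t) ∧
          Covers B ∧
          (B.length : ℝ) ≤ (1 + ε) * k ∧
          cost α B ≤ (1 + ε) * optCost X α k} ≤ ENNReal.ofReal (1 / n) := by
  -- The constant does not depend on the instance: `powBounded_time` is uniform in all parameters.
  obtain ⟨-, C, -, hC⟩ := KClustering.TimeParams.powBounded_time hα
  refine ⟨KClustering.algorithm, C, fun X _ n k e ε hn hk hε => ?_⟩
  obtain ⟨m, lg, D, hm, hmL, hlg, hlg', hD, hsep, hrun⟩ :=
    KClustering.exists_halts_run α hn k e hε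
  have hpts : ∀ x, x ∈ List.ofFn e := fun x => (List.mem_ofFn' _ _).2 ⟨e.symm x, by simp⟩
  have hlen : (List.ofFn e).length = n := by simp
  have hne : List.ofFn e ≠ [] := by
    rw [← List.length_pos_iff, hlen]; omega
  obtain ⟨u, hu, ⟨hcov, hrad, -⟩, huk, huc⟩ :=
    KClustering.pick_table hα hpts hne hε hm (by rwa [hlen]) hD hsep hk
  rw [hu] at hrun
  have hruns := KClustering.runs_algorithm hrun
  refine ⟨fun ω => ?_, ?_⟩
  · obtain ⟨t, ht, h⟩ := hruns ω
    exact ⟨_, t, h, le_trans (by exact_mod_cast ht) (hC ⟨n, m, lg, ε, _, hn, hm, hmL, hlg', hε⟩)⟩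
  · -- The algorithm does not use the random source and never fails.
    refine (MeasureTheory.measure_mono_null (t := ∅) (fun ω (h : ¬ _) => (h ?_).elim)
      MeasureTheory.measure_empty).trans_le zero_le
    obtain ⟨t, -, h⟩ := hruns ω
    refine ⟨KClustering.toBalls u hrad, ⟨t, ?_⟩, ?_, ?_, ?_⟩
    · rwa [KClustering.encodeBalls_toBalls]
    · exact KClustering.covers_toBalls hrad fun x => hcov x (hpts x)
    · rwa [KClustering.length_toBalls]
    · rwa [KClustering.cost_toBalls]
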